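/- **Setting.** Let $\Omega=(-\pi,\pi)^3$ and let $|\cdot|$ be the norm of $L^2(\Omega)^3$ (real vector fields). Let $H$ be the closure in $L^2(\Omega)^3$ of the set of $2\pi$-periodic, divergence-free trigonometric polynomial vector fields with zero average over $\Omega$, and let $\mathcal P$ be the orthogonal projection of $L^2(\Omega)^3$ onto $H$. For $u=\sum_{k\in\mathbb Z^3\setminus\{0\}}\hat u(k)e^{ik\cdot x}\in H$ and $\alpha,\sigma\in\mathbb R$ put $$A^\alpha e^{\sigma A^{1/2}}u=\sum_{k\neq0}|k|^{2\alpha}e^{\sigma|k|}\hat u(k)e^{ik\cdot x},\qquad |u|_{\alpha,\sigma}=|A^\alpha e^{\sigma A^{1/2}}u|,\qquad G_{\alpha,\sigma}=\{u\in H:|u|_{\alpha,\sigma}<\infty\}.$$ Write $A^\alpha=A^\alpha e^{0A^{1/2}}$, $\mathcal D(A^\alpha)=G_{\alpha,0}$, $A=A^1$ (the Stokes operator, equal to $-\Delta$), and $V=\mathcal D(A^{1/2})$ with norm $|A^{1/2}u|$. For $u,v\in\mathcal D(A)$ let $B(u,v)=\mathcal P((u\cdot\nabla)v)$. A *regular solution*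 on $[0,T)$, $0<T\le\infty$, with initial value $u^0$ is a continuous $u:[0,T)\to V$ with $u(0)=u^0$ such that, for every $t\in(0,T)$, $u(t)\in\mathcal D(A)$, $u$ is differentiable in $H$ at $t$, and $$\frac{du}{dt}(t)+Au(t)+B(u(t),u(t))=0 .$$ **Constants.** There is $K\ge1$ such that for all $\alpha\ge\frac12$, $\sigma\ge0$ and $u,v\in G_{\alpha+1/2,\sigma}$ $$B(u,v)\in G_{\alpha,\sigma}\quad\text{and}\quad |B(u,v)|_{\alpha,\sigma}\le K^\alpha|u|_{\alpha+1/2,\sigma}|v|_{\alpha+1/2,\sigma}.\qquad(*)$$ Let $K\geq 1$ be any constant with $(*)$, and write $C_\alpha=K^\alpha$. **Theorem.** Let $\alpha\ge\frac12$ and let $u^0\in\mathcal D(A^{\alpha+1/2})$ satisfy $$|A^{\alpha+1/2}u^0|<\frac1{12\,C_{\alpha+1/2}} .$$ Then there is a regular solution $u$ on $[0,\infty)$ with initial value $u^0$; it is unique, in the sense that every regular solution on some $[0,T)$ with initial value $u^0$ coincides with $u$ on $[0,T)$. For every $\sigma>0$ and every $t\ge24\sigma$ one has $u(t)\in G_{\alpha,\sigma}$,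 $$|u(t)|_{\alpha,\sigma}\le\sqrt2\,e^{4\sigma}\,|A^{\alpha+1/2}u^0|\,e^{-t},$$ and, consequently, $$|u(t)|_{\alpha,\sigma}\le\frac{e^{4\sigma}}{6\sqrt2\,C_{\alpha+1/2}}\,e^{-t}.$$ -/

import Mathlib

open MeasureTheory

namespace NSE

noncomputable section

/-- Lebesgue measure on the periodic box `Ω = (-π, π)³`. -/
def boxMeasure : Measure (Fin 3 → ℝ) :=
  volume.restrict (Set.univ.pi fun _ => Set.Ioo (-Real.pi) Real.pi)

/-- `L²(Ω)³`, real vector fields; its norm is `|u| = (∫_Ω u · u dx)^{1/2}`. -/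
abbrev L2 : Type := Lp (EuclideanSpace ℝ (Fin 3)) 2 boxMeasure

/-- The character `x ↦ e^{i k · x}`. -/
def character (k : Fin 3 → ℤ) (x : Fin 3 → ℝ) : ℂ :=
  Complex.exp (Complex.I * ((∑ j, (k j : ℝ) * x j : ℝ) : ℂ))

/-- The real vector field `x ↦ Re (a e^{i k · x})`. -/
def realMode (k : Fin 3 → ℤ) (a : Fin 3 → ℂ) (x : Fin 3 → ℝ) : EuclideanSpace ℝ (Fin 3) :=
  WithLp.toLp 2 fun i => (a i * character k x).re

/-- The `2π`-periodic real trigonometric polynomial vector fields which are divergence-free and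
have zero average: the finite sums of the fields `Re (a e^{i k · x})` with `k ≠ 0`, `k · a = 0`. -/
def trigPoly : Submodule ℝ L2 :=
  Submodule.span ℝ {v : L2 | ∃ (k : Fin 3 → ℤ) (a : Fin 3 → ℂ), k ≠ 0 ∧
    ∑ i, (k i : ℂ) * a i = 0 ∧ (v : (Fin 3 → ℝ) → EuclideanSpace ℝ (Fin 3)) =ᵐ[boxMeasure]
      realMode k a}

/-- The space `H`: the closure of the trigonometric polynomials above in `L²(Ω)³`. -/
def H : Submodule ℝ L2 := trigPoly.topologicalClosure

instance : CompleteSpace H :=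
  inferInstanceAs (CompleteSpace trigPoly.topologicalClosure)

/-- The Leray projection: the orthogonal projection of `L²(Ω)³` onto `H`. -/
def leray : L2 →L[ℝ] L2 := H.starProjection

/-- The Fourier coefficient `û(k) = (2π)⁻³ ∫_Ω u(x) e^{-i k · x} dx ∈ ℂ³`. -/
def fourierCoeff (u : L2) (k : Fin 3 → ℤ) : Fin 3 → ℂ := fun i =>
  (((2 * Real.pi) ^ 3 : ℝ) : ℂ)⁻¹ * ∫ x, ((u x i : ℝ) : ℂ) * character (-k) x ∂boxMeasure

/-- `w ∈ H` has the Fourier series `∑_k m(k) û(k) e^{i k · x}`. -/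
def HasMultiplier (m : (Fin 3 → ℤ) → ℂ) (u w : L2) : Prop :=
  w ∈ H ∧ ∀ k, fourierCoeff w k = m k • fourierCoeff u k

open Classical in
/-- The field `∑_k m(k) û(k) e^{i k · x}` if the series defines an element of `H`
(and `0` otherwise). -/
def multiplier (m : (Fin 3 → ℤ) → ℂ) (u : L2) : L2 :=
  if h : ∃ w, HasMultiplier m u w then h.choose else 0

/-- The Euclidean length `|k|` of a wave vector. -/
def waveNorm (k : Fin 3 → ℤ) : ℝ := Real.sqrt (∑ i, (k i : ℝ) ^ 2)

/-- The symbol `|k|^{2α} e^{σ|k|}` of `A^α e^{σ A^{1/2}}`. -/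
def gevreySymbol (α σ : ℝ) (k : Fin 3 → ℤ) : ℂ :=
  ((waveNorm k ^ (2 * α) * Real.exp (σ * waveNorm k) : ℝ) : ℂ)

/-- The Gevrey class `G_{α,σ}`: the domain of `A^α e^{σ A^{1/2}}` in `H`. -/
def gevreyClass (α σ : ℝ) : Set L2 :=
  {u | u ∈ H ∧ ∃ w, HasMultiplier (gevreySymbol α σ) u w}

/-- The operator `A^α e^{σ A^{1/2}}`. -/
def gevreyOp (α σ : ℝ) (u : L2) : L2 := multiplier (gevreySymbol α σ) u

/-- The Gevrey norm `|u|_{α,σ} = |A^α e^{σ A^{1/2}} u|`, for `u` in `G_{α,σ}`. -/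
def gevreyNorm (α σ : ℝ) (u : L2) : ℝ := ‖gevreyOp α σ u‖

/-- The domain `D(A^α) = G_{α,0}`; `D(A) = D(A^1)` and `V = D(A^{1/2})`. -/
def domA (α : ℝ) : Set L2 := gevreyClass α 0

/-- The powers `A^α` of the Stokes operator `A = -Δ`. -/
def powA (α : ℝ) (u : L2) : L2 := gevreyOp α 0 u

/-- The (periodic, weak) partial derivative `∂_j v = ∑_k i k_j v̂(k) e^{i k · x}`. -/
def partialDeriv (j : Fin 3) (v : L2) : L2 :=
  multiplier (fun k => Complex.I * (k j : ℂ)) v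

/-- The pointwise nonlinearity `(u · ∇) v = ∑_j u_j ∂_j v`. -/
def advection (u v : L2) (x : Fin 3 → ℝ) : EuclideanSpace ℝ (Fin 3) :=
  ∑ j, (u x j) • (partialDeriv j v x)

open Classical in
/-- The bilinear map `B(u, v) = P((u · ∇) v)`, for `u`, `v` in `D(A)`, where `(u · ∇) v` is square
integrable. -/
def bilin (u v : L2) : L2 :=
  if h : MemLp (advection u v) 2 boxMeasure then leray (h.toLp (advection u v)) else 0

/-- `K ≥ 1` is a constant in the estimate `|B(u,v)|_{α,σ} ≤ K^α |u|_{α+1/2,σ} |v|_{α+1/2,σ}` for all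
`α ≥ 1/2`, `σ ≥ 0` and `u, v ∈ G_{α+1/2,σ}`. -/
def IsBilinConstant (K : ℝ) : Prop :=
  1 ≤ K ∧ ∀ α σ : ℝ, 1 / 2 ≤ α → 0 ≤ σ →
    ∀ u ∈ gevreyClass (α + 1 / 2) σ, ∀ v ∈ gevreyClass (α + 1 / 2) σ,
      bilin u v ∈ gevreyClass α σ ∧
      gevreyNorm α σ (bilin u v) ≤
        K ^ α * gevreyNorm (α + 1 / 2) σ u * gevreyNorm (α + 1 / 2) σ v

/-- `u` is a regular solution on `[0,T)`, `T ∈ (0,∞]`, of `du/dt + Au + B(u,u) = 0`, `u(0) = u⁰`: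
it is continuous from `[0,T)` to `V`, whose norm is `|A^{1/2} ·|`, it takes values in `D(A)` on
`(0,T)`, and the equation holds in `H` at each `t ∈ (0,T)`. -/
structure IsRegularSolution (T : EReal) (u₀ : L2) (u : ℝ → L2) : Prop where
  pos : 0 < T
  initial : u 0 = u₀
  mem_V : ∀ t : ℝ, 0 ≤ t → (t : EReal) < T → u t ∈ domA (1 / 2)
  continuous_V : ContinuousOn (fun t => powA (1 / 2) (u t)) {t : ℝ | 0 ≤ t ∧ (t : EReal) < T}
  mem_domA : ∀ t : ℝ, 0 < t → (t : EReal) < T → u t ∈ domA 1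
  equation : ∀ t : ℝ, 0 < t → (t : EReal) < T →
    HasDerivAt u (-(powA 1 (u t) + bilin (u t) (u t))) t

end

end NSE

open scoped ENNReal

namespace NSE

noncomputable section

/-! The unknown is lifted to the top regularity, w = A^{α+1/2}u, and the equation is put in Duhamel
form: w(t) = e^{-tA}w₀ - ∫₀ᵗ A^{1/2}e^{-τA} N(w,w)(t-τ) dτ, where N(x,y) = A^α B(A^{-α-1/2}x,
A^{-α-1/2}y). The estimate (*) says exactly that N is bounded, with one constant, in every norm
|e^{σA^{1/2}}·| with σ ≥ 0 (`isGevreyBilinear_liftedBilin`). The derivative lost by B is the A^{1/2}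
in front of the heat semigroup, whose norm has an integrable singularity τ^{-1/2}.

The fixed point is sought among functions with |e^{σA^{1/2}}w(t)| ≤ M e^{σ-t} for all 0 ≤ σ ≤ t/24.
In the Duhamel integral the radius σ is divided in the ratio (t-τ) : τ. The first share is an
admissible radius for w at time t-τ, and the second, at most τ/24, is paid for by the semigroup,
because |k| ≥ 1 on the frequencies of H (`smooth_gevrey_le_kernel`). The nonlinearity is quadratic,
so the exponential bound enters twice: one copy rebuilds e^{σ-t}, the other leaves a factor
e^{-(23/24)(t-τ)} that keeps the integral below 9/4 uniformly in t (`norm_trunc_duhamel_le`). With C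
the bound of N and C|w₀| ≤ 1/12, the choice M = 4|w₀|/3 gives a self-map and a contraction of ratio
1/2 (`exists_mild_solution`). The field u = A^{-α-1/2}w solves the equation, as is checked frequency
by frequency (`exists_regular_solution`), and 4/3 ≤ √2 yields the stated decay.

Uniqueness holds among all regular solutions by an L² energy argument for the difference. It rests
on the trilinear bound of `exists_trilinear_bound`, in which the difference is tested only in the
norm of D(A^{3/8}), and on interpolation between H and V.

That a constant K exists is a convolution estimate on ℤ³: e^{σ|k|} is submultiplicative along k = j
+ l, and the remaining weights are square summable because ∑|k|^{-4} converges. -/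

/-- The Fourier coefficient of a scalar function on the box. -/
def coeff (f : (Fin 3 → ℝ) → ℂ) (k : Fin 3 → ℤ) : ℂ :=
  (((2 * Real.pi) ^ 3 : ℝ) : ℂ)⁻¹ * ∫ x, f x * character (-k) x ∂boxMeasure

theorem continuous_character (k : Fin 3 → ℤ) : Continuous (character k) := by
  unfold character; fun_prop

theorem norm_character (k : Fin 3 → ℤ) (x : Fin 3 → ℝ) : ‖character k x‖ = 1 := by
  unfold character
  rw [mul_comm, Complex.norm_exp_ofReal_mul_I]

theorem character_neg (k : Fin 3 → ℤ) (x : Fin 3 → ℝ) :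
    character (-k) x = (starRingEnd ℂ) (character k x) := by
  unfold character
  rw [← Complex.exp_conj]
  congr 1
  simp

theorem character_add (k l : Fin 3 → ℤ) (x : Fin 3 → ℝ) :
    character (k + l) x = character k x * character l x := by
  unfold character
  rw [← Complex.exp_add, ← mul_add, ← Complex.ofReal_add, ← Finset.sum_add_distrib]
  congr 4
  ext j
  push_cast [Pi.add_apply]
  ring

/-! ### Transfer of Parseval's identity from the unit torus to the box. -/

section Torus

local instance : MeasureSpace UnitAddCircle := ⟨AddCircle.haarAddCircle⟩

local instance : IsProbabilityMeasure (volume : Measure UnitAddCircle) :=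
  inferInstanceAs (IsProbabilityMeasure AddCircle.haarAddCircle)

/-- The section of the covering `ℝ³ → (ℝ/ℤ)³`, `x ↦ x / 2π`, with values in `(-π, π]³`. -/
def torusSection (t : UnitAddTorus (Fin 3)) : Fin 3 → ℝ :=
  (2 * Real.pi) • (UnitAddTorus.measurableEquivPiIoc (fun _ : Fin 3 => (-1 / 2 : ℝ)) t).1

theorem measurable_torusSection : Measurable torusSection :=
  (measurable_const_smul (2 * Real.pi)).comp (measurable_subtype_coe.comp
    (UnitAddTorus.measurableEquivPiIoc (fun _ : Fin 3 => (-1 / 2 : ℝ))).measurable)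

/-- Dilation by 2π scales the volume by (2π)³, and the half-open and open cubes differ by a null
set. -/
theorem measurePreserving_torusSection :
    MeasurePreserving torusSection volume
      (ENNReal.ofReal ((2 * Real.pi) ^ 3)⁻¹ • boxMeasure) := by
  have hpi : (2 * Real.pi) ≠ 0 := by positivity
  refine ⟨measurable_torusSection, ?_⟩
  have h1 := (UnitAddTorus.measurePreserving_equivPiIoc (fun _ : Fin 3 => (-1 / 2 : ℝ))).map_eq
  have h2 : torusSection = (fun x : Fin 3 → ℝ => (2 * Real.pi) • x) ∘
      (Subtype.val ∘ (UnitAddTorus.measurableEquivPiIoc (fun _ : Fin 3 => (-1 / 2 : ℝ)))) := rfl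
  have hm : MeasurableSet {x : Fin 3 → ℝ | ∀ i, x i ∈ Set.Ioc (-1 / 2 : ℝ) (-1 / 2 + 1)} :=
    MeasurableSet.univ_pi' fun i => measurableSet_Ioc
  rw [h2, ← Measure.map_map (measurable_const_smul _)
    (measurable_subtype_coe.comp (MeasurableEquiv.measurable _)),
    ← Measure.map_map measurable_subtype_coe (MeasurableEquiv.measurable _), h1]
  erw [map_comap_subtype_coe hm]
  have h3 : (volume.restrict {x : Fin 3 → ℝ | ∀ i, x i ∈ Set.Ioc (-1 / 2 : ℝ) (-1 / 2 + 1)}).map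
      (fun x : Fin 3 → ℝ => (2 * Real.pi) • x) =
      ((volume : Measure (Fin 3 → ℝ)).map (fun x : Fin 3 → ℝ => (2 * Real.pi) • x)).restrict
        (Set.univ.pi fun _ => Set.Ioc (-Real.pi) Real.pi) := by
    rw [Measure.restrict_map (measurable_const_smul _)
      (MeasurableSet.univ_pi fun i => measurableSet_Ioc)]
    congr 2
    ext x
    have := Real.pi_pos
    simp only [Set.mem_ofPred_eq, Set.mem_Ioc, Set.mem_preimage, Set.mem_pi, Set.mem_univ,
      Pi.smul_apply, smul_eq_mul, forall_true_left]
    refine forall_congr' fun i => and_congr ?_ ?_ <;> constructor <;> intro h <;> nlinarith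
  rw [h3, Measure.map_addHaar_smul _ hpi, Measure.restrict_smul]
  congr 1
  · simp [abs_of_pos Real.pi_pos]
  · unfold boxMeasure
    refine Measure.restrict_congr_set ?_
    exact Measure.univ_pi_Ioo_ae_eq_Icc.trans Measure.univ_pi_Ioc_ae_eq_Icc.symm |>.symm

theorem mFourier_torus (k : Fin 3 → ℤ) (t : UnitAddTorus (Fin 3)) :
    UnitAddTorus.mFourier k t = character k (torusSection t) := by
  obtain ⟨y, rfl⟩ := (UnitAddTorus.measurableEquivPiIoc
    (fun _ : Fin 3 => (-1 / 2 : ℝ))).symm.surjective t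
  unfold torusSection
  rw [MeasurableEquiv.apply_symm_apply]
  simp only [UnitAddTorus.mFourier, ContinuousMap.coe_mk, character,
    UnitAddTorus.coe_symm_measurableEquivPiIoc_apply, fourier_coe_apply]
  rw [← Complex.exp_sum]
  congr 1
  push_cast
  rw [Finset.mul_sum]
  refine Finset.sum_congr rfl fun i _ => ?_
  simp
  ring

/-- Parseval on the torus, pulled back by `torusSection`. Strong measurability serves the change of
variables and is removed in `hasSum_sq_coeff` by passing to a representative. -/
theorem hasSum_sq_coeff_of_stronglyMeasurable {f : (Fin 3 → ℝ) → ℂ} (hf : MemLp f 2 boxMeasure)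
    (hfm : StronglyMeasurable f) :
    HasSum (fun k : Fin 3 → ℤ =>
      ‖(((2 * Real.pi) ^ 3 : ℝ) : ℂ)⁻¹ * ∫ x, f x * character (-k) x ∂boxMeasure‖ ^ 2)
      (((2 * Real.pi) ^ 3)⁻¹ * ∫ x, ‖f x‖ ^ 2 ∂boxMeasure) := by
  have hpos : (0 : ℝ) ≤ ((2 * Real.pi) ^ 3)⁻¹ := by positivity
  have hmp := measurePreserving_torusSection
  have hf' : MemLp f 2 (ENNReal.ofReal ((2 * Real.pi) ^ 3)⁻¹ • boxMeasure) :=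
    hf.smul_measure ENNReal.ofReal_ne_top
  have hg : MemLp (f ∘ torusSection) 2 (volume : Measure (UnitAddTorus (Fin 3))) :=
    hf'.comp_measurePreserving hmp
  have hchar : ∀ k, Continuous (character k) := fun k => by unfold character; fun_prop
  have key := UnitAddTorus.hasSum_sq_mFourierCoeff (hg.toLp _)
  have e1 : ∀ k, UnitAddTorus.mFourierCoeff (hg.toLp (f ∘ torusSection)) k =
      (((2 * Real.pi) ^ 3 : ℝ) : ℂ)⁻¹ * ∫ x, f x * character (-k) x ∂boxMeasure := by
    intro k
    unfold UnitAddTorus.mFourierCoeff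
    rw [integral_congr_ae (g := fun t => (fun x => f x * character (-k) x) (torusSection t))]
    · rw [← integral_map (φ := torusSection) (f := fun x => f x * character (-k) x)
        measurable_torusSection.aemeasurable
        (hfm.aestronglyMeasurable.mul (hchar _).aestronglyMeasurable), hmp.map_eq,
        integral_smul_measure, ENNReal.toReal_ofReal hpos, Complex.real_smul]
      push_cast
      rfl
    · filter_upwards [hg.coeFn_toLp] with t ht
      rw [ht, mFourier_torus]
      simp [mul_comm]
  have e2 : ∫ t, ‖(hg.toLp (f ∘ torusSection)) t‖ ^ 2 =
      ((2 * Real.pi) ^ 3)⁻¹ * ∫ x, ‖f x‖ ^ 2 ∂boxMeasure := by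
    rw [integral_congr_ae (g := fun t => (fun x => ‖f x‖ ^ 2) (torusSection t))]
    · rw [← integral_map (φ := torusSection) (f := fun x => ‖f x‖ ^ 2)
        measurable_torusSection.aemeasurable
        (hfm.norm.pow 2).aestronglyMeasurable, hmp.map_eq,
        integral_smul_measure, ENNReal.toReal_ofReal hpos, smul_eq_mul]
    · filter_upwards [hg.coeFn_toLp] with t ht
      rw [ht]; rfl
  simp only [e1] at key
  rwa [e2] at key

theorem coeff_character (k m : Fin 3 → ℤ) :
    coeff (character k) m = if m = k then 1 else 0 := by
  have hc := continuous_character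
  have hmp := measurePreserving_torusSection
  have hpos : (0 : ℝ) ≤ ((2 * Real.pi) ^ 3)⁻¹ := by positivity
  have e1 : UnitAddTorus.mFourierCoeff (UnitAddTorus.mFourier k) m = coeff (character k) m := by
    unfold UnitAddTorus.mFourierCoeff coeff
    rw [integral_congr_ae (g := fun t => (fun x => character k x * character (-m) x)
      (torusSection t))]
    · rw [← integral_map (φ := torusSection) (f := fun x => character k x * character (-m) x)
        measurable_torusSection.aemeasurable
        ((hc _).aestronglyMeasurable.mul (hc _).aestronglyMeasurable), hmp.map_eq,
        integral_smul_measure, ENNReal.toReal_ofReal hpos, Complex.real_smul]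
      push_cast
      rfl
    · refine Filter.Eventually.of_forall fun t => ?_
      simp [mFourier_torus, mul_comm]
  rw [← e1, ← UnitAddTorus.mFourierCoeff_toLp, ← UnitAddTorus.mFourierBasis_repr]
  have h2 : (ContinuousMap.toLp 2 volume ℂ (UnitAddTorus.mFourier k) :
      Lp ℂ 2 (volume : Measure (UnitAddTorus (Fin 3)))) = UnitAddTorus.mFourierBasis k := by
    rw [UnitAddTorus.coe_mFourierBasis]
  rw [h2, HilbertBasis.repr_self, lp.single_apply]
  simp [Pi.single_apply]

end Torus

/-! ### Fourier coefficients of scalar functions and of fields. -/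

instance : IsFiniteMeasure boxMeasure := by
  unfold boxMeasure
  refine ⟨?_⟩
  rw [Measure.restrict_apply_univ, Real.volume_pi_Ioo]
  exact ENNReal.prod_lt_top fun i _ => ENNReal.ofReal_lt_top

theorem coeff_congr_ae {f g : (Fin 3 → ℝ) → ℂ} (h : f =ᵐ[boxMeasure] g) (k : Fin 3 → ℤ) :
    coeff f k = coeff g k := by
  unfold coeff
  congr 1
  refine integral_congr_ae ?_
  filter_upwards [h] with x hx
  rw [hx]

theorem integrable_mul_character {f : (Fin 3 → ℝ) → ℂ} (hf : Integrable f boxMeasure)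
    (k : Fin 3 → ℤ) : Integrable (fun x => f x * character k x) boxMeasure :=
  hf.mul_bdd (c := 1) (continuous_character k).aestronglyMeasurable
    (Filter.Eventually.of_forall fun x => (norm_character k x).le)

theorem coeff_add {f g : (Fin 3 → ℝ) → ℂ} (hf : Integrable f boxMeasure)
    (hg : Integrable g boxMeasure) (k : Fin 3 → ℤ) :
    coeff (fun x => f x + g x) k = coeff f k + coeff g k := by
  unfold coeff
  simp only [add_mul]
  rw [integral_add (integrable_mul_character hf _) (integrable_mul_character hg _), mul_add]

theorem coeff_const_mul (c : ℂ) (f : (Fin 3 → ℝ) → ℂ) (k : Fin 3 → ℤ) :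
    coeff (fun x => c * f x) k = c * coeff f k := by
  unfold coeff
  simp only [mul_assoc]
  rw [integral_const_mul]
  ring

theorem coeff_conj (f : (Fin 3 → ℝ) → ℂ) (k : Fin 3 → ℤ) :
    coeff (fun x => (starRingEnd ℂ) (f x)) k = (starRingEnd ℂ) (coeff f (-k)) := by
  unfold coeff
  rw [map_mul, ← integral_conj]
  simp only [map_mul, character_neg, Complex.conj_conj, map_inv₀, Complex.conj_ofReal]

/-- Parseval's identity on the box. -/
theorem hasSum_sq_coeff {f : (Fin 3 → ℝ) → ℂ} (hf : MemLp f 2 boxMeasure) :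
    HasSum (fun k : Fin 3 → ℤ => ‖coeff f k‖ ^ 2)
      (((2 * Real.pi) ^ 3)⁻¹ * ∫ x, ‖f x‖ ^ 2 ∂boxMeasure) := by
  have hae := hf.1.ae_eq_mk
  have h := hasSum_sq_coeff_of_stronglyMeasurable ((memLp_congr_ae hae).1 hf)
    hf.1.stronglyMeasurable_mk
  convert h using 1
  · ext k
    rw [coeff_congr_ae hae]
    rfl
  · congr 1
    refine integral_congr_ae ?_
    filter_upwards [hae] with x hx
    rw [hx]

/-- The Fourier coefficients of a field, as vectors of the Hermitian space `ℂ³`. -/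
def fc (u : L2) (k : Fin 3 → ℤ) : EuclideanSpace ℂ (Fin 3) := WithLp.toLp 2 (fourierCoeff u k)

theorem fc_apply (u : L2) (k : Fin 3 → ℤ) (i : Fin 3) :
    fc u k i = coeff (fun x => ((u x i : ℝ) : ℂ)) k := rfl

theorem memLp_component (u : L2) (i : Fin 3) :
    MemLp (fun x => ((u x i : ℝ) : ℂ)) 2 boxMeasure := by
  have h := Lp.memLp u
  refine h.of_le ?_ (Filter.Eventually.of_forall fun x => ?_)
  · exact (Complex.continuous_ofReal.comp (EuclideanSpace.proj (𝕜 := ℝ) i).continuous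
      ).comp_aestronglyMeasurable h.1
  · rw [Complex.norm_real]
    exact PiLp.norm_apply_le (u x) i

theorem integrable_component (u : L2) (i : Fin 3) :
    Integrable (fun x => ((u x i : ℝ) : ℂ)) boxMeasure :=
  (memLp_component u i).integrable (by norm_num)

theorem fc_congr {u : L2} {f : (Fin 3 → ℝ) → EuclideanSpace ℝ (Fin 3)}
    (h : u =ᵐ[boxMeasure] f) (k : Fin 3 → ℤ) (i : Fin 3) :
    fc u k i = coeff (fun x => ((f x i : ℝ) : ℂ)) k := by
  rw [fc_apply]
  refine coeff_congr_ae ?_ k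
  filter_upwards [h] with x hx
  rw [hx]

theorem fc_add (u v : L2) (k : Fin 3 → ℤ) : fc (u + v) k = fc u k + fc v k := by
  ext i
  rw [fc_congr (Lp.coeFn_add u v), PiLp.add_apply, fc_apply, fc_apply,
    ← coeff_add (integrable_component u i) (integrable_component v i)]
  simp

theorem fc_smul (c : ℝ) (u : L2) (k : Fin 3 → ℤ) : fc (c • u) k = c • fc u k := by
  ext i
  rw [fc_congr (Lp.coeFn_smul c u), PiLp.smul_apply, fc_apply, Complex.real_smul,
    ← coeff_const_mul]
  simp

theorem fc_conj (u : L2) (k : Fin 3 → ℤ) (i : Fin 3) :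
    fc u (-k) i = (starRingEnd ℂ) (fc u k i) := by
  rw [fc_apply, fc_apply]
  conv_rhs => rw [← neg_neg k]
  rw [← coeff_conj]
  simp

theorem hasSum_fc_sq (u : L2) :
    HasSum (fun k => ‖fc u k‖ ^ 2) (((2 * Real.pi) ^ 3)⁻¹ * ‖u‖ ^ 2) := by
  have h := hasSum_sum (s := Finset.univ) fun i _ => hasSum_sq_coeff (memLp_component u i)
  convert h using 1
  · ext k
    rw [EuclideanSpace.norm_sq_eq]
    rfl
  · rw [← Finset.mul_sum, ← integral_finsetSum]
    · congr 1
      rw [← real_inner_self_eq_norm_sq, MeasureTheory.L2.inner_def]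
      refine integral_congr_ae (Filter.Eventually.of_forall fun x => ?_)
      simp [EuclideanSpace.norm_sq_eq]
    · intro i _
      exact (memLp_component u i).integrable_norm_pow (by norm_num)

/-- The `k`-th Fourier coefficient as a linear map. -/
def fcLin (k : Fin 3 → ℤ) : L2 →L[ℝ] EuclideanSpace ℂ (Fin 3) :=
  LinearMap.mkContinuous
    { toFun := fun u => fc u k
      map_add' := fun u v => fc_add u v k
      map_smul' := fun c u => fc_smul c u k } (Real.sqrt (((2 * Real.pi) ^ 3)⁻¹)) (by
    intro u
    have h := le_hasSum (hasSum_fc_sq u) k fun j _ => by positivity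
    refine le_of_sq_le_sq ?_ (by positivity)
    rw [mul_pow, Real.sq_sqrt (by positivity)]
    exact h)

theorem fcLin_apply (k : Fin 3 → ℤ) (u : L2) : fcLin k u = fc u k := rfl

theorem fc_zero (k : Fin 3 → ℤ) : fc 0 k = 0 := (fcLin k).map_zero

theorem fc_sub (u v : L2) (k : Fin 3 → ℤ) : fc (u - v) k = fc u k - fc v k :=
  (fcLin k).map_sub u v

theorem fc_neg (u : L2) (k : Fin 3 → ℤ) : fc (-u) k = -fc u k :=
  (fcLin k).map_neg u

theorem fc_injective {u v : L2} (h : ∀ k, fc u k = fc v k) : u = v := by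
  have h1 := hasSum_fc_sq (u - v)
  simp only [fc_sub, h, sub_self, norm_zero, ne_eq, OfNat.ofNat_ne_zero, not_false_eq_true,
    zero_pow] at h1
  have h2 := h1.unique hasSum_zero
  have h3 : ((2 * Real.pi) ^ 3)⁻¹ ≠ 0 := by positivity
  rw [mul_eq_zero, or_iff_right h3] at h2
  exact sub_eq_zero.1 (norm_eq_zero.1 (pow_eq_zero_iff (by norm_num) |>.1 h2))

/-- Parseval's identity for inner products. -/
theorem hasSum_inner_fc (u v : L2) :
    HasSum (fun k => (inner ℂ (fc u k) (fc v k)).re)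
      (((2 * Real.pi) ^ 3)⁻¹ * inner ℝ u v) := by
  have h := ((hasSum_fc_sq (u + v)).sub (hasSum_fc_sq (u - v))).mul_right (1 / 4 : ℝ)
  have e1 : ∀ k, (‖fc (u + v) k‖ ^ 2 - ‖fc (u - v) k‖ ^ 2) * (1 / 4) =
      (inner ℂ (fc u k) (fc v k)).re := by
    intro k
    rw [fc_add, fc_sub]
    have := re_inner_eq_norm_add_mul_self_sub_norm_sub_mul_self_div_four (𝕜 := ℂ)
      (fc u k) (fc v k)
    simp only [RCLike.re_to_complex] at this
    rw [this]
    ring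
  simp only [e1] at h
  have e2 := re_inner_eq_norm_add_mul_self_sub_norm_sub_mul_self_div_four (𝕜 := ℝ) u v
  simp only [RCLike.re_to_real] at e2
  have e3 : (((2 * Real.pi) ^ 3)⁻¹ * ‖u + v‖ ^ 2 - ((2 * Real.pi) ^ 3)⁻¹ * ‖u - v‖ ^ 2) * (1 / 4) =
      ((2 * Real.pi) ^ 3)⁻¹ * inner ℝ u v := by
    rw [e2]
    ring
  rwa [e3] at h

theorem continuous_realMode (k : Fin 3 → ℤ) (a : Fin 3 → ℂ) : Continuous (realMode k a) := by
  unfold realMode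
  have := continuous_character k
  refine (PiLp.continuous_toLp 2 _).comp (continuous_pi fun i => ?_)
  exact Complex.continuous_re.comp (continuous_const.mul this)

theorem memLp_realMode (k : Fin 3 → ℤ) (a : Fin 3 → ℂ) : MemLp (realMode k a) 2 boxMeasure := by
  refine MemLp.of_bound (continuous_realMode k a).aestronglyMeasurable
    (∑ i, ‖a i‖) (Filter.Eventually.of_forall fun x => ?_)
  rw [EuclideanSpace.norm_eq]
  refine Real.sqrt_le_iff.2 ⟨by positivity, ?_⟩
  refine (Finset.sum_le_sum fun i _ => pow_le_pow_left₀ (norm_nonneg _)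
    (?_ : _ ≤ ‖a i‖) 2).trans (Finset.sum_sq_le_sq_sum_of_nonneg fun i _ => norm_nonneg _)
  refine (Complex.abs_re_le_norm _).trans ?_
  rw [norm_mul, norm_character, mul_one]

/-- The field `Re (a e^{i k · x})` as an element of `L²`. -/
def modeL2 (k : Fin 3 → ℤ) (a : EuclideanSpace ℂ (Fin 3)) : L2 :=
  (memLp_realMode k (fun i => a i)).toLp _

theorem fc_modeL2 (k m : Fin 3 → ℤ) (a : EuclideanSpace ℂ (Fin 3)) (i : Fin 3) :
    fc (modeL2 k a) m i =
      (if m = k then a i / 2 else 0) + (if m = -k then (starRingEnd ℂ) (a i) / 2 else 0) := by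
  rw [modeL2, fc_congr (MemLp.coeFn_toLp (memLp_realMode k (fun i => a i)))]
  have h : (fun x => ((realMode k (fun i => a i) x i : ℝ) : ℂ)) =
      fun x => (a i / 2) * character k x + ((starRingEnd ℂ) (a i) / 2) * character (-k) x := by
    ext x
    rw [character_neg]
    simp only [realMode, Complex.re_eq_add_conj, map_mul]
    ring
  have hi : ∀ k, Integrable (character k) boxMeasure := fun k =>
    (integrable_const (1 : ℂ)).mono (continuous_character k).aestronglyMeasurable
      (Filter.Eventually.of_forall fun x => by simp [norm_character])
  rw [h, coeff_add ((hi _).const_mul _) ((hi _).const_mul _), coeff_const_mul, coeff_const_mul,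
    coeff_character, coeff_character]
  simp

/-- A real mode at k puts half of its amplitude at k and the conjugate half at -k. By Hermitian
symmetry both halves arriving at m are c(m)/2, so a symmetric sum reproduces c. -/
theorem fc_sum_modeL2 {c : (Fin 3 → ℤ) → EuclideanSpace ℂ (Fin 3)}
    (hc : ∀ k i, c (-k) i = (starRingEnd ℂ) (c k i)) (s : Finset (Fin 3 → ℤ)) (m : Fin 3 → ℤ) :
    fc (∑ k ∈ s, modeL2 k (c k)) m =
      (((if m ∈ s then 1 else 0) + (if -m ∈ s then 1 else 0)) / 2 : ℝ) • c m := by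
  rw [← fcLin_apply, map_sum]
  ext i
  rw [WithLp.ofLp_sum, Finset.sum_apply]
  simp only [fcLin_apply, fc_modeL2, Finset.sum_add_distrib, PiLp.smul_apply, Complex.real_smul]
  have h2 : ∀ x, (m = -x) ↔ (-m = x) := fun x => by rw [neg_eq_iff_eq_neg]
  simp only [h2, Finset.sum_ite_eq]
  rw [hc, Complex.conj_conj]
  split_ifs <;> push_cast <;> ring

/-- The weight at m is the mean of the indicators of m ∈ s and -m ∈ s. Its square is at most the
mean of their squares, and the reflection m ↦ -m gives both indicators the same sum. -/
theorem norm_sum_modeL2_sq_le {c : (Fin 3 → ℤ) → EuclideanSpace ℂ (Fin 3)}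
    (hc : ∀ k i, c (-k) i = (starRingEnd ℂ) (c k i)) (s : Finset (Fin 3 → ℤ)) :
    ‖∑ k ∈ s, modeL2 k (c k)‖ ^ 2 ≤ (2 * Real.pi) ^ 3 * ∑ k ∈ s, ‖c k‖ ^ 2 := by
  have hn : ∀ k, ‖c (-k)‖ = ‖c k‖ := by
    intro k
    simp [EuclideanSpace.norm_eq, hc]
  have h1 : HasSum (fun m => if m ∈ s then ‖c m‖ ^ 2 else 0) (∑ k ∈ s, ‖c k‖ ^ 2) := by
    have := hasSum_sum_of_ne_finset_zero (f := fun m => if m ∈ s then ‖c m‖ ^ 2 else 0)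
      (s := s) (L := SummationFilter.unconditional _) (fun b hb => by simp [hb])
    rwa [Finset.sum_congr rfl (fun x hx => if_pos hx)] at this
  have h2 : HasSum (fun m => if -m ∈ s then ‖c m‖ ^ 2 else 0) (∑ k ∈ s, ‖c k‖ ^ 2) := by
    have := (Equiv.neg (Fin 3 → ℤ)).hasSum_iff.2 h1
    simpa [Function.comp_def, hn] using this
  have h3 := hasSum_fc_sq (∑ k ∈ s, modeL2 k (c k))
  have h4 : ((2 * Real.pi) ^ 3)⁻¹ * ‖∑ k ∈ s, modeL2 k (c k)‖ ^ 2 ≤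
      (∑ k ∈ s, ‖c k‖ ^ 2 + ∑ k ∈ s, ‖c k‖ ^ 2) / 2 := by
    refine hasSum_le (fun m => ?_) h3 ((h1.add h2).div_const 2)
    rw [fc_sum_modeL2 hc, norm_smul, mul_pow]
    have := sq_nonneg ‖c m‖
    split_ifs <;> norm_num <;> linarith
  rw [add_self_div_two] at h4
  rwa [inv_mul_le_iff₀ (by positivity)] at h4

/-- Every Hermitian square-summable family is the family of Fourier coefficients of a real
field, the sum of its Fourier series. -/
theorem exists_hasSum_modeL2 {c : (Fin 3 → ℤ) → EuclideanSpace ℂ (Fin 3)}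
    (hc : ∀ k i, c (-k) i = (starRingEnd ℂ) (c k i)) (hs : Summable fun k => ‖c k‖ ^ 2) :
    ∃ u : L2, HasSum (fun k => modeL2 k (c k)) u ∧ ∀ k, fc u k = c k := by
  have hsum : Summable (fun k => modeL2 k (c k)) := by
    rw [summable_iff_vanishing_norm] at hs ⊢
    intro ε hε
    obtain ⟨s, hs⟩ := hs (ε ^ 2 / (2 * Real.pi) ^ 3) (by positivity)
    refine ⟨s, fun t ht => ?_⟩
    have h1 := hs t ht
    rw [Real.norm_of_nonneg (Finset.sum_nonneg fun k _ => by positivity),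
      lt_div_iff₀ (by positivity)] at h1
    have h2 := norm_sum_modeL2_sq_le hc t
    refine lt_of_pow_lt_pow_left₀ 2 hε.le (h2.trans_lt ?_)
    linarith
  obtain ⟨u, hu⟩ := hsum
  refine ⟨u, hu, fun m => ?_⟩
  have h1 : HasSum (fun k => fc (modeL2 k (c k)) m) (fc u m) := (fcLin m).hasSum hu
  refine tendsto_nhds_unique h1 (tendsto_const_nhds.congr' ?_)
  -- Once the finite set contains m and -m, the coefficient at m no longer changes.
  filter_upwards [Filter.eventually_ge_atTop {m, -m}] with s hs
  have h2 := fc_sum_modeL2 hc s m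
  rw [← fcLin_apply, map_sum] at h2
  have hm : m ∈ s := hs (by simp)
  have hm' : -m ∈ s := hs (by simp)
  simp only [fcLin_apply] at h2
  rw [h2]
  simp [hm, hm']

/-! ### Wave vectors and the description of H by Fourier coefficients. -/

/-- The wave vector `k` as an element of `ℂ³`. -/
def kvec (k : Fin 3 → ℤ) : EuclideanSpace ℂ (Fin 3) := WithLp.toLp 2 fun i => (k i : ℂ)

theorem norm_kvec (k : Fin 3 → ℤ) : ‖kvec k‖ = waveNorm k := by
  rw [EuclideanSpace.norm_eq, waveNorm]
  simp [kvec]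

theorem inner_kvec (k : Fin 3 → ℤ) (a : EuclideanSpace ℂ (Fin 3)) :
    inner ℂ (kvec k) a = ∑ i, (k i : ℂ) * a i := by
  simp [PiLp.inner_apply, kvec, mul_comm]

theorem kvec_neg (k : Fin 3 → ℤ) : kvec (-k) = -kvec k := by
  ext i; simp [kvec]

theorem waveNorm_nonneg (k : Fin 3 → ℤ) : 0 ≤ waveNorm k := Real.sqrt_nonneg _

theorem waveNorm_zero : waveNorm 0 = 0 := by simp [waveNorm]

theorem waveNorm_neg (k : Fin 3 → ℤ) : waveNorm (-k) = waveNorm k := by simp [waveNorm]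

theorem waveNorm_add_le (k l : Fin 3 → ℤ) : waveNorm (k + l) ≤ waveNorm k + waveNorm l := by
  rw [← norm_kvec, ← norm_kvec, ← norm_kvec]
  refine le_trans (le_of_eq ?_) (norm_add_le _ _)
  congr 1
  ext i; simp [kvec]

theorem abs_le_waveNorm (k : Fin 3 → ℤ) (i : Fin 3) : |(k i : ℝ)| ≤ waveNorm k := by
  have := PiLp.norm_apply_le (kvec k) i
  rw [norm_kvec] at this
  simpa [kvec] using this

theorem one_le_waveNorm {k : Fin 3 → ℤ} (hk : k ≠ 0) : 1 ≤ waveNorm k := by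
  obtain ⟨i, hi⟩ := Function.ne_iff.1 hk
  refine le_trans ?_ (abs_le_waveNorm k i)
  have : 1 ≤ |k i| := Int.one_le_abs hi
  exact_mod_cast this

theorem waveNorm_pos {k : Fin 3 → ℤ} (hk : k ≠ 0) : 0 < waveNorm k :=
  one_pos.trans_le (one_le_waveNorm hk)

/-- The two conditions cut out a closed subspace containing the generators, hence H. Conversely,
under these conditions the partial sums of the Fourier series are trigonometric polynomials of the
required kind, and they converge to u. -/
theorem mem_H_iff {u : L2} :
    u ∈ H ↔ fc u 0 = 0 ∧ ∀ k, inner ℂ (kvec k) (fc u k) = 0 := by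
  constructor
  · let D : (Fin 3 → ℤ) → L2 →L[ℝ] ℂ := fun k =>
      ((innerSL ℂ (kvec k)).restrictScalars ℝ).comp (fcLin k)
    let W : Submodule ℝ L2 := (fcLin 0).ker ⊓ ⨅ k, (D k).ker
    have hW : IsClosed (W : Set L2) := by
      simp only [W, Submodule.coe_inf, Submodule.coe_iInf]
      exact (fcLin 0).isClosed_ker.inter (isClosed_iInter fun k => (D k).isClosed_ker)
    have hle : H ≤ W := by
      refine Submodule.topologicalClosure_minimal _ (Submodule.span_le.2 ?_) hW
      rintro v ⟨k, a, hk, ha, hv⟩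
      have hv' : v = modeL2 k (WithLp.toLp 2 a) :=
        Lp.ext (hv.trans (MemLp.coeFn_toLp (memLp_realMode k a)).symm)
      simp only [W, Submodule.coe_inf, Submodule.coe_iInf, Set.mem_inter_iff, Set.mem_iInter,
        SetLike.mem_coe, LinearMap.mem_ker, ContinuousLinearMap.coe_coe]
      refine ⟨?_, fun m => ?_⟩
      · ext i
        rw [fcLin_apply, hv', fc_modeL2, if_neg (Ne.symm hk),
          if_neg (by rwa [eq_comm, neg_eq_zero])]
        simp
      · change inner ℂ (kvec m) (fc v m) = 0
        have ha' : ∑ i, (k i : ℂ) * (starRingEnd ℂ) (a i) = 0 := by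
          have := congrArg (starRingEnd ℂ) ha
          simpa using this
        rw [inner_kvec, hv']
        simp only [fc_modeL2, mul_add, Finset.sum_add_distrib]
        by_cases h1 : m = k
        · have h2 : ¬ (m = -k) := by
            rintro h2
            rw [h1] at h2
            exact hk (self_eq_neg.1 h2)
          subst h1
          simp only [if_true, h2, if_false, mul_zero, Finset.sum_const_zero, add_zero]
          simp only [← mul_div_assoc, ← Finset.sum_div, ha, zero_div]
        · by_cases h2 : m = -k
          · subst h2
            simp only [if_true, h1, if_false, mul_zero, Finset.sum_const_zero, zero_add]
            simp only [← mul_div_assoc, ← Finset.sum_div, Pi.neg_apply, Int.cast_neg, neg_mul,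
              Finset.sum_neg_distrib, ha', neg_zero, zero_div]
          · simp [h1, h2]
    intro hu
    have := hle hu
    simp only [W, Submodule.mem_inf, Submodule.mem_iInf, LinearMap.mem_ker,
      ContinuousLinearMap.coe_coe] at this
    exact ⟨this.1, fun k => this.2 k⟩
  · rintro ⟨h0, h⟩
    obtain ⟨v, hv, hvc⟩ := exists_hasSum_modeL2 (c := fc u) (fc_conj u) (hasSum_fc_sq u).summable
    have huv : u = v := fc_injective fun k => (hvc k).symm
    rw [huv]
    refine (Submodule.isClosed_topologicalClosure trigPoly).mem_of_tendsto hv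
      (Filter.Eventually.of_forall fun s => ?_)
    refine Submodule.sum_mem _ fun k _ => Submodule.le_topologicalClosure _ ?_
    by_cases hk : k = 0
    · have : modeL2 k (fc u k) = 0 := by
        refine fc_injective fun m => ?_
        ext i
        rw [fc_modeL2, hk, h0, fc_zero]
        simp
      rw [this]
      exact Submodule.zero_mem _
    · refine Submodule.subset_span ⟨k, fun i => fc u k i, hk, ?_, MemLp.coeFn_toLp _⟩
      rw [← inner_kvec]
      exact h k

theorem fc_zero_of_mem_H {u : L2} (hu : u ∈ H) : fc u 0 = 0 := (mem_H_iff.1 hu).1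

theorem exists_mem_H {c : (Fin 3 → ℤ) → EuclideanSpace ℂ (Fin 3)}
    (hc : ∀ k i, c (-k) i = (starRingEnd ℂ) (c k i)) (hs : Summable fun k => ‖c k‖ ^ 2)
    (h0 : c 0 = 0) (hd : ∀ k, inner ℂ (kvec k) (c k) = 0) : ∃ u ∈ H, ∀ k, fc u k = c k := by
  obtain ⟨u, -, hu⟩ := exists_hasSum_modeL2 hc hs
  exact ⟨u, mem_H_iff.2 ⟨by rw [hu, h0], fun k => by rw [hu, hd]⟩, hu⟩

theorem norm_le_of_fc_le {u v : L2} {C : ℝ} (hC : 0 ≤ C) (h : ∀ k, ‖fc u k‖ ≤ C * ‖fc v k‖) :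
    ‖u‖ ≤ C * ‖v‖ := by
  have h1 := hasSum_le (fun k => ?_) (hasSum_fc_sq u) ((hasSum_fc_sq v).mul_left (C ^ 2))
  · refine le_of_sq_le_sq ?_ (by positivity)
    have h3 : (0 : ℝ) < ((2 * Real.pi) ^ 3)⁻¹ := by positivity
    rw [mul_pow]
    refine le_of_mul_le_mul_left ?_ h3
    linarith
  · rw [← mul_pow]
    exact pow_le_pow_left₀ (norm_nonneg _) (h k) 2

/-! ### Multipliers -/

theorem fourierCoeff_eq_iff {u w : L2} {m : ℂ} {k : Fin 3 → ℤ} :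
    fourierCoeff w k = m • fourierCoeff u k ↔ fc w k = m • fc u k := by
  unfold fc
  rw [← WithLp.toLp_smul]
  exact (WithLp.toLp_injective 2).eq_iff.symm

theorem hasMultiplier_iff {m : (Fin 3 → ℤ) → ℂ} {u w : L2} :
    HasMultiplier m u w ↔ w ∈ H ∧ ∀ k, fc w k = m k • fc u k := by
  unfold HasMultiplier
  simp only [fourierCoeff_eq_iff]

/-- Fourier coefficients determine the field, so the choice in `multiplier` is harmless. -/
theorem HasMultiplier.multiplier_eq {m : (Fin 3 → ℤ) → ℂ} {u w : L2} (h : HasMultiplier m u w) :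
    multiplier m u = w := by
  have hex : ∃ w, HasMultiplier m u w := ⟨w, h⟩
  unfold multiplier
  rw [dif_pos hex]
  refine fc_injective fun k => ?_
  rw [(hasMultiplier_iff.1 h).2, (hasMultiplier_iff.1 hex.choose_spec).2]

theorem exists_hasMultiplier {m : (Fin 3 → ℤ) → ℂ} (hm : ∀ k, m (-k) = (starRingEnd ℂ) (m k))
    {u : L2} (hu : u ∈ H) (hs : Summable fun k => (‖m k‖ * ‖fc u k‖) ^ 2) :
    ∃ w, HasMultiplier m u w := by
  obtain ⟨h0, hd⟩ := mem_H_iff.1 hu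
  obtain ⟨w, hw, hwc⟩ := exists_mem_H (c := fun k => m k • fc u k)
    (fun k i => by simp [hm, fc_conj]) (by simpa only [norm_smul] using hs)
    (by simp [h0]) (fun k => by rw [inner_smul_right, hd, mul_zero])
  exact ⟨w, hasMultiplier_iff.2 ⟨hw, hwc⟩⟩

/-- The real symbol `|k|^{2α} e^{σ|k|}`. -/
def gsymb (α σ : ℝ) (k : Fin 3 → ℤ) : ℝ := waveNorm k ^ (2 * α) * Real.exp (σ * waveNorm k)

theorem gsymb_nonneg (α σ : ℝ) (k : Fin 3 → ℤ) : 0 ≤ gsymb α σ k :=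
  mul_nonneg (Real.rpow_nonneg (waveNorm_nonneg k) _) (Real.exp_pos _).le

theorem gevreySymbol_eq (α σ : ℝ) (k : Fin 3 → ℤ) : gevreySymbol α σ k = (gsymb α σ k : ℂ) := rfl

theorem norm_gevreySymbol (α σ : ℝ) (k : Fin 3 → ℤ) : ‖gevreySymbol α σ k‖ = gsymb α σ k := by
  rw [gevreySymbol_eq, Complex.norm_real, Real.norm_of_nonneg (gsymb_nonneg α σ k)]

theorem mem_gevreyClass_iff {α σ : ℝ} {u : L2} :
    u ∈ gevreyClass α σ ↔ u ∈ H ∧ Summable fun k => (gsymb α σ k * ‖fc u k‖) ^ 2 := by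
  constructor
  · rintro ⟨hu, w, hw⟩
    refine ⟨hu, ?_⟩
    convert (hasSum_fc_sq w).summable using 2 with k
    rw [(hasMultiplier_iff.1 hw).2, norm_smul, norm_gevreySymbol]
  · rintro ⟨hu, hs⟩
    refine ⟨hu, exists_hasMultiplier (fun k => ?_) hu (by simpa only [norm_gevreySymbol] using hs)⟩
    rw [gevreySymbol_eq, gevreySymbol_eq, Complex.conj_ofReal, gsymb, waveNorm_neg]
    rfl

theorem gevreyOp_spec {α σ : ℝ} {u : L2} (hu : u ∈ gevreyClass α σ) :
    gevreyOp α σ u ∈ H ∧ ∀ k, fc (gevreyOp α σ u) k = gsymb α σ k • fc u k := by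
  obtain ⟨-, w, hw⟩ := hu
  rw [gevreyOp, hw.multiplier_eq]
  exact hasMultiplier_iff.1 hw

theorem hasSum_gevreyNorm {α σ : ℝ} {u : L2} (hu : u ∈ gevreyClass α σ) :
    HasSum (fun k => (gsymb α σ k * ‖fc u k‖) ^ 2)
      (((2 * Real.pi) ^ 3)⁻¹ * gevreyNorm α σ u ^ 2) := by
  unfold gevreyNorm
  convert hasSum_fc_sq (gevreyOp α σ u) using 2 with k
  rw [(gevreyOp_spec hu).2, norm_smul, Real.norm_of_nonneg (gsymb_nonneg α σ k)]

theorem gevreyOp_eq {α σ : ℝ} {u w : L2} (hw : w ∈ H) (h : ∀ k, fc w k = gsymb α σ k • fc u k) :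
    gevreyOp α σ u = w :=
  HasMultiplier.multiplier_eq (hasMultiplier_iff.2 ⟨hw, h⟩)

theorem mem_gevreyClass_of_fc {α σ : ℝ} {u w : L2} (hu : u ∈ H)
    (h : ∀ k, ‖fc w k‖ = gsymb α σ k * ‖fc u k‖) : u ∈ gevreyClass α σ := by
  refine mem_gevreyClass_iff.2 ⟨hu, ?_⟩
  convert (hasSum_fc_sq w).summable using 2 with k
  rw [h]

/-- `φ` is bounded on the lengths of the wave vectors. -/
def BddSymbol (φ : ℝ → ℝ) : Prop := ∃ C : ℝ, ∀ k : Fin 3 → ℤ, |φ (waveNorm k)| ≤ C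

theorem BddSymbol.exists_op {φ : ℝ → ℝ} (h : BddSymbol φ) :
    ∃ S : L2 →L[ℝ] L2, ∀ u k, fc (S u) k = φ (waveNorm k) • fc u k := by
  obtain ⟨C, hC⟩ := h
  have hC0 : 0 ≤ C := (abs_nonneg _).trans (hC 0)
  have hex : ∀ u : L2, ∃ w : L2, ∀ k, fc w k = φ (waveNorm k) • fc u k := by
    intro u
    obtain ⟨w, -, hw⟩ := exists_hasSum_modeL2 (c := fun k => φ (waveNorm k) • fc u k)
      (fun k i => by simp [waveNorm_neg, fc_conj]) (by
        refine Summable.of_nonneg_of_le (fun k => by positivity) (fun k => ?_)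
          ((hasSum_fc_sq u).summable.mul_left (C ^ 2))
        rw [norm_smul, mul_pow]
        gcongr
        exact hC k)
    exact ⟨w, hw⟩
  choose S hS using hex
  refine ⟨LinearMap.mkContinuous
    { toFun := S
      map_add' := fun u v => fc_injective fun k => by rw [fc_add, hS, hS, hS, fc_add, smul_add]
      map_smul' := fun c u => fc_injective fun k => by
        rw [hS, RingHom.id_apply, fc_smul, fc_smul, hS, smul_comm] } C (fun u =>
      norm_le_of_fc_le hC0 fun k => ?_), fun u k => hS u k⟩
  change ‖fc (S u) k‖ ≤ _
  rw [hS, norm_smul]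
  exact mul_le_mul_of_nonneg_right (hC k) (norm_nonneg _)

open Classical in
/-- The operator `φ(A^{1/2})` with bounded symbol `φ(|k|)`. -/
def mulOp (φ : ℝ → ℝ) : L2 →L[ℝ] L2 := if h : BddSymbol φ then h.exists_op.choose else 0

theorem fc_mulOp {φ : ℝ → ℝ} (h : BddSymbol φ) (u : L2) (k : Fin 3 → ℤ) :
    fc (mulOp φ u) k = φ (waveNorm k) • fc u k := by
  unfold mulOp
  rw [dif_pos h]
  exact h.exists_op.choose_spec u k

theorem mulOp_mem_H (φ : ℝ → ℝ) {u : L2} (hu : u ∈ H) : mulOp φ u ∈ H := by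
  by_cases h : BddSymbol φ
  · obtain ⟨h0, hd⟩ := mem_H_iff.1 hu
    refine mem_H_iff.2 ⟨by rw [fc_mulOp h, h0, smul_zero], fun k => ?_⟩
    rw [fc_mulOp h, RCLike.real_smul_eq_coe_smul (K := ℂ), inner_smul_right, hd, mul_zero]
  · simp [mulOp, h, H.zero_mem]

/-- Fields in H have no zero mode, so symbols need only be estimated where |k| ≥ 1. -/
theorem norm_mulOp_le {φ : ℝ → ℝ} (h : BddSymbol φ) {u v : L2} {C : ℝ} (hC : 0 ≤ C)
    (hu : u ∈ H) (hle : ∀ k ≠ 0, |φ (waveNorm k)| * ‖fc u k‖ ≤ C * ‖fc v k‖) :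
    ‖mulOp φ u‖ ≤ C * ‖v‖ := by
  refine norm_le_of_fc_le hC fun k => ?_
  rw [fc_mulOp h, norm_smul, Real.norm_eq_abs]
  by_cases hk : k = 0
  · rw [hk, fc_zero_of_mem_H hu, norm_zero, mul_zero]
    positivity
  · exact hle k hk

/-! ### The Leray projection -/

theorem leray_mem (f : L2) : leray f ∈ H := Submodule.starProjection_apply_mem _ _

/-- The Fourier coefficients of the Leray projection. -/
def lerayCoeff (k : Fin 3 → ℤ) (a : EuclideanSpace ℂ (Fin 3)) : EuclideanSpace ℂ (Fin 3) :=
  if k = 0 then 0 else a - (inner ℂ (kvec k) a / (waveNorm k : ℂ) ^ 2) • kvec k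

theorem lerayCoeff_orthogonal (k : Fin 3 → ℤ) (a : EuclideanSpace ℂ (Fin 3)) :
    inner ℂ (kvec k) (lerayCoeff k a) = 0 := by
  unfold lerayCoeff
  split_ifs with hk
  · simp
  · have h : (waveNorm k : ℂ) ≠ 0 := Complex.ofReal_ne_zero.2 (waveNorm_pos hk).ne'
    rw [inner_sub_right, inner_smul_right, inner_self_eq_norm_sq_to_K, norm_kvec]
    field_simp
    simp

theorem inner_sub_lerayCoeff {k : Fin 3 → ℤ} (hk : k ≠ 0) (a : EuclideanSpace ℂ (Fin 3))
    {b : EuclideanSpace ℂ (Fin 3)} (hb : inner ℂ (kvec k) b = 0) :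
    inner ℂ (a - lerayCoeff k a) b = 0 := by
  unfold lerayCoeff
  rw [if_neg hk, sub_sub_cancel, inner_smul_left, hb, mul_zero]

theorem norm_lerayCoeff_le (k : Fin 3 → ℤ) (a : EuclideanSpace ℂ (Fin 3)) :
    ‖lerayCoeff k a‖ ≤ ‖a‖ := by
  by_cases hk : k = 0
  · simp [lerayCoeff, hk]
  · have h := inner_sub_lerayCoeff hk a (lerayCoeff_orthogonal k a)
    have h2 := norm_add_sq_eq_norm_sq_add_norm_sq_of_inner_eq_zero _ _ h
    rw [sub_add_cancel] at h2
    nlinarith [norm_nonneg a, norm_nonneg (lerayCoeff k a), norm_nonneg (a - lerayCoeff k a)]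

/-- The field g with the projected coefficients lies in H, and f - g is orthogonal to H mode by mode
through Parseval. These two properties characterise the orthogonal projection. -/
theorem fc_leray (f : L2) (k : Fin 3 → ℤ) : fc (leray f) k = lerayCoeff k (fc f k) := by
  obtain ⟨g, hg, hgc⟩ := exists_mem_H (c := fun k => lerayCoeff k (fc f k))
    (fun k i => by
      unfold lerayCoeff
      by_cases hk : k = 0
      · simp [hk]
      · have hk' : -k ≠ 0 := by simpa using hk
        have hi : inner ℂ (kvec k) (fc f (-k)) = (starRingEnd ℂ) (inner ℂ (kvec k) (fc f k)) := by
          rw [inner_kvec, inner_kvec, map_sum]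
          simp [fc_conj]
        rw [if_neg hk, if_neg hk', kvec_neg, inner_neg_left, waveNorm_neg, hi]
        simp only [PiLp.sub_apply, PiLp.smul_apply, PiLp.neg_apply, smul_eq_mul, fc_conj, map_sub,
          map_mul, map_div₀, map_pow, Complex.conj_ofReal]
        simp [kvec]
        ring)
    (Summable.of_nonneg_of_le (fun k => by positivity)
      (fun k => pow_le_pow_left₀ (norm_nonneg _) (norm_lerayCoeff_le k _) 2)
      (hasSum_fc_sq f).summable)
    (by simp [lerayCoeff]) (fun k => lerayCoeff_orthogonal k _)
  have : leray f = g := by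
    refine Submodule.eq_starProjection_of_mem_of_inner_eq_zero hg fun w hw => ?_
    have h1 := hasSum_inner_fc (f - g) w
    have h2 : ∀ k, (inner ℂ (fc (f - g) k) (fc w k)).re = 0 := by
      intro k
      by_cases hk : k = 0
      · rw [hk, fc_zero_of_mem_H hw, inner_zero_right, Complex.zero_re]
      · rw [fc_sub, hgc, inner_sub_lerayCoeff hk _ ((mem_H_iff.1 hw).2 k), Complex.zero_re]
    simp only [h2] at h1
    have h3 := h1.unique hasSum_zero
    have h4 : ((2 * Real.pi) ^ 3)⁻¹ ≠ 0 := by positivity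
    exact (mul_eq_zero.1 h3).resolve_left h4
  rw [this, hgc]

theorem norm_fc_leray_le (f : L2) (k : Fin 3 → ℤ) : ‖fc (leray f) k‖ ≤ ‖fc f k‖ := by
  rw [fc_leray]
  exact norm_lerayCoeff_le k _

/-! ### Lattice sums and weighted convolutions on ℤ³. -/

theorem summable_waveNorm_rpow {r : ℝ} (hr : r < -3) :
    Summable fun k : Fin 3 → ℤ => waveNorm k ^ r := by
  let b := (EuclideanSpace.basisFun (Fin 3) ℝ).toBasis
  let L := Submodule.span ℤ (Set.range b)
  have hfin : Module.finrank ℤ L = 3 := by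
    rw [ZLattice.rank ℝ L]; simp
  have hs := ZLattice.summable_norm_rpow L r (by rw [hfin]; exact_mod_cast hr)
  let f : (Fin 3 → ℤ) → L := fun k => ⟨∑ i, k i • b i,
    Submodule.sum_mem _ fun i _ => Submodule.smul_mem _ _ (Submodule.subset_span ⟨i, rfl⟩)⟩
  have hf : ∀ k i, (f k : EuclideanSpace ℝ (Fin 3)) i = (k i : ℝ) := by
    intro k i
    simp [f, b, Pi.single_apply]
  have hinj : Function.Injective f := by
    intro k l h
    ext i
    have := congrArg (fun z : L => (z : EuclideanSpace ℝ (Fin 3)) i) h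
    simp only [hf] at this
    exact_mod_cast this
  refine (hs.comp_injective hinj).congr fun k => ?_
  simp only [Function.comp]
  congr 1
  rw [Submodule.coe_norm, EuclideanSpace.norm_eq, waveNorm]
  simp only [hf, Real.norm_eq_abs, sq_abs]

/-- `|k|` as an extended nonnegative real. -/
def kn (k : Fin 3 → ℤ) : ℝ≥0∞ := ENNReal.ofReal (waveNorm k)

/-- `1 / |k|` as an extended nonnegative real, with value `0` at `k = 0`. -/
def kinv (k : Fin 3 → ℤ) : ℝ≥0∞ := ENNReal.ofReal (waveNorm k)⁻¹

theorem kinv_mul_kn {k : Fin 3 → ℤ} (hk : k ≠ 0) : kinv k * kn k = 1 := by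
  rw [kinv, kn, ← ENNReal.ofReal_mul (by have := waveNorm_nonneg k; positivity),
    inv_mul_cancel₀ (waveNorm_pos hk).ne', ENNReal.ofReal_one]

theorem tsum_kinv_rpow_lt_top {r : ℝ} (hr : 3 < r) : ∑' k, kinv k ^ r < ∞ := by
  have h := (summable_waveNorm_rpow (r := -r) (by linarith))
  have h2 : ∀ k, kinv k ^ r = ENNReal.ofReal (waveNorm k ^ (-r)) := by
    intro k
    rw [kinv, ENNReal.ofReal_rpow_of_nonneg (by have := waveNorm_nonneg k; positivity) (by linarith),
      Real.inv_rpow (waveNorm_nonneg k), Real.rpow_neg (waveNorm_nonneg k)]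
  simp only [h2]
  exact h.tsum_ofReal_lt_top

theorem tsum_mul_sq_le {ι : Type*} (f g : ι → ℝ≥0∞) :
    (∑' i, f i * g i) ^ 2 ≤ (∑' i, f i ^ 2) * ∑' i, g i ^ 2 := by
  let _ : MeasurableSpace ι := ⊤
  have h := ENNReal.lintegral_mul_le_Lp_mul_Lq (Measure.count : Measure ι)
    (p := 2) (q := 2) Real.HolderConjugate.two_two (f := f) (g := g)
    (measurable_from_top).aemeasurable (measurable_from_top).aemeasurable
  simp only [lintegral_count, Pi.mul_apply] at h
  calc (∑' i, f i * g i) ^ 2 ≤ ((∑' i, f i ^ (2 : ℝ)) ^ (1 / (2 : ℝ)) *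
        (∑' i, g i ^ (2 : ℝ)) ^ (1 / (2 : ℝ))) ^ 2 := by gcongr
    _ = _ := by
      rw [mul_pow, ← ENNReal.rpow_natCast, ← ENNReal.rpow_natCast, ← ENNReal.rpow_mul,
        ← ENNReal.rpow_mul]
      norm_num

/-- Cauchy–Schwarz for weighted convolutions on `ℤ³`. -/
theorem tsum_conv_sq_le {g : (Fin 3 → ℤ) → (Fin 3 → ℤ) → ℝ≥0∞} {S : ℝ≥0∞}
    (hg : ∀ k, ∑' j, g j (k - j) ^ 2 ≤ S) (U V : (Fin 3 → ℤ) → ℝ≥0∞) :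
    ∑' k, (∑' j, g j (k - j) * (U j * V (k - j))) ^ 2 ≤
      S * ((∑' j, U j ^ 2) * ∑' j, V j ^ 2) := by
  calc ∑' k, (∑' j, g j (k - j) * (U j * V (k - j))) ^ 2
      ≤ ∑' k, S * ∑' j, U j ^ 2 * V (k - j) ^ 2 := by
        refine ENNReal.tsum_le_tsum fun k => ?_
        refine (tsum_mul_sq_le _ _).trans ?_
        simp only [mul_pow]
        gcongr
        exact hg k
    _ = S * ∑' j, ∑' k, U j ^ 2 * V (k - j) ^ 2 := by
        rw [ENNReal.tsum_mul_left, ENNReal.tsum_comm]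
    _ = S * ((∑' j, U j ^ 2) * ∑' j, V j ^ 2) := by
        congr 1
        rw [← ENNReal.tsum_mul_right]
        refine tsum_congr fun j => ?_
        rw [ENNReal.tsum_mul_left]
        congr 1
        exact (Equiv.subRight j).tsum_eq (fun k => V k ^ 2)

/-- The larger of x and y dominates the product; this reduces two-centre lattice sums to one-centre
ones. -/
theorem rpow_mul_rpow_le_add (x y : ℝ≥0∞) {p q : ℝ} (hp : 0 ≤ p) (hq : 0 ≤ q) :
    x ^ p * y ^ q ≤ x ^ (p + q) + y ^ (p + q) := by
  rw [ENNReal.rpow_add_of_nonneg _ _ hp hq, ENNReal.rpow_add_of_nonneg _ _ hp hq]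
  rcases le_total x y with h | h
  · exact le_add_left (by gcongr)
  · exact le_add_right (by gcongr)

/-- The lattice sum `∑ |k|^{-r}`. -/
def latticeSum (r : ℝ) : ℝ≥0∞ := ∑' k, kinv k ^ r

theorem tsum_kinv_conv_le {p q : ℝ} (hp : 0 ≤ p) (hq : 0 ≤ q) (k : Fin 3 → ℤ) :
    ∑' j, kinv j ^ p * kinv (k - j) ^ q ≤ 2 * latticeSum (p + q) := by
  calc ∑' j, kinv j ^ p * kinv (k - j) ^ q
      ≤ ∑' j, (kinv j ^ (p + q) + kinv (k - j) ^ (p + q)) :=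
        ENNReal.tsum_le_tsum fun j => rpow_mul_rpow_le_add _ _ hp hq
    _ = 2 * latticeSum (p + q) := by
        rw [ENNReal.tsum_add, two_mul, latticeSum]
        congr 1
        exact (Equiv.subLeft k).tsum_eq (fun j => kinv j ^ (p + q))

/-! ### Products and convolutions -/

/-- Absolute summability of a allows the sum and the integral to be exchanged. -/
theorem hasSum_coeff_mul {a : (Fin 3 → ℤ) → ℂ} (ha : Summable fun m => ‖a m‖)
    {q : (Fin 3 → ℝ) → ℂ} (hq : Integrable q boxMeasure) (k : Fin 3 → ℤ) :
    HasSum (fun m => a m * coeff q (k - m)) (coeff (fun x => (∑' m, a m * character m x) * q x) k) := by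
  have hF : ∀ m x, a m * character m x * q x * character (-k) x =
      a m * (q x * character (-(k - m)) x) := by
    intro m x
    rw [neg_sub, sub_eq_add_neg, character_add]
    ring
  have h := hasSum_integral_of_summable_integral_norm (μ := boxMeasure)
    (F := fun m x => a m * character m x * q x * character (-k) x)
    (fun m => by
      simp only [hF]
      exact (integrable_mul_character hq _).const_mul _)
    (by
      have : ∀ m, ∫ x, ‖a m * character m x * q x * character (-k) x‖ ∂boxMeasure =
          ‖a m‖ * ∫ x, ‖q x‖ ∂boxMeasure := by
        intro m
        rw [← integral_const_mul]
        refine integral_congr_ae (Filter.Eventually.of_forall fun x => ?_)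
        simp [norm_character]
      simp only [this]
      exact ha.mul_right _)
  have h2 := h.mul_left (((2 * Real.pi) ^ 3 : ℝ) : ℂ)⁻¹
  have e1 : ∀ m, (((2 * Real.pi) ^ 3 : ℝ) : ℂ)⁻¹ *
      ∫ x, a m * character m x * q x * character (-k) x ∂boxMeasure = a m * coeff q (k - m) := by
    intro m
    simp only [hF]
    rw [integral_const_mul, coeff]
    ring
  have e2 : (((2 * Real.pi) ^ 3 : ℝ) : ℂ)⁻¹ *
      ∫ x, ∑' m, a m * character m x * q x * character (-k) x ∂boxMeasure =
      coeff (fun x => (∑' m, a m * character m x) * q x) k := by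
    unfold coeff
    congr 1
    refine integral_congr_ae (Filter.Eventually.of_forall fun x => ?_)
    simp only
    rw [← tsum_mul_right, ← tsum_mul_right]
  simp only [e1] at h2
  rwa [e2] at h2

theorem memLp_tsum_character {a : (Fin 3 → ℤ) → ℂ} (ha : Summable fun m => ‖a m‖) :
    Continuous (fun x => ∑' m, a m * character m x) ∧
      ∀ x, ‖∑' m, a m * character m x‖ ≤ ∑' m, ‖a m‖ := by
  have hn : ∀ m x, ‖a m * character m x‖ = ‖a m‖ := fun m x => by
    rw [norm_mul, norm_character, mul_one]
  refine ⟨continuous_tsum (fun m => continuous_const.mul (continuous_character m)) ha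
    fun m x => (hn m x).le, fun x => ?_⟩
  refine (norm_tsum_le_tsum_norm (by simpa only [hn] using ha)).trans ?_
  simp only [hn, le_refl]

/-- A square-integrable function with summable Fourier coefficients is the sum of its Fourier
series. -/
theorem ae_eq_tsum_character {p : (Fin 3 → ℝ) → ℂ} (hp : MemLp p 2 boxMeasure)
    (ha : Summable fun m => ‖coeff p m‖) :
    p =ᵐ[boxMeasure] fun x => ∑' m, coeff p m * character m x := by
  obtain ⟨hc, hb⟩ := memLp_tsum_character ha
  set g : (Fin 3 → ℝ) → ℂ := fun x => ∑' m, coeff p m * character m x with hg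
  have hgL : MemLp g 2 boxMeasure :=
    MemLp.of_bound hc.aestronglyMeasurable _ (Filter.Eventually.of_forall hb)
  -- Multiplying the series by the constant character 0 reads off its coefficients; p and the series
  -- then agree by Parseval.
  have hgc : ∀ k, coeff g k = coeff p k := by
    intro k
    have h1 := hasSum_coeff_mul ha (q := character 0)
      ((integrable_const (1 : ℂ)).mono (continuous_character 0).aestronglyMeasurable
        (Filter.Eventually.of_forall fun x => by simp [norm_character])) k
    have hc0 : ∀ x, character 0 x = 1 := fun x => by simp [character]
    simp only [coeff_character, hc0, mul_one, sub_eq_zero] at h1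
    have h2 := hasSum_ite_eq k (coeff p k)
    refine h1.unique (h2.congr_fun fun m => ?_)
    by_cases h : m = k
    · subst h; simp
    · simp [h, Ne.symm h]
  have hneg : MemLp (fun x => p x + (-1) * g x) 2 boxMeasure := hp.add (hgL.const_mul (-1))
  have h0 := hasSum_sq_coeff hneg
  have hz : ∀ k, coeff (fun x => p x + (-1) * g x) k = 0 := by
    intro k
    rw [coeff_add (hp.integrable (by norm_num)) ((hgL.integrable (by norm_num)).const_mul _),
      coeff_const_mul, hgc]
    ring
  simp only [hz, norm_zero, ne_eq, OfNat.ofNat_ne_zero, not_false_eq_true, zero_pow] at h0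
  have h1 := h0.unique hasSum_zero
  have h2 : ((2 * Real.pi) ^ 3)⁻¹ ≠ 0 := by positivity
  have h3 := (mul_eq_zero.1 h1).resolve_left h2
  rw [integral_eq_zero_iff_of_nonneg (fun x => by positivity)
    (hneg.integrable_norm_pow (by norm_num))] at h3
  filter_upwards [h3] with x hx
  have : p x + (-1) * g x = 0 := by simpa using hx
  linear_combination this

/-! ### Gevrey sums -/

/-- `|û(k)|` as an extended nonnegative real. -/
def en (u : L2) (k : Fin 3 → ℤ) : ℝ≥0∞ := ‖fc u k‖ₑ

theorem en_eq (u : L2) (k : Fin 3 → ℤ) : en u k = ENNReal.ofReal ‖fc u k‖ :=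
  (ofReal_norm _).symm

theorem en_zero_of_mem_H {u : L2} (hu : u ∈ H) : en u 0 = 0 := by
  rw [en, fc_zero_of_mem_H hu, enorm_zero]

/-- The sum `∑ (|k|^{2α} e^{σ|k|} |û(k)|)²`. -/
def gsum (α σ : ℝ) (u : L2) : ℝ≥0∞ := ∑' k, (ENNReal.ofReal (gsymb α σ k) * en u k) ^ 2

theorem ofReal_gsymb_mul_en_sq (α σ : ℝ) (u : L2) (k : Fin 3 → ℤ) :
    (ENNReal.ofReal (gsymb α σ k) * en u k) ^ 2 =
      ENNReal.ofReal ((gsymb α σ k * ‖fc u k‖) ^ 2) := by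
  have := gsymb_nonneg α σ k
  rw [en_eq, ← ENNReal.ofReal_mul this, ENNReal.ofReal_pow (by positivity)]

theorem mem_gevreyClass_iff_gsum {α σ : ℝ} {u : L2} :
    u ∈ gevreyClass α σ ↔ u ∈ H ∧ gsum α σ u < ∞ := by
  rw [mem_gevreyClass_iff, gsum]
  simp only [ofReal_gsymb_mul_en_sq]
  refine and_congr_right fun _ => ⟨fun h => h.tsum_ofReal_lt_top, fun h => ?_⟩
  have := ENNReal.summable_toReal h.ne
  refine this.congr fun k => ?_
  rw [ENNReal.toReal_ofReal (by positivity)]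

theorem gsum_eq {α σ : ℝ} {u : L2} (hu : u ∈ gevreyClass α σ) :
    gsum α σ u = ENNReal.ofReal (((2 * Real.pi) ^ 3)⁻¹ * gevreyNorm α σ u ^ 2) := by
  have h := hasSum_gevreyNorm hu
  rw [gsum, ← h.tsum_eq, ENNReal.ofReal_tsum_of_nonneg (fun k => by positivity) h.summable]
  simp only [ofReal_gsymb_mul_en_sq]

theorem gevreyNorm_nonneg (α σ : ℝ) (u : L2) : 0 ≤ gevreyNorm α σ u := norm_nonneg _

theorem gsymb_mono {α α' σ σ' : ℝ} (hα : α ≤ α') (hσ : σ ≤ σ') {k : Fin 3 → ℤ} (hk : k ≠ 0) :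
    gsymb α σ k ≤ gsymb α' σ' k := by
  have h1 := one_le_waveNorm hk
  unfold gsymb
  gcongr

theorem gevreyClass_mono {α α' σ σ' : ℝ} (hα : α ≤ α') (hσ : σ ≤ σ') {u : L2}
    (hu : u ∈ gevreyClass α' σ') :
    u ∈ gevreyClass α σ ∧ gevreyNorm α σ u ≤ gevreyNorm α' σ' u := by
  have hle : ∀ k, gsymb α σ k * ‖fc u k‖ ≤ gsymb α' σ' k * ‖fc u k‖ := by
    intro k
    by_cases hk : k = 0
    · rw [hk, fc_zero_of_mem_H hu.1, norm_zero, mul_zero, mul_zero]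
    · exact mul_le_mul_of_nonneg_right (gsymb_mono hα hσ hk) (norm_nonneg _)
  have hmem : u ∈ gevreyClass α σ := by
    refine mem_gevreyClass_iff.2 ⟨hu.1, Summable.of_nonneg_of_le (fun k => by positivity)
      (fun k => ?_) (mem_gevreyClass_iff.1 hu).2⟩
    have := gsymb_nonneg α σ k
    exact pow_le_pow_left₀ (by positivity) (hle k) 2
  refine ⟨hmem, ?_⟩
  have := norm_le_of_fc_le (u := gevreyOp α σ u) (v := gevreyOp α' σ' u) (C := 1) zero_le_one
    (fun k => by
      rw [(gevreyOp_spec hmem).2, (gevreyOp_spec hu).2, norm_smul, norm_smul, one_mul,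
        Real.norm_of_nonneg (gsymb_nonneg _ _ _), Real.norm_of_nonneg (gsymb_nonneg _ _ _)]
      exact hle k)
  rwa [one_mul] at this

theorem gevreyClass_sub {α σ : ℝ} {u v : L2} (hu : u ∈ gevreyClass α σ)
    (hv : v ∈ gevreyClass α σ) : u - v ∈ gevreyClass α σ := by
  refine ⟨H.sub_mem hu.1 hv.1, gevreyOp α σ u - gevreyOp α σ v, hasMultiplier_iff.2
    ⟨H.sub_mem (gevreyOp_spec hu).1 (gevreyOp_spec hv).1, fun k => ?_⟩⟩
  rw [fc_sub, fc_sub, (gevreyOp_spec hu).2, (gevreyOp_spec hv).2, smul_sub, gevreySymbol_eq]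
  rfl

theorem gevreyOp_sub {α σ : ℝ} {u v : L2} (hu : u ∈ gevreyClass α σ)
    (hv : v ∈ gevreyClass α σ) : gevreyOp α σ (u - v) = gevreyOp α σ u - gevreyOp α σ v := by
  refine gevreyOp_eq (H.sub_mem (gevreyOp_spec hu).1 (gevreyOp_spec hv).1) fun k => ?_
  rw [fc_sub, fc_sub, (gevreyOp_spec hu).2, (gevreyOp_spec hv).2, smul_sub]

theorem gsymb_half (k : Fin 3 → ℤ) : gsymb (1 / 2) 0 k = waveNorm k := by
  simp [gsymb]

theorem gsymb_one (k : Fin 3 → ℤ) : gsymb 1 0 k = waveNorm k ^ 2 := by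
  simp [gsymb]

/-! ### The bilinear map -/

/-- Cauchy–Schwarz against |k|^{-2}, using ∑|k|^{-4} < ∞. Fields in D(A) are therefore bounded,
which makes (u·∇)v square integrable and its Fourier series a convolution. -/
theorem summable_norm_fc {u : L2} (hu : u ∈ domA 1) : Summable fun k => ‖fc u k‖ := by
  have h1 : ∑' k, en u k < ∞ := by
    have h2 : ∀ k, en u k = kinv k ^ 2 * (ENNReal.ofReal (gsymb 1 0 k) * en u k) := by
      intro k
      by_cases hk : k = 0
      · rw [hk, en_zero_of_mem_H hu.1, mul_zero, mul_zero]
      · rw [gsymb_one, ENNReal.ofReal_pow (waveNorm_nonneg k), ← mul_assoc, ← mul_pow,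
          ← kn, kinv_mul_kn hk, one_pow, one_mul]
    have h3 := tsum_mul_sq_le (fun k => kinv k ^ 2) (fun k => ENNReal.ofReal (gsymb 1 0 k) * en u k)
    simp only [← h2] at h3
    have h4 : (∑' k, en u k) ^ 2 < ∞ := by
      refine h3.trans_lt (ENNReal.mul_lt_top ?_ (mem_gevreyClass_iff_gsum.1 hu).2)
      have := tsum_kinv_rpow_lt_top (r := 4) (by norm_num)
      refine lt_of_eq_of_lt (tsum_congr fun k => ?_) this
      rw [← pow_mul, ← ENNReal.rpow_natCast]
      norm_num
    exact (ENNReal.pow_lt_top_iff (n := 2)).1 h4 |>.resolve_right (by norm_num)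
  refine (ENNReal.summable_toReal h1.ne).congr fun k => ?_
  rw [en, toReal_enorm]

theorem summable_norm_component {u : L2} (hu : u ∈ domA 1) (j : Fin 3) :
    Summable fun m => ‖coeff (fun x => ((u x j : ℝ) : ℂ)) m‖ :=
  Summable.of_nonneg_of_le (fun _ => norm_nonneg _) (fun m => PiLp.norm_apply_le (fc u m) j)
    (summable_norm_fc hu)

theorem ae_bound_component {u : L2} (hu : u ∈ domA 1) (j : Fin 3) :
    ∃ C : ℝ, ∀ᵐ x ∂boxMeasure, |u x j| ≤ C := by
  have hs := summable_norm_component hu j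
  refine ⟨∑' m, ‖coeff (fun x => ((u x j : ℝ) : ℂ)) m‖, ?_⟩
  filter_upwards [ae_eq_tsum_character (memLp_component u j) hs] with x hx
  have := (memLp_tsum_character hs).2 x
  rw [← hx, Complex.norm_real] at this
  exact this

theorem exists_partialDeriv (j : Fin 3) {v : L2} (hv : v ∈ domA (1 / 2)) :
    ∃ w, HasMultiplier (fun k => Complex.I * (k j : ℂ)) v w := by
  refine exists_hasMultiplier (fun k => by simp) hv.1 ?_
  refine Summable.of_nonneg_of_le (fun k => by positivity) (fun k => ?_)
    (mem_gevreyClass_iff.1 hv).2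
  rw [gsymb_half]
  refine pow_le_pow_left₀ (by positivity) ?_ 2
  gcongr
  simpa using abs_le_waveNorm k j

theorem fc_partialDeriv (j : Fin 3) {v : L2} (hv : v ∈ domA (1 / 2)) (k : Fin 3 → ℤ) :
    fc (partialDeriv j v) k = (Complex.I * (k j : ℂ)) • fc v k := by
  obtain ⟨w, hw⟩ := exists_partialDeriv j hv
  rw [partialDeriv, hw.multiplier_eq]
  exact (hasMultiplier_iff.1 hw).2 k

theorem partialDeriv_sub (j : Fin 3) {v v' : L2} (hv : v ∈ domA (1 / 2))
    (hv' : v' ∈ domA (1 / 2)) :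
    partialDeriv j (v - v') = partialDeriv j v - partialDeriv j v' := by
  refine fc_injective fun k => ?_
  rw [fc_partialDeriv j (gevreyClass_sub hv hv'), fc_sub, fc_sub, fc_partialDeriv j hv,
    fc_partialDeriv j hv', smul_sub]

theorem memLp_advection {u v : L2} (hu : u ∈ domA 1) : MemLp (advection u v) 2 boxMeasure := by
  have h : advection u v = fun x => ∑ j, (u x j) • (partialDeriv j v x) := rfl
  rw [h]
  refine memLp_finsetSum _ fun j _ => ?_
  obtain ⟨C, hC⟩ := ae_bound_component hu j
  refine MemLp.of_le_mul (Lp.memLp (partialDeriv j v)) (c := C) ?_ ?_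
  · have hm : AEStronglyMeasurable (fun x => u x j) boxMeasure :=
      (EuclideanSpace.proj (𝕜 := ℝ) j).continuous.comp_aestronglyMeasurable (Lp.memLp u).1
    exact hm.smul (Lp.memLp (partialDeriv j v)).1
  · filter_upwards [hC] with x hx
    rw [norm_smul]
    exact mul_le_mul_of_nonneg_right hx (norm_nonneg _)

theorem bilin_eq {u v : L2} (hu : u ∈ domA 1) :
    bilin u v = leray ((memLp_advection (v := v) hu).toLp (advection u v)) := by
  unfold bilin
  rw [dif_pos (memLp_advection hu)]

theorem bilin_mem_H (u v : L2) : bilin u v ∈ H := by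
  unfold bilin
  split_ifs
  · exact leray_mem _
  · exact H.zero_mem

theorem bilin_sub_left {u u' v : L2} (hu : u ∈ domA 1) (hu' : u' ∈ domA 1) :
    bilin (u - u') v = bilin u v - bilin u' v := by
  rw [bilin_eq (gevreyClass_sub hu hu'), bilin_eq hu, bilin_eq hu', ← map_sub, ← MemLp.toLp_sub]
  congr 1
  refine MemLp.toLp_congr _ _ ?_
  filter_upwards [Lp.coeFn_sub u u'] with x hx
  simp only [advection, Pi.sub_apply, hx, PiLp.sub_apply, sub_smul, Finset.sum_sub_distrib]

theorem bilin_sub_right {u v v' : L2} (hu : u ∈ domA 1) (hv : v ∈ domA (1 / 2))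
    (hv' : v' ∈ domA (1 / 2)) :
    bilin u (v - v') = bilin u v - bilin u v' := by
  rw [bilin_eq hu, bilin_eq hu, bilin_eq hu, ← map_sub, ← MemLp.toLp_sub]
  congr 1
  refine MemLp.toLp_congr _ _ ?_
  have h : ∀ᵐ x ∂boxMeasure, ∀ j, partialDeriv j (v - v') x =
      partialDeriv j v x - partialDeriv j v' x := by
    rw [ae_all_iff]
    intro j
    rw [partialDeriv_sub j hv hv']
    exact Lp.coeFn_sub _ _
  filter_upwards [h] with x hx
  simp [advection, hx, smul_sub]

theorem coeff_add_add {f g h : (Fin 3 → ℝ) → ℂ} (hf : Integrable f boxMeasure)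
    (hg : Integrable g boxMeasure) (hh : Integrable h boxMeasure) (k : Fin 3 → ℤ) :
    coeff (fun x => f x + g x + h x) k = coeff f k + coeff g k + coeff h k := by
  rw [coeff_add (f := fun x => f x + g x) (hf.add hg) hh, coeff_add hf hg]

theorem hasSum_fc_advection {u v : L2} (hu : u ∈ domA 1) (hv : v ∈ domA (1 / 2))
    (k : Fin 3 → ℤ) :
    HasSum (fun m => (Complex.I * inner ℂ (kvec (k - m)) (fc u m)) • fc v (k - m))
      (fc ((memLp_advection (v := v) hu).toLp (advection u v)) k) := by
  have hprod : ∀ i j, HasSum (fun m => fc u m j * fc (partialDeriv j v) (k - m) i)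
      (coeff (fun x => ((u x j : ℝ) : ℂ) * ((partialDeriv j v x i : ℝ) : ℂ)) k) := by
    intro i j
    have hs := summable_norm_component hu j
    have h := hasSum_coeff_mul hs (integrable_component (partialDeriv j v) i) k
    rw [coeff_congr_ae (g := fun x => ((u x j : ℝ) : ℂ) * ((partialDeriv j v x i : ℝ) : ℂ))] at h
    · exact h
    · filter_upwards [ae_eq_tsum_character (memLp_component u j) hs] with x hx
      rw [← hx]
  have hint : ∀ i j, Integrable
      (fun x => ((u x j : ℝ) : ℂ) * ((partialDeriv j v x i : ℝ) : ℂ)) boxMeasure := fun i j =>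
    (memLp_component u j).integrable_mul (memLp_component (partialDeriv j v) i)
  have hcomp : ∀ i, HasSum
      (fun m => ((Complex.I * inner ℂ (kvec (k - m)) (fc u m)) • fc v (k - m)) i)
      (fc ((memLp_advection (v := v) hu).toLp (advection u v)) k i) := by
    intro i
    rw [fc_congr (MemLp.coeFn_toLp (memLp_advection (v := v) hu))]
    have e : (fun x => ((advection u v x i : ℝ) : ℂ)) = fun x =>
        ((u x 0 : ℝ) : ℂ) * ((partialDeriv 0 v x i : ℝ) : ℂ) +
        ((u x 1 : ℝ) : ℂ) * ((partialDeriv 1 v x i : ℝ) : ℂ) +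
        ((u x 2 : ℝ) : ℂ) * ((partialDeriv 2 v x i : ℝ) : ℂ) := by
      ext x
      simp [advection, Fin.sum_univ_three]
    rw [e, coeff_add_add (hint i 0) (hint i 1) (hint i 2)]
    refine (((hprod i 0).add (hprod i 1)).add (hprod i 2)).congr_fun fun m => ?_
    simp only [fc_partialDeriv _ hv, inner_kvec, Fin.sum_univ_three, PiLp.smul_apply, smul_eq_mul]
    ring
  have h1 : HasSum (fun m => WithLp.ofLp
      ((Complex.I * inner ℂ (kvec (k - m)) (fc u m)) • fc v (k - m)))
      (WithLp.ofLp (fc ((memLp_advection (v := v) hu).toLp (advection u v)) k)) :=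
    Pi.hasSum.2 hcomp
  exact (PiLp.continuousLinearEquiv 2 ℂ (fun _ : Fin 3 => ℂ)).symm.hasSum.2 h1

/-- The Leray projection does not increase any coefficient, and the symbol of the derivative costs
at most the length |k-j| of the frequency of v. -/
theorem en_bilin_le {u v : L2} (hu : u ∈ domA 1) (hv : v ∈ domA (1 / 2)) (k : Fin 3 → ℤ) :
    en (bilin u v) k ≤ ∑' j, en u j * (kn (k - j) * en v (k - j)) := by
  have h := hasSum_fc_advection hu hv k
  calc en (bilin u v) k ≤ ‖fc ((memLp_advection (v := v) hu).toLp (advection u v)) k‖ₑ := by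
        rw [en, bilin_eq hu, enorm_le_iff_norm_le]
        exact norm_fc_leray_le _ k
    _ ≤ ∑' j, ‖(Complex.I * inner ℂ (kvec (k - j)) (fc u j)) • fc v (k - j)‖ₑ := by
        rw [← h.tsum_eq]
        exact enorm_tsum_le_tsum_enorm
    _ ≤ _ := by
        refine ENNReal.tsum_le_tsum fun j => ?_
        rw [en_eq, kn, en_eq, ← ofReal_norm,
          ← ENNReal.ofReal_mul (waveNorm_nonneg _), ← ENNReal.ofReal_mul (norm_nonneg _)]
        refine ENNReal.ofReal_le_ofReal ?_
        rw [norm_smul, norm_mul, Complex.norm_I, one_mul, ← mul_assoc, mul_comm ‖fc u j‖,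
          ← norm_kvec]
        gcongr
        exact norm_inner_le_norm _ _

/-! ### The bilinear estimate -/

theorem add_rpow_le_four_rpow {a b α : ℝ} (ha : 0 ≤ a) (hb : 0 ≤ b) (hα : 0 ≤ α) :
    (a + b) ^ (2 * α) ≤ 4 ^ α * (a ^ (2 * α) + b ^ (2 * α)) := by
  have h4 : (4 : ℝ) ^ α = 2 ^ (2 * α) := by
    rw [Real.rpow_mul (by norm_num)]; norm_num
  have hm : (max a b) ^ (2 * α) ≤ a ^ (2 * α) + b ^ (2 * α) := by
    have h1 := Real.rpow_nonneg ha (2 * α)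
    have h2 := Real.rpow_nonneg hb (2 * α)
    rcases max_cases a b with ⟨h, -⟩ | ⟨h, -⟩ <;> rw [h] <;> linarith
  calc (a + b) ^ (2 * α) ≤ (2 * max a b) ^ (2 * α) := by
        refine Real.rpow_le_rpow (by positivity) ?_ (by positivity)
        linarith [le_max_left a b, le_max_right a b]
    _ = 4 ^ α * (max a b) ^ (2 * α) := by
        rw [Real.mul_rpow (by norm_num) (by positivity), h4]
    _ ≤ _ := by gcongr

/-- In (a+b)^{2α} ≤ 4^α(a^{2α}+b^{2α}), the first term is absorbed by the weight a⁻¹b⁻¹ and the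
second by a⁻². Both absorptions need 2α ≥ 1. -/
theorem weight_product_le {a b α : ℝ} (ha : 1 ≤ a) (hb : 1 ≤ b) (hα : 1 / 2 ≤ α) :
    (a + b) ^ (2 * α) * b ≤
      4 ^ α * (a⁻¹ * b⁻¹ + a⁻¹ ^ 2) * (a ^ (2 * (α + 1 / 2)) * b ^ (2 * (α + 1 / 2))) := by
  have ha0 : 0 < a := by linarith
  have hb0 : 0 < b := by linarith
  have e : 2 * (α + 1 / 2) = 2 * α + 1 := by ring
  have e2 : 2 * α = (2 * α - 1) + 1 := by ring
  rw [e, Real.rpow_add_one ha0.ne', Real.rpow_add_one hb0.ne']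
  have hx : 1 ≤ a ^ (2 * α - 1) := Real.one_le_rpow ha (by linarith)
  have hy : 1 ≤ b ^ (2 * α - 1) := Real.one_le_rpow hb (by linarith)
  have hX : a ^ (2 * α) = a ^ (2 * α - 1) * a := by
    rw [← Real.rpow_add_one ha0.ne']; ring_nf
  have hY : b ^ (2 * α) = b ^ (2 * α - 1) * b := by
    rw [← Real.rpow_add_one hb0.ne']; ring_nf
  have h1 := add_rpow_le_four_rpow ha0.le hb0.le (α := α) (by linarith)
  have h4 : (0 : ℝ) < 4 ^ α := by positivity
  have e3 : 4 ^ α * (a⁻¹ * b⁻¹ + a⁻¹ ^ 2) * (a ^ (2 * α) * a * (b ^ (2 * α) * b)) =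
      4 ^ α * (a ^ (2 * α) * b ^ (2 * α) + a ^ (2 * α - 1) * b ^ (2 * α) * b) := by
    rw [hX]
    field_simp
  rw [e3]
  calc (a + b) ^ (2 * α) * b ≤ 4 ^ α * (a ^ (2 * α) + b ^ (2 * α)) * b := by gcongr
    _ = 4 ^ α * (a ^ (2 * α) * b + b ^ (2 * α) * b) := by ring
    _ ≤ _ := by
      have hA : 0 < a ^ (2 * α) := by positivity
      have hB : 0 < b ^ (2 * α) := by positivity
      have : b ≤ b ^ (2 * α) := by rw [hY]; nlinarith
      have h5 : b ^ (2 * α) * b ≤ a ^ (2 * α - 1) * b ^ (2 * α) * b := by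
        have : 0 < b ^ (2 * α) * b := by positivity
        nlinarith
      gcongr

theorem gsymb_add_mul_le {α σ : ℝ} (hα : 1 / 2 ≤ α) (hσ : 0 ≤ σ) {j l : Fin 3 → ℤ} (hj : j ≠ 0)
    (hl : l ≠ 0) :
    gsymb α σ (j + l) * waveNorm l ≤
      4 ^ α * ((waveNorm j)⁻¹ * (waveNorm l)⁻¹ + (waveNorm j)⁻¹ ^ 2) *
        (gsymb (α + 1 / 2) σ j * gsymb (α + 1 / 2) σ l) := by
  have ha := one_le_waveNorm hj
  have hb := one_le_waveNorm hl
  have h := weight_product_le ha hb hα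
  have hadd := waveNorm_add_le j l
  have h0 := waveNorm_nonneg (j + l)
  unfold gsymb
  set a := waveNorm j
  set b := waveNorm l
  calc waveNorm (j + l) ^ (2 * α) * Real.exp (σ * waveNorm (j + l)) * b
      ≤ (a + b) ^ (2 * α) * Real.exp (σ * (a + b)) * b := by gcongr
    _ = (a + b) ^ (2 * α) * b * (Real.exp (σ * a) * Real.exp (σ * b)) := by
        rw [mul_add, Real.exp_add]; ring
    _ ≤ 4 ^ α * (a⁻¹ * b⁻¹ + a⁻¹ ^ 2) * (a ^ (2 * (α + 1 / 2)) * b ^ (2 * (α + 1 / 2))) *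
        (Real.exp (σ * a) * Real.exp (σ * b)) := by gcongr
    _ = _ := by ring

theorem add_sq_le_four (x y : ℝ≥0∞) : (x + y) ^ 2 ≤ 4 * (x ^ 2 + y ^ 2) := by
  rcases le_total x y with h | h
  · calc (x + y) ^ 2 ≤ (y + y) ^ 2 := by gcongr
      _ = 4 * y ^ 2 := by ring
      _ ≤ _ := by gcongr; exact le_add_self
  · calc (x + y) ^ 2 ≤ (x + x) ^ 2 := by gcongr
      _ = 4 * x ^ 2 := by ring
      _ ≤ _ := by gcongr; exact le_self_add

theorem tsum_kinv_weight_le (k : Fin 3 → ℤ) :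
    ∑' j, (kinv j * kinv (k - j) + kinv j ^ 2) ^ 2 ≤ 12 * latticeSum 4 := by
  calc ∑' j, (kinv j * kinv (k - j) + kinv j ^ 2) ^ 2
      ≤ ∑' j, 4 * (kinv j ^ (2 : ℝ) * kinv (k - j) ^ (2 : ℝ) + kinv j ^ (4 : ℝ)) := by
        refine ENNReal.tsum_le_tsum fun j => (add_sq_le_four _ _).trans (le_of_eq ?_)
        rw [mul_pow, ← pow_mul]
        congr 2
        · rw [← ENNReal.rpow_natCast, ← ENNReal.rpow_natCast]; norm_num
        · rw [← ENNReal.rpow_natCast]; norm_num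
    _ ≤ 4 * (2 * latticeSum 4 + latticeSum 4) := by
        rw [ENNReal.tsum_mul_left, ENNReal.tsum_add]
        gcongr
        · have h := tsum_kinv_conv_le (p := 2) (q := 2) (by norm_num) (by norm_num) k
          rwa [show (2 : ℝ) + 2 = 4 by norm_num] at h
        · exact le_rfl
    _ = _ := by ring

/-- Each output frequency k = j + l is handled by `gsymb_add_mul_le`; what remains is a convolution
with the square-summable weight of `tsum_kinv_weight_le`. -/
theorem gsum_bilin_le {α σ : ℝ} (hα : 1 / 2 ≤ α) (hσ : 0 ≤ σ) {u v : L2}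
    (hu : u ∈ gevreyClass (α + 1 / 2) σ) (hv : v ∈ gevreyClass (α + 1 / 2) σ) :
    gsum α σ (bilin u v) ≤ ENNReal.ofReal (4 ^ α) ^ 2 *
      (12 * latticeSum 4 * (gsum (α + 1 / 2) σ u * gsum (α + 1 / 2) σ v)) := by
  have hu1 : u ∈ domA 1 := (gevreyClass_mono (by linarith) hσ hu).1
  have hv1 : v ∈ domA (1 / 2) := (gevreyClass_mono (by linarith) hσ hv).1
  have key : ∀ k, ENNReal.ofReal (gsymb α σ k) * en (bilin u v) k ≤
      ENNReal.ofReal (4 ^ α) * ∑' j, (kinv j * kinv (k - j) + kinv j ^ 2) *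
        ((ENNReal.ofReal (gsymb (α + 1 / 2) σ j) * en u j) *
          (ENNReal.ofReal (gsymb (α + 1 / 2) σ (k - j)) * en v (k - j))) := by
    intro k
    calc ENNReal.ofReal (gsymb α σ k) * en (bilin u v) k
        ≤ ENNReal.ofReal (gsymb α σ k) * ∑' j, en u j * (kn (k - j) * en v (k - j)) := by
          gcongr
          exact en_bilin_le hu1 hv1 k
      _ ≤ _ := by
          rw [← ENNReal.tsum_mul_left, ← ENNReal.tsum_mul_left]
          refine ENNReal.tsum_le_tsum fun j => ?_
          by_cases hj : j = 0
          · rw [hj, en_zero_of_mem_H hu.1]; simp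
          by_cases hl : k - j = 0
          · rw [hl, en_zero_of_mem_H hv.1]; simp
          have h := gsymb_add_mul_le hα hσ hj hl
          rw [add_sub_cancel] at h
          have h0 := gsymb_nonneg α σ k
          have h1 := gsymb_nonneg (α + 1 / 2) σ j
          have h2 := gsymb_nonneg (α + 1 / 2) σ (k - j)
          have h3 := waveNorm_nonneg j
          have h4 := waveNorm_nonneg (k - j)
          have h5 := ENNReal.ofReal_le_ofReal h
          rw [ENNReal.ofReal_mul h0, ENNReal.ofReal_mul (by positivity),
            ENNReal.ofReal_mul (by positivity), ENNReal.ofReal_add (by positivity) (by positivity),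
            ENNReal.ofReal_mul (by positivity), ENNReal.ofReal_pow (by positivity),
            ENNReal.ofReal_mul h1] at h5
          change ENNReal.ofReal (gsymb α σ k) * kn (k - j) ≤
            ENNReal.ofReal (4 ^ α) * (kinv j * kinv (k - j) + kinv j ^ 2) * _ at h5
          calc _ = ENNReal.ofReal (gsymb α σ k) * kn (k - j) * (en u j * en v (k - j)) := by ring
            _ ≤ _ * (en u j * en v (k - j)) := mul_le_mul_left h5 _
            _ = _ := by ring
  calc gsum α σ (bilin u v)
      ≤ ∑' k, (ENNReal.ofReal (4 ^ α) * ∑' j, (kinv j * kinv (k - j) + kinv j ^ 2) *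
        ((ENNReal.ofReal (gsymb (α + 1 / 2) σ j) * en u j) *
          (ENNReal.ofReal (gsymb (α + 1 / 2) σ (k - j)) * en v (k - j)))) ^ 2 :=
        ENNReal.tsum_le_tsum fun k => pow_le_pow_left' (key k) 2
    _ ≤ _ := by
        simp only [mul_pow _ _ 2]
        rw [ENNReal.tsum_mul_left]
        gcongr
        have := tsum_conv_sq_le (g := fun j l => kinv j * kinv l + kinv j ^ 2) tsum_kinv_weight_le
          (fun j => ENNReal.ofReal (gsymb (α + 1 / 2) σ j) * en u j)
          (fun j => ENNReal.ofReal (gsymb (α + 1 / 2) σ j) * en v j)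
        simpa only [gsum, mul_pow] using this

theorem latticeSum_lt_top {r : ℝ} (hr : 3 < r) : latticeSum r < ∞ := tsum_kinv_rpow_lt_top hr

theorem exists_isBilinConstant : ∃ K : ℝ, IsBilinConstant K := by
  set Λ : ℝ := (latticeSum 4).toReal with hΛ
  have hΛ' : latticeSum 4 = ENNReal.ofReal Λ :=
    (ENNReal.ofReal_toReal (latticeSum_lt_top (by norm_num)).ne).symm
  have hΛ0 : 0 ≤ Λ := ENNReal.toReal_nonneg
  set c : ℝ := ((2 * Real.pi) ^ 3)⁻¹ with hc
  have hc0 : 0 < c := by positivity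
  set L : ℝ := max 1 (Real.sqrt (12 * Λ * c)) with hL
  have hL1 : 1 ≤ L := le_max_left _ _
  refine ⟨4 * L ^ 2, by nlinarith, fun α σ hα hσ u hu v hv => ?_⟩
  have h := gsum_bilin_le hα hσ hu hv
  have hmem : bilin u v ∈ gevreyClass α σ := by
    refine mem_gevreyClass_iff_gsum.2 ⟨bilin_mem_H u v, h.trans_lt ?_⟩
    refine ENNReal.mul_lt_top (by simp) (ENNReal.mul_lt_top (ENNReal.mul_lt_top (by simp)
      (latticeSum_lt_top (by norm_num))) (ENNReal.mul_lt_top ?_ ?_))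
    · exact (mem_gevreyClass_iff_gsum.1 hu).2
    · exact (mem_gevreyClass_iff_gsum.1 hv).2
  refine ⟨hmem, ?_⟩
  rw [gsum_eq hmem, gsum_eq hu, gsum_eq hv, hΛ', ← hc] at h
  set x := gevreyNorm (α + 1 / 2) σ u
  set y := gevreyNorm (α + 1 / 2) σ v
  have hx : 0 ≤ x := norm_nonneg _
  have hy : 0 ≤ y := norm_nonneg _
  have h12 : (12 : ℝ≥0∞) = ENNReal.ofReal 12 := by norm_num
  rw [h12, ← ENNReal.ofReal_pow (by positivity), ← ENNReal.ofReal_mul (by positivity),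
    ← ENNReal.ofReal_mul (by positivity), ← ENNReal.ofReal_mul (by positivity),
    ← ENNReal.ofReal_mul (by positivity), ENNReal.ofReal_le_ofReal_iff (by positivity)] at h
  have hLs : 12 * Λ * c ≤ L ^ 2 := by
    rw [← Real.sq_sqrt (show 0 ≤ 12 * Λ * c by positivity)]
    exact pow_le_pow_left₀ (Real.sqrt_nonneg _) (le_max_right _ _) 2
  have h1 : gevreyNorm α σ (bilin u v) ≤ 4 ^ α * L * x * y := by
    refine le_of_sq_le_sq (le_of_mul_le_mul_left ?_ hc0) (by positivity)
    calc c * gevreyNorm α σ (bilin u v) ^ 2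
        ≤ (4 ^ α) ^ 2 * (12 * Λ * (c * x ^ 2 * (c * y ^ 2))) := h
      _ = c * ((4 ^ α) ^ 2 * (12 * Λ * c) * (x ^ 2 * y ^ 2)) := by ring
      _ ≤ c * ((4 ^ α) ^ 2 * L ^ 2 * (x ^ 2 * y ^ 2)) := by gcongr
      _ = _ := by ring
  refine h1.trans ?_
  -- The prefactor L, independent of α, is hidden in the power: L ≤ L^{2α} because L ≥ 1 and 2α ≥ 1.
  have h2 : 4 ^ α * L ≤ (4 * L ^ 2) ^ α := by
    rw [Real.mul_rpow (by norm_num) (by positivity), ← Real.rpow_natCast, ← Real.rpow_mul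
      (by positivity)]
    gcongr
    calc L = L ^ (1 : ℝ) := (Real.rpow_one L).symm
      _ ≤ _ := Real.rpow_le_rpow_of_exponent_le hL1 (by push_cast; linarith)
  gcongr

/-! ### Smoothing operators -/

theorem waveNorm_eq_zero_or (k : Fin 3 → ℤ) : waveNorm k = 0 ∨ 1 ≤ waveNorm k := by
  by_cases hk : k = 0
  · exact Or.inl (by rw [hk, waveNorm_zero])
  · exact Or.inr (one_le_waveNorm hk)

/-- Parseval and dominated convergence for series. -/
theorem tendsto_of_fc {x : L2} {T : ℝ → L2} {l : Filter ℝ} {y : L2} {C : ℝ}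
    (hT : ∀ᶠ τ in l, ∀ k, ‖fc (T τ) k - fc y k‖ ≤ C * ‖fc x k‖)
    (hk : ∀ k, Filter.Tendsto (fun τ => ‖fc (T τ) k - fc y k‖) l (nhds 0)) :
    Filter.Tendsto T l (nhds y) := by
  rw [tendsto_iff_norm_sub_tendsto_zero]
  have h1 : Filter.Tendsto (fun τ => ∑' k, ‖fc (T τ) k - fc y k‖ ^ 2) l
      (nhds (∑' _ : Fin 3 → ℤ, (0 : ℝ))) := by
    refine tendsto_tsum_of_dominated_convergence (bound := fun k => C ^ 2 * ‖fc x k‖ ^ 2)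
      ((hasSum_fc_sq x).summable.mul_left _) (fun k => ?_) ?_
    · simpa using (hk k).pow 2
    · filter_upwards [hT] with τ hτ k
      rw [Real.norm_of_nonneg (by positivity), ← mul_pow]
      exact pow_le_pow_left₀ (norm_nonneg _) (hτ k) 2
  rw [tsum_zero] at h1
  have h2 : ∀ τ, ‖T τ - y‖ = Real.sqrt ((2 * Real.pi) ^ 3 * ∑' k, ‖fc (T τ) k - fc y k‖ ^ 2) := by
    intro τ
    have h := hasSum_fc_sq (T τ - y)
    simp only [fc_sub] at h
    rw [h.tsum_eq, mul_inv_cancel_left₀ (by positivity), Real.sqrt_sq (norm_nonneg _)]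
  simp only [h2]
  have h3 := (h1.const_mul ((2 * Real.pi) ^ 3)).sqrt
  simpa using h3

/-- Strong continuity of a family of multipliers with locally bounded symbols. -/
theorem continuousAt_mulOp {φ : ℝ → ℝ → ℝ} {τ₀ C : ℝ}
    (hb : ∀ᶠ τ in nhds τ₀, ∀ k, |φ τ (waveNorm k)| ≤ C)
    (hc : ∀ k, ContinuousAt (fun τ => φ τ (waveNorm k)) τ₀) (x : L2) :
    ContinuousAt (fun τ => mulOp (φ τ) x) τ₀ := by
  have hb0 := hb.self_of_nhds
  have hC0 : 0 ≤ C := (abs_nonneg _).trans (hb0 0)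
  have hfc : ∀ τ, (∀ k, |φ τ (waveNorm k)| ≤ C) → ∀ k,
      ‖fc (mulOp (φ τ) x) k - fc (mulOp (φ τ₀) x) k‖ =
        |φ τ (waveNorm k) - φ τ₀ (waveNorm k)| * ‖fc x k‖ := by
    intro τ hτ k
    rw [fc_mulOp ⟨C, hτ⟩, fc_mulOp ⟨C, hb0⟩, ← sub_smul, norm_smul, Real.norm_eq_abs]
  refine tendsto_of_fc (x := x) (C := 2 * C) ?_ fun k => ?_
  · filter_upwards [hb] with τ hτ k
    rw [hfc τ hτ]
    gcongr
    refine (abs_sub _ _).trans ?_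
    linarith [hτ k, hb0 k]
  · have h := (((hc k).sub continuousAt_const).abs.mul continuousAt_const).tendsto
      (x := τ₀) (f := fun τ => |φ τ (waveNorm k) - φ τ₀ (waveNorm k)| * ‖fc x k‖)
    simp only [sub_self, abs_zero, zero_mul] at h
    refine h.congr' ?_
    filter_upwards [hb] with τ hτ
    rw [hfc τ hτ]

theorem continuousAt_mulOp_apply {φ : ℝ → ℝ → ℝ} {τ₀ C : ℝ}
    (hb : ∀ᶠ τ in nhds τ₀, ∀ k, |φ τ (waveNorm k)| ≤ C)
    (hc : ∀ k, ContinuousAt (fun τ => φ τ (waveNorm k)) τ₀) {y : ℝ → L2}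
    (hy : ContinuousAt y τ₀) : ContinuousAt (fun τ => mulOp (φ τ) (y τ)) τ₀ := by
  have hC0 : 0 ≤ C := (abs_nonneg _).trans (hb.self_of_nhds 0)
  have h1 := continuousAt_mulOp hb hc (y τ₀)
  have h2 : Filter.Tendsto (fun τ => mulOp (φ τ) (y τ - y τ₀)) (nhds τ₀) (nhds 0) := by
    have h3 : Filter.Tendsto (fun τ => C * ‖y τ - y τ₀‖) (nhds τ₀) (nhds 0) := by
      have h : ContinuousAt (fun τ => C * ‖y τ - y τ₀‖) τ₀ :=
        continuousAt_const.mul (hy.sub continuousAt_const).norm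
      simpa only [sub_self, norm_zero, mul_zero] using h.tendsto
    refine squeeze_zero_norm' ?_ h3
    filter_upwards [hb] with τ hτ
    refine norm_le_of_fc_le hC0 fun k => ?_
    rw [fc_mulOp ⟨C, hτ⟩, norm_smul]
    exact mul_le_mul_of_nonneg_right (hτ k) (norm_nonneg _)
  have h4 := h2.add h1.tendsto
  simp only [zero_add] at h4
  refine h4.congr fun τ => ?_
  rw [← map_add, sub_add_cancel]

/-- The symbol of the heat semigroup. -/
def heatSymbol (τ r : ℝ) : ℝ := Real.exp (-(r ^ 2 * τ))

/-- The symbol of `A^{1/2} e^{-τA}`, for `τ > 0`. -/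
def smoothSymbol (τ r : ℝ) : ℝ := if 0 < τ then r * Real.exp (-(r ^ 2 * τ)) else 0

theorem heatSymbol_le {τ : ℝ} (hτ : 0 ≤ τ) (r : ℝ) : |heatSymbol τ r| ≤ 1 := by
  rw [heatSymbol, abs_of_pos (Real.exp_pos _), Real.exp_le_one_iff]
  have : 0 ≤ r ^ 2 * τ := by positivity
  linarith

theorem bdd_heatSymbol {τ : ℝ} (hτ : 0 ≤ τ) : BddSymbol (heatSymbol τ) :=
  ⟨1, fun _ => heatSymbol_le hτ _⟩

/-- A crude bound from r ≤ r² and x ≤ eˣ. It is not integrable at τ = 0 and serves only for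
boundedness and continuity in τ > 0; the integrable majorant is `kernel`. -/
theorem smoothSymbol_le {τ : ℝ} (hτ : 0 < τ) (k : Fin 3 → ℤ) :
    |smoothSymbol τ (waveNorm k)| ≤ τ⁻¹ := by
  rw [smoothSymbol, if_pos hτ]
  rcases waveNorm_eq_zero_or k with h | h
  · rw [h, zero_mul, abs_zero]; positivity
  · set r := waveNorm k
    rw [abs_of_nonneg (by positivity), Real.exp_neg]
    have h1 := Real.add_one_le_exp (r ^ 2 * τ)
    rw [← div_eq_mul_inv, div_le_iff₀ (Real.exp_pos _)]
    have h2 : r ≤ r ^ 2 := by nlinarith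
    calc r ≤ r ^ 2 := h2
      _ = τ⁻¹ * (r ^ 2 * τ) := by field_simp
      _ ≤ τ⁻¹ * Real.exp (r ^ 2 * τ) := by
        gcongr
        linarith

theorem bdd_smoothSymbol (τ : ℝ) : BddSymbol (smoothSymbol τ) := by
  by_cases hτ : 0 < τ
  · exact ⟨_, smoothSymbol_le hτ⟩
  · exact ⟨0, fun k => by simp [smoothSymbol, hτ]⟩

theorem continuousAt_smooth {τ₀ : ℝ} (h0 : 0 < τ₀) {y : ℝ → L2} (hy : ContinuousAt y τ₀) :
    ContinuousAt (fun τ => mulOp (smoothSymbol τ) (y τ)) τ₀ := by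
  refine continuousAt_mulOp_apply (C := (τ₀ / 2)⁻¹) ?_ (fun k => ?_) hy
  · filter_upwards [eventually_gt_nhds (show τ₀ / 2 < τ₀ by linarith)] with τ hτ k
    refine (smoothSymbol_le (by linarith) k).trans ?_
    gcongr
  · have : ContinuousAt (fun τ => waveNorm k * Real.exp (-(waveNorm k ^ 2 * τ))) τ₀ := by fun_prop
    refine this.congr ?_
    filter_upwards [eventually_gt_nhds h0] with τ hτ
    simp [smoothSymbol, hτ]

theorem continuousAt_heat_max (t₀ : ℝ) (x : L2) :
    ContinuousAt (fun t => mulOp (heatSymbol (max t 0)) x) t₀ := by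
  refine continuousAt_mulOp (φ := fun t => heatSymbol (max t 0)) (C := 1)
    (Filter.Eventually.of_forall fun t k => heatSymbol_le (le_max_right _ _) _) (fun k => ?_) x
  unfold heatSymbol
  fun_prop

/-- The integrable part of the smoothing kernel. -/
def kernelSing : ℝ → ℝ := Set.indicator (Set.Ioc 0 (9 / 16)) fun τ => 3 / 4 * τ ^ (-1 / 2 : ℝ)

theorem kernelSing_nonneg (τ : ℝ) : 0 ≤ kernelSing τ := by
  refine Set.indicator_nonneg (fun τ hτ => ?_) τ
  have := hτ.1
  positivity

theorem integrableOn_kernel :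
    IntegrableOn (fun τ : ℝ => 3 / 4 * τ ^ (-1 / 2 : ℝ)) (Set.Ioc 0 (9 / 16)) := by
  rw [← intervalIntegrable_iff_integrableOn_Ioc_of_le (by norm_num)]
  exact (intervalIntegral.intervalIntegrable_rpow' (by norm_num)).const_mul _

theorem integrable_kernelSing : Integrable kernelSing :=
  (integrable_indicator_iff measurableSet_Ioc).2 integrableOn_kernel

theorem integral_kernelSing : ∫ τ, kernelSing τ = 9 / 8 := by
  unfold kernelSing
  rw [integral_indicator measurableSet_Ioc,
    ← intervalIntegral.integral_of_le (by norm_num), intervalIntegral.integral_const_mul,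
    integral_rpow (Or.inl (by norm_num))]
  have h : ((9 : ℝ) / 16) ^ (-1 / 2 + 1 : ℝ) = 3 / 4 := by
    rw [show (-1 / 2 + 1 : ℝ) = 1 / 2 by norm_num, ← Real.sqrt_eq_rpow,
      show (9 : ℝ) / 16 = (3 / 4) ^ 2 by norm_num, Real.sqrt_sq (by norm_num)]
  rw [h, Real.zero_rpow (by norm_num)]
  norm_num

/-- A majorant of the norm of `A^{1/2} e^{-τ(A - 1)}`. -/
def kernel (τ : ℝ) : ℝ := 1 + kernelSing τ

theorem kernel_nonneg (τ : ℝ) : 0 ≤ kernel τ := by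
  have := kernelSing_nonneg τ
  unfold kernel; linarith

/-- The cut 9/16 is where (3/4)τ^{-1/2} falls to 1. Below it, the square (9/16)τ⁻¹ turns the bracket
into (9/16)τ⁻¹ + r² - 1 ≥ r²; above it, the bracket alone exceeds r². -/
theorem sq_le_kernel_sq {r τ : ℝ} (hr : 1 ≤ r) (hτ : 0 < τ) :
    r ^ 2 ≤ kernel τ ^ 2 * (1 + 16 / 9 * τ * (r ^ 2 - 1)) := by
  have hr2 : 0 ≤ r ^ 2 - 1 := by nlinarith
  by_cases h : τ ≤ 9 / 16
  · have hk : kernelSing τ = 3 / 4 * τ ^ (-1 / 2 : ℝ) := 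
      Set.indicator_of_mem (show τ ∈ Set.Ioc (0 : ℝ) (9 / 16) from ⟨hτ, h⟩) _
    have hsq : (τ ^ (-1 / 2 : ℝ)) ^ 2 = τ⁻¹ := by
      rw [← Real.rpow_natCast, ← Real.rpow_mul hτ.le]
      norm_num
      exact Real.rpow_neg_one τ
    have h1 : 9 / 16 * τ⁻¹ ≤ kernel τ ^ 2 := by
      calc 9 / 16 * τ⁻¹ = kernelSing τ ^ 2 := by rw [hk, mul_pow, hsq]; norm_num
        _ ≤ _ := by
          have := kernelSing_nonneg τ
          unfold kernel
          gcongr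
          linarith
    have h2 : r ^ 2 ≤ 9 / 16 * τ⁻¹ * (1 + 16 / 9 * τ * (r ^ 2 - 1)) := by
      have : 9 / 16 * τ⁻¹ * (1 + 16 / 9 * τ * (r ^ 2 - 1)) = 9 / 16 * τ⁻¹ + (r ^ 2 - 1) := by
        field_simp
      rw [this]
      have : 1 ≤ 9 / 16 * τ⁻¹ := by
        rw [← div_eq_mul_inv, le_div_iff₀ hτ]; linarith
      linarith
    refine h2.trans ?_
    gcongr
  · have h1 : 1 ≤ kernel τ ^ 2 := by
      have := kernelSing_nonneg τ
      unfold kernel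
      nlinarith
    have h2 : r ^ 2 ≤ 1 + 16 / 9 * τ * (r ^ 2 - 1) := by nlinarith
    nlinarith

/-- The whole rate δ - τ is extracted at r = 1. Since δ(r-1) ≤ (τ/48)(r²-1), at least (8/9)τ(r²-1)
of damping is left, and 1 + x ≤ eˣ with `sq_le_kernel_sq` lets it absorb the factor r. -/
theorem smooth_gevrey_le_kernel {r τ δ : ℝ} (hr : 1 ≤ r) (hτ : 0 < τ)
    (hδτ : δ ≤ τ / 24) :
    r * Real.exp (-(r ^ 2 * τ) + δ * r) ≤ kernel τ * Real.exp (δ - τ) := by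
  have h1 : -(r ^ 2 * τ) + δ * r ≤ (δ - τ) + -(8 / 9 * τ * (r ^ 2 - 1)) := by
    have h2 : δ * (r - 1) ≤ τ / 24 * (r - 1) := by
      have : 0 ≤ r - 1 := by linarith
      gcongr
    have h3 : r - 1 ≤ (r ^ 2 - 1) / 2 := by nlinarith
    have h4 : τ / 24 * (r - 1) ≤ τ / 24 * ((r ^ 2 - 1) / 2) := by gcongr
    have h5 : 0 ≤ τ * (r ^ 2 - 1) := by
      have : 0 ≤ r ^ 2 - 1 := by nlinarith
      positivity
    nlinarith
  have h6 : r * Real.exp (-(8 / 9 * τ * (r ^ 2 - 1))) ≤ kernel τ := by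
    refine le_of_sq_le_sq ?_ (kernel_nonneg τ)
    rw [mul_pow, ← Real.exp_nat_mul, Nat.cast_ofNat]
    have h7 := sq_le_kernel_sq hr hτ
    have h8 := Real.add_one_le_exp (16 / 9 * τ * (r ^ 2 - 1))
    have h9 : (2 : ℝ) * -(8 / 9 * τ * (r ^ 2 - 1)) = -(16 / 9 * τ * (r ^ 2 - 1)) := by ring
    rw [h9, Real.exp_neg, ← div_eq_mul_inv, div_le_iff₀ (Real.exp_pos _)]
    refine h7.trans ?_
    gcongr
    linarith
  calc r * Real.exp (-(r ^ 2 * τ) + δ * r)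
      ≤ r * Real.exp ((δ - τ) + -(8 / 9 * τ * (r ^ 2 - 1))) := by gcongr
    _ = r * Real.exp (-(8 / 9 * τ * (r ^ 2 - 1))) * Real.exp (δ - τ) := by
        rw [Real.exp_add]; ring
    _ ≤ _ := by gcongr

theorem norm_smooth_le {τ : ℝ} (hτ : 0 < τ) {x : L2} (hx : x ∈ H) :
    ‖mulOp (smoothSymbol τ) x‖ ≤ kernel τ * Real.exp (-τ) * ‖x‖ := by
  have hκ := kernel_nonneg τ
  refine norm_mulOp_le (bdd_smoothSymbol τ) (by positivity) hx fun k hk => ?_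
  have h := smooth_gevrey_le_kernel (δ := 0) (one_le_waveNorm hk) hτ (by linarith)
  rw [zero_mul, add_zero, zero_sub] at h
  have := waveNorm_nonneg k
  rw [smoothSymbol, if_pos hτ, abs_of_nonneg (by positivity)]
  gcongr

theorem norm_smooth_le' (τ : ℝ) {x : L2} (hx : x ∈ H) :
    ‖mulOp (smoothSymbol τ) x‖ ≤ kernel τ * ‖x‖ := by
  have hκ := kernel_nonneg τ
  by_cases hτ : 0 < τ
  · refine (norm_smooth_le hτ hx).trans ?_
    have : Real.exp (-τ) ≤ 1 := Real.exp_le_one_iff.2 (by linarith)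
    gcongr
    nlinarith
  · have : mulOp (smoothSymbol τ) x = 0 := fc_injective fun k => by
      rw [fc_mulOp (bdd_smoothSymbol τ), fc_zero]
      simp [smoothSymbol, hτ]
    rw [this, norm_zero]
    positivity

/-- The majorant of the integrands in Duhamel's formula. -/
def majorant (t τ : ℝ) : ℝ := Real.exp (-(23 / 24 * (t - τ))) + kernelSing τ

/-- The constant part of the kernel needs the exponential to be integrable over long times; the
singular part is integrable by itself. -/
theorem kernel_mul_exp_le {t τ : ℝ} (hτ : τ ≤ t) :
    kernel τ * Real.exp (-(23 / 24 * (t - τ))) ≤ majorant t τ := by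
  have h0 := kernelSing_nonneg τ
  have h1 : Real.exp (-(23 / 24 * (t - τ))) ≤ 1 := Real.exp_le_one_iff.2 (by linarith)
  unfold kernel majorant
  nlinarith

theorem intervalIntegrable_majorant (t a b : ℝ) :
    IntervalIntegrable (majorant t) volume a b := by
  refine IntervalIntegrable.add (Continuous.intervalIntegrable (by fun_prop) _ _)
    integrable_kernelSing.intervalIntegrable

/-- The two parts contribute at most 24/23 and 9/8, and 24/23 + 9/8 < 9/4. -/
theorem integral_majorant_le {t : ℝ} (ht : 0 ≤ t) : ∫ τ in 0..t, majorant t τ ≤ 9 / 4 := by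
  unfold majorant
  rw [intervalIntegral.integral_add (Continuous.intervalIntegrable (by fun_prop) _ _)
    integrable_kernelSing.intervalIntegrable]
  have h1 : ∫ τ in 0..t, kernelSing τ ≤ 9 / 8 := by
    rw [← integral_kernelSing, intervalIntegral.integral_of_le ht]
    exact setIntegral_le_integral integrable_kernelSing
      (Filter.Eventually.of_forall kernelSing_nonneg)
  have h2 : ∫ τ in 0..t, Real.exp (-(23 / 24 * (t - τ))) ≤ 24 / 23 := by
    have hd : ∀ τ ∈ Set.uIcc 0 t, HasDerivAt
        (fun τ => 24 / 23 * Real.exp (-(23 / 24 * (t - τ)))) (Real.exp (-(23 / 24 * (t - τ)))) τ := by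
      intro τ _
      have h := ((((hasDerivAt_id' τ).const_sub t).const_mul (23 / 24 : ℝ)).fun_neg.exp).const_mul
        (24 / 23 : ℝ)
      exact h.congr_deriv (by ring)
    rw [intervalIntegral.integral_eq_sub_of_hasDerivAt hd
      (Continuous.intervalIntegrable (by fun_prop) _ _)]
    have := Real.exp_pos (-(23 / 24 * (t - 0)))
    simp only [sub_self, mul_zero, neg_zero, Real.exp_zero]
    linarith
  linarith

/-! ### Truncated Gevrey norms -/

/-- The symbol of `e^{σ A^{1/2}}`, truncated to the frequencies `|k| ≤ n`. -/
def truncSymbol (σ : ℝ) (n : ℕ) (r : ℝ) : ℝ := if r ≤ n then Real.exp (σ * r) else 0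

theorem truncSymbol_nonneg (σ : ℝ) (n : ℕ) (r : ℝ) : 0 ≤ truncSymbol σ n r := by
  unfold truncSymbol; split_ifs <;> positivity

theorem truncSymbol_le (σ : ℝ) (n : ℕ) (r : ℝ) : truncSymbol σ n r ≤ Real.exp (σ * r) := by
  unfold truncSymbol; split_ifs
  · exact le_rfl
  · positivity

theorem bdd_truncSymbol (σ : ℝ) (n : ℕ) : BddSymbol (truncSymbol σ n) := by
  refine ⟨Real.exp (|σ| * n), fun k => ?_⟩
  have h0 := waveNorm_nonneg k
  unfold truncSymbol
  split_ifs with h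
  · rw [abs_of_pos (Real.exp_pos _)]
    refine Real.exp_le_exp.2 ?_
    exact mul_le_mul (le_abs_self σ) h h0 (abs_nonneg σ)
  · rw [abs_zero]; positivity

theorem gsymb_zero (σ : ℝ) (k : Fin 3 → ℤ) : gsymb 0 σ k = Real.exp (σ * waveNorm k) := by
  simp [gsymb]

/-- Any finite set of frequencies lies below some n, so uniform bounds on truncations bound all
partial sums. Truncated operators are bounded on L²: they commute with the Duhamel integral and make
the Gevrey bound a closed condition. -/
theorem mem_gevreyClass_zero_iff {σ R : ℝ} (hR : 0 ≤ R) {x : L2} (hx : x ∈ H) :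
    (x ∈ gevreyClass 0 σ ∧ gevreyNorm 0 σ x ≤ R) ↔
      ∀ n : ℕ, ‖mulOp (truncSymbol σ n) x‖ ≤ R := by
  constructor
  · rintro ⟨h1, h2⟩ n
    refine le_trans ?_ h2
    have := norm_mulOp_le (bdd_truncSymbol σ n) (v := gevreyOp 0 σ x) zero_le_one hx
      (fun k _ => by
        rw [(gevreyOp_spec h1).2, norm_smul, Real.norm_of_nonneg (gsymb_nonneg _ _ _), one_mul,
          gsymb_zero, abs_of_nonneg (truncSymbol_nonneg _ _ _)]
        exact mul_le_mul_of_nonneg_right (truncSymbol_le _ _ _) (norm_nonneg _))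
    rwa [one_mul] at this
  · intro h
    have hfin : ∀ s : Finset (Fin 3 → ℤ), ∑ k ∈ s, (gsymb 0 σ k * ‖fc x k‖) ^ 2 ≤
        ((2 * Real.pi) ^ 3)⁻¹ * R ^ 2 := by
      intro s
      obtain ⟨n, hn⟩ := exists_nat_ge (∑ k ∈ s, waveNorm k)
      have h1 := sum_le_hasSum s (fun k _ => by positivity)
        (hasSum_fc_sq (mulOp (truncSymbol σ n) x))
      refine le_trans (le_of_eq (Finset.sum_congr rfl fun k hk => ?_)) (h1.trans ?_)
      · have hkn : waveNorm k ≤ n :=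
          (Finset.single_le_sum (fun j _ => waveNorm_nonneg j) hk).trans hn
        rw [fc_mulOp (bdd_truncSymbol σ n), norm_smul, truncSymbol, if_pos hkn, gsymb_zero,
          Real.norm_of_nonneg (Real.exp_pos _).le]
      · gcongr
        exact h n
    have hs : Summable fun k => (gsymb 0 σ k * ‖fc x k‖) ^ 2 :=
      summable_of_sum_le (fun k => by positivity) hfin
    have hmem : x ∈ gevreyClass 0 σ := mem_gevreyClass_iff.2 ⟨hx, hs⟩
    refine ⟨hmem, ?_⟩
    have h2 := hasSum_gevreyNorm hmem
    have h3 := hs.tsum_le_of_sum_le hfin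
    rw [h2.tsum_eq] at h3
    have h4 : (0 : ℝ) < ((2 * Real.pi) ^ 3)⁻¹ := by positivity
    exact le_of_sq_le_sq (le_of_mul_le_mul_left h3 h4) hR

theorem gevreyOp_zero_zero {x : L2} (hx : x ∈ H) : gevreyOp 0 0 x = x :=
  gevreyOp_eq hx fun k => by simp [gsymb]

theorem mem_gevreyClass_zero_zero {x : L2} (hx : x ∈ H) : x ∈ gevreyClass 0 0 :=
  mem_gevreyClass_of_fc (w := x) hx fun k => by simp [gsymb]

theorem norm_trunc_smooth_le {σ δ τ : ℝ} (hτ : 0 < τ) (hδτ : δ ≤ τ / 24) {x : L2}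
    (hx : x ∈ gevreyClass 0 σ) (n : ℕ) :
    ‖mulOp (truncSymbol (σ + δ) n) (mulOp (smoothSymbol τ) x)‖ ≤
      kernel τ * Real.exp (δ - τ) * gevreyNorm 0 σ x := by
  have hκ := kernel_nonneg τ
  refine norm_mulOp_le (bdd_truncSymbol _ n) (by positivity) (mulOp_mem_H _ hx.1) fun k hk => ?_
  have h := smooth_gevrey_le_kernel (one_le_waveNorm hk) hτ hδτ
  have h0 := waveNorm_nonneg k
  rw [fc_mulOp (bdd_smoothSymbol τ), (gevreyOp_spec hx).2, norm_smul, norm_smul,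
    Real.norm_of_nonneg (gsymb_nonneg _ _ _), gsymb_zero, abs_of_nonneg (truncSymbol_nonneg _ _ _),
    smoothSymbol, if_pos hτ, Real.norm_of_nonneg (by positivity)]
  calc truncSymbol (σ + δ) n (waveNorm k) *
        (waveNorm k * Real.exp (-(waveNorm k ^ 2 * τ)) * ‖fc x k‖)
      ≤ Real.exp ((σ + δ) * waveNorm k) *
        (waveNorm k * Real.exp (-(waveNorm k ^ 2 * τ)) * ‖fc x k‖) := by
        gcongr
        exact truncSymbol_le _ _ _
    _ = waveNorm k * Real.exp (-(waveNorm k ^ 2 * τ) + δ * waveNorm k) *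
        (Real.exp (σ * waveNorm k) * ‖fc x k‖) := by
        rw [Real.exp_add, add_mul, Real.exp_add]; ring
    _ ≤ _ := by gcongr

/-- For r ≥ 1, σr - r²t ≤ σ - t, because σ(r-1) ≤ t(r-1) ≤ t(r²-1). -/
theorem norm_trunc_heat_le {σ t : ℝ} (ht : 0 ≤ t) (hσt : σ ≤ t) {x : L2} (hx : x ∈ H) (n : ℕ) :
    ‖mulOp (truncSymbol σ n) (mulOp (heatSymbol t) x)‖ ≤ Real.exp (σ - t) * ‖x‖ := by
  refine norm_mulOp_le (bdd_truncSymbol _ n) (by positivity) (mulOp_mem_H _ hx) fun k hk => ?_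
  have hr := one_le_waveNorm hk
  rw [fc_mulOp (bdd_heatSymbol ht), norm_smul, abs_of_nonneg (truncSymbol_nonneg _ _ _),
    heatSymbol, Real.norm_of_nonneg (Real.exp_pos _).le]
  set r := waveNorm k
  calc truncSymbol σ n r * (Real.exp (-(r ^ 2 * t)) * ‖fc x k‖)
      ≤ Real.exp (σ * r) * (Real.exp (-(r ^ 2 * t)) * ‖fc x k‖) := by
        gcongr
        exact truncSymbol_le _ _ _
    _ = Real.exp (σ * r + -(r ^ 2 * t)) * ‖fc x k‖ := by rw [Real.exp_add]; ring
    _ ≤ _ := by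
        gcongr
        have h1 : σ * (r - 1) ≤ t * (r - 1) := by
          have : 0 ≤ r - 1 := by linarith
          gcongr
        have h2 : t * (r - 1) ≤ t * (r ^ 2 - 1) := by
          gcongr
          nlinarith
        nlinarith

/-! ### Duhamel's formula -/

/-- The Duhamel integral `∫₀ᵗ A^{1/2} e^{-τA} y(t - τ) dτ`. -/
def duhamel (y : ℝ → L2) (t : ℝ) : L2 := ∫ τ in 0..t, mulOp (smoothSymbol τ) (y (t - τ))

theorem mulOp_smooth_nonpos {τ : ℝ} (hτ : ¬ 0 < τ) (x : L2) : mulOp (smoothSymbol τ) x = 0 :=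
  fc_injective fun k => by
    rw [fc_mulOp (bdd_smoothSymbol τ), fc_zero]
    simp [smoothSymbol, hτ]

/-- The integrand is continuous on τ > 0 and vanishes for τ ≤ 0 by the convention in `smoothSymbol`.
-/
theorem aestronglyMeasurable_smooth {y : ℝ → L2} (hy : Continuous y) (t : ℝ) :
    AEStronglyMeasurable (fun τ => mulOp (smoothSymbol τ) (y (t - τ))) volume := by
  have h1 : ContinuousOn (fun τ => mulOp (smoothSymbol τ) (y (t - τ))) (Set.Ioi 0) :=
    fun τ hτ => (continuousAt_smooth hτ (y := fun τ => y (t - τ))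
      (hy.comp (continuous_const.sub continuous_id)).continuousAt).continuousWithinAt
  have h2 := h1.aestronglyMeasurable (μ := volume) measurableSet_Ioi
  rw [← aestronglyMeasurable_indicator_iff measurableSet_Ioi] at h2
  refine h2.congr (Filter.Eventually.of_forall fun τ => ?_)
  by_cases hτ : 0 < τ
  · rw [Set.indicator_of_mem (Set.mem_Ioi.2 hτ)]
  · rw [Set.indicator_of_notMem (by simpa using hτ)]
    exact (mulOp_smooth_nonpos hτ _).symm

theorem intervalIntegrable_kernel (a b : ℝ) : IntervalIntegrable kernel volume a b :=
  (continuous_const.intervalIntegrable _ _).add integrable_kernelSing.intervalIntegrable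

theorem intervalIntegrable_smooth {y : ℝ → L2} (hy : Continuous y) (hH : ∀ t, y t ∈ H) {Y : ℝ}
    (hY : ∀ t, ‖y t‖ ≤ Y) (t a b : ℝ) :
    IntervalIntegrable (fun τ => mulOp (smoothSymbol τ) (y (t - τ))) volume a b := by
  refine ((intervalIntegrable_kernel a b).mul_const Y).mono_fun
    (aestronglyMeasurable_smooth hy t).restrict (Filter.Eventually.of_forall fun τ => ?_)
  refine (norm_smooth_le' τ (hH _)).trans ((le_abs_self _).trans' ?_)
  have := kernel_nonneg τ
  gcongr
  exact hY _

theorem continuousAt_duhamel {y : ℝ → L2} (hy : Continuous y) (hH : ∀ t, y t ∈ H) {Y : ℝ}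
    (hY : ∀ t, ‖y t‖ ≤ Y) {t₀ : ℝ} (ht₀ : 0 ≤ t₀) : ContinuousAt (duhamel y) t₀ := by
  -- The parameter and the upper limit vary independently, and the result is restricted to the
  -- diagonal. The interval (-1, t₀+1) has 0 and t₀ in its interior.
  have h := intervalIntegral.continuousAt_parametric_primitive_of_dominated (μ := volume)
    (F := fun t τ => mulOp (smoothSymbol τ) (y (t - τ))) (fun τ => kernel τ * Y) (-1) (t₀ + 1)
    (a₀ := 0) (b₀ := t₀) (x₀ := t₀) (fun t => (aestronglyMeasurable_smooth hy t).restrict)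
    (Filter.Eventually.of_forall fun t => Filter.Eventually.of_forall fun τ => by
      refine (norm_smooth_le' τ (hH _)).trans ?_
      have := kernel_nonneg τ
      gcongr
      exact hY _)
    ((intervalIntegrable_kernel _ _).mul_const Y)
    (Filter.Eventually.of_forall fun τ => by fun_prop)
    ⟨by norm_num, by linarith⟩ ⟨by linarith, by linarith⟩ (by simp)
  exact ContinuousAt.comp (f := fun t : ℝ => (t, t)) h (by fun_prop)

theorem duhamel_mem_H {y : ℝ → L2} (hy : Continuous y) (hH : ∀ t, y t ∈ H) {Y : ℝ}
    (hY : ∀ t, ‖y t‖ ≤ Y) (t : ℝ) : duhamel y t ∈ H := by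
  have h := leray.intervalIntegral_comp_comm (intervalIntegrable_smooth hy hH hY t 0 t)
  have h2 : ∀ τ, leray (mulOp (smoothSymbol τ) (y (t - τ))) = mulOp (smoothSymbol τ) (y (t - τ)) :=
    -- The integrand takes values in H, so the projection fixes it and hence its integral.
    fun τ => Submodule.starProjection_eq_self_iff.2 (mulOp_mem_H _ (hH _))
  simp only [h2] at h
  rw [duhamel, h]
  exact leray_mem _

theorem fc_duhamel {y : ℝ → L2} (hy : Continuous y) (hH : ∀ t, y t ∈ H) {Y : ℝ}
    (hY : ∀ t, ‖y t‖ ≤ Y) (t : ℝ) (k : Fin 3 → ℤ) :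
    fc (duhamel y t) k = ∫ τ in 0..t, smoothSymbol τ (waveNorm k) • fc (y (t - τ)) k := by
  have h := (fcLin k).intervalIntegral_comp_comm (intervalIntegrable_smooth hy hH hY t 0 t)
  rw [duhamel, ← fcLin_apply, ← h]
  refine intervalIntegral.integral_congr fun τ _ => ?_
  simp only [fcLin_apply, fc_mulOp (bdd_smoothSymbol τ)]

/-! ### The fixed point argument -/

/-- A bilinear map on `H` which is bounded with the same constant for all norms
`|e^{σA^{1/2}} ·|`. -/
structure IsGevreyBilinear (N : L2 → L2 → L2) (C : ℝ) : Prop where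
  nonneg : 0 ≤ C
  mem : ∀ x ∈ H, ∀ y ∈ H, N x y ∈ H
  sub_left : ∀ x ∈ H, ∀ x' ∈ H, ∀ y ∈ H, N (x - x') y = N x y - N x' y
  sub_right : ∀ x ∈ H, ∀ y ∈ H, ∀ y' ∈ H, N x (y - y') = N x y - N x y'
  bound : ∀ σ, 0 ≤ σ → ∀ x ∈ gevreyClass 0 σ, ∀ y ∈ gevreyClass 0 σ,
    N x y ∈ gevreyClass 0 σ ∧
      gevreyNorm 0 σ (N x y) ≤ C * gevreyNorm 0 σ x * gevreyNorm 0 σ y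

namespace IsGevreyBilinear

variable {N : L2 → L2 → L2} {C : ℝ}

theorem norm_le (hN : IsGevreyBilinear N C) {x y : L2} (hx : x ∈ H) (hy : y ∈ H) :
    ‖N x y‖ ≤ C * ‖x‖ * ‖y‖ := by
  have h := (hN.bound 0 le_rfl x (mem_gevreyClass_zero_zero hx) y (mem_gevreyClass_zero_zero hy)).2
  unfold gevreyNorm at h
  rwa [gevreyOp_zero_zero hx, gevreyOp_zero_zero hy, gevreyOp_zero_zero (hN.mem x hx y hy)] at h

theorem norm_sub_le (hN : IsGevreyBilinear N C) {x y : L2} (hx : x ∈ H) (hy : y ∈ H) :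
    ‖N x x - N y y‖ ≤ C * (‖x‖ + ‖y‖) * ‖x - y‖ := by
  have h1 : N x x - N y y = N (x - y) x + N y (x - y) := by
    rw [hN.sub_left x hx y hy x hx, hN.sub_right y hy x hx y hy]
    abel
  rw [h1]
  have h2 := hN.norm_le (H.sub_mem hx hy) hx
  have h3 := hN.norm_le hy (H.sub_mem hx hy)
  refine (norm_add_le _ _).trans ?_
  linarith

theorem continuous_diag (hN : IsGevreyBilinear N C) {w : ℝ → L2} (hw : Continuous w)
    (hH : ∀ t, w t ∈ H) : Continuous fun t => N (w t) (w t) := by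
  rw [continuous_iff_continuousAt]
  intro t₀
  rw [ContinuousAt, tendsto_iff_norm_sub_tendsto_zero]
  have h : Continuous fun t => C * (‖w t‖ + ‖w t₀‖) * ‖w t - w t₀‖ := by fun_prop
  have h2 := h.tendsto t₀
  simp only [sub_self, norm_zero, mul_zero] at h2
  exact squeeze_zero (fun _ => norm_nonneg _) (fun t => hN.norm_sub_le (hH t) (hH t₀)) h2

end IsGevreyBilinear

open BoundedContinuousFunction in
/-- The functions with values in `H` satisfying the Gevrey bound `|w(t)|_{0,σ} ≤ M e^{σ-t}` for
`24 σ ≤ t`. -/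
def decaySet (M : ℝ) : Set (ℝ →ᵇ L2) :=
  {w | (∀ t, w t ∈ H) ∧ ∀ t, 0 ≤ t → ∀ σ, 0 ≤ σ → σ ≤ t / 24 → ∀ n : ℕ,
    ‖mulOp (truncSymbol σ n) (w t)‖ ≤ M * Real.exp (σ - t)}

/-- Closedness is what makes the fixed point inherit the decay and the analyticity. -/
theorem isClosed_decaySet (M : ℝ) : IsClosed (decaySet M) := by
  have hev : ∀ t : ℝ, Continuous fun w : BoundedContinuousFunction ℝ L2 => w t :=
    fun t => continuous_eval_const t
  have hHc : IsClosed (H : Set L2) := Submodule.isClosed_topologicalClosure trigPoly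
  refine IsClosed.inter (s₁ := {w : BoundedContinuousFunction ℝ L2 | ∀ t, w t ∈ H}) ?_ ?_
  · have : {w : BoundedContinuousFunction ℝ L2 | ∀ t, w t ∈ H} =
        ⋂ t, (fun w : BoundedContinuousFunction ℝ L2 => w t) ⁻¹' (H : Set L2) := by
      ext w; simp
    rw [this]
    exact isClosed_iInter fun t => hHc.preimage (hev t)
  · change IsClosed {w : BoundedContinuousFunction ℝ L2 | ∀ t, 0 ≤ t → ∀ σ, 0 ≤ σ → σ ≤ t / 24 →
      ∀ n : ℕ, ‖mulOp (truncSymbol σ n) (w t)‖ ≤ M * Real.exp (σ - t)}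
    simp only [Set.ofPred_forall]
    refine isClosed_iInter fun t => isClosed_iInter fun _ => isClosed_iInter fun σ =>
      isClosed_iInter fun _ => isClosed_iInter fun _ => isClosed_iInter fun n => ?_
    exact isClosed_le ((mulOp _).continuous.comp (hev t)).norm continuous_const

section FixedPoint

variable {M : ℝ} {w w' : BoundedContinuousFunction ℝ L2}

theorem mem_gevreyClass_of_mem_decaySet (hM : 0 ≤ M) (hw : w ∈ decaySet M) {t σ : ℝ} (ht : 0 ≤ t)
    (hσ : 0 ≤ σ) (hσt : σ ≤ t / 24) :
    w t ∈ gevreyClass 0 σ ∧ gevreyNorm 0 σ (w t) ≤ M * Real.exp (σ - t) :=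
  (mem_gevreyClass_zero_iff (by positivity) (hw.1 t)).2 (hw.2 t ht σ hσ hσt)

theorem norm_le_of_mem_decaySet (hM : 0 ≤ M) (hw : w ∈ decaySet M) {t : ℝ} (ht : 0 ≤ t) :
    ‖w t‖ ≤ M * Real.exp (-t) := by
  have h := (mem_gevreyClass_of_mem_decaySet hM hw ht le_rfl (by positivity)).2
  unfold gevreyNorm at h
  rwa [gevreyOp_zero_zero (hw.1 t), zero_sub] at h

variable {N : L2 → L2 → L2} {C : ℝ}

theorem norm_diag_le (hN : IsGevreyBilinear N C) (hw : w ∈ decaySet M) (t : ℝ) :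
    ‖N (w t) (w t)‖ ≤ C * ‖w‖ * ‖w‖ := by
  refine (hN.norm_le (hw.1 t) (hw.1 t)).trans ?_
  have h := w.norm_coe_le_norm t
  have := hN.nonneg
  gcongr

theorem intervalIntegrable_diag (hN : IsGevreyBilinear N C) (hw : w ∈ decaySet M) (t a b : ℝ) :
    IntervalIntegrable
      (fun τ => mulOp (smoothSymbol τ) (N (w (t - τ)) (w (t - τ)))) volume a b :=
  intervalIntegrable_smooth (y := fun t => N (w t) (w t)) (hN.continuous_diag w.continuous hw.1)
    (fun t => hN.mem _ (hw.1 t) _ (hw.1 t)) (norm_diag_le hN hw) t a b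

/-- The nonlinear half of the self-map property: the output has the same profile e^{σ-t} as the
input, with a constant quadratic in M. -/
theorem norm_trunc_duhamel_le (hN : IsGevreyBilinear N C) (hM : 0 ≤ M) (hw : w ∈ decaySet M)
    {t σ : ℝ} (ht : 0 ≤ t) (hσ : 0 ≤ σ) (hσt : σ ≤ t / 24) (n : ℕ) :
    ‖mulOp (truncSymbol σ n) (duhamel (fun t => N (w t) (w t)) t)‖ ≤
      9 / 4 * (C * M ^ 2) * Real.exp (σ - t) := by
  have hC := hN.nonneg
  rw [duhamel, ← (mulOp (truncSymbol σ n)).intervalIntegral_comp_comm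
    (intervalIntegrable_diag hN hw t 0 t)]
  have hb : ∀ τ ∈ Set.Ioc 0 t,
      ‖mulOp (truncSymbol σ n) (mulOp (smoothSymbol τ) (N (w (t - τ)) (w (t - τ))))‖ ≤
        C * M ^ 2 * Real.exp (σ - t) * majorant t τ := by
    rintro τ ⟨hτ0, hτt⟩
    have ht0 : 0 < t := hτ0.trans_le hτt
    have hs : 0 ≤ t - τ := by linarith
    have hsplit : σ = σ * (t - τ) / t + σ * τ / t := by field_simp; ring
    have h1 : 0 ≤ σ * (t - τ) / t := by positivity
    have h2 : σ * (t - τ) / t ≤ (t - τ) / 24 := by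
      rw [div_le_iff₀ ht0]; nlinarith
    have h3 : σ * τ / t ≤ τ / 24 := by
      rw [div_le_iff₀ ht0]; nlinarith
    set σ' := σ * (t - τ) / t
    set δ := σ * τ / t
    obtain ⟨hm, hmb⟩ := mem_gevreyClass_of_mem_decaySet hM hw hs h1 h2
    obtain ⟨hNm, hNb⟩ := hN.bound σ' h1 _ hm _ hm
    have hκ := kernel_nonneg τ
    have h4 := norm_trunc_smooth_le hτ0 h3 hNm n
    rw [← hsplit] at h4
    have h5 := kernel_mul_exp_le hτt
    calc _ ≤ _ := h4
      _ ≤ kernel τ * Real.exp (δ - τ) *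
          (C * (M * Real.exp (σ' - (t - τ))) * (M * Real.exp (σ' - (t - τ)))) := by
          have := gevreyNorm_nonneg 0 σ' (w (t - τ))
          gcongr
          refine hNb.trans ?_
          gcongr
      _ = C * M ^ 2 * (Real.exp (δ - τ) * Real.exp (σ' - (t - τ))) *
          (kernel τ * Real.exp (σ' - (t - τ))) := by ring
      _ = C * M ^ 2 * Real.exp (σ - t) * (kernel τ * Real.exp (σ' - (t - τ))) := by
          rw [← Real.exp_add]
          congr 3
          linarith
      -- Since σ' ≤ (t-τ)/24, the surplus copy of the exponential still decays at rate 23/24.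
      _ ≤ C * M ^ 2 * Real.exp (σ - t) *
          (kernel τ * Real.exp (-(23 / 24 * (t - τ)))) := by
          gcongr
          linarith
      _ ≤ _ := by gcongr
  refine (intervalIntegral.norm_integral_le_of_norm_le ht (Filter.Eventually.of_forall hb)
    ((intervalIntegrable_majorant t 0 t).const_mul _)).trans ?_
  rw [intervalIntegral.integral_const_mul]
  have h6 := integral_majorant_le ht
  calc C * M ^ 2 * Real.exp (σ - t) * ∫ τ in 0..t, majorant t τ
      ≤ C * M ^ 2 * Real.exp (σ - t) * (9 / 4) := by gcongr
    _ = _ := by ring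

/-- The contraction is measured in the uniform norm of H only. One factor keeps its exponential
decay, which makes the constant independent of t. -/
theorem norm_duhamel_sub_le (hN : IsGevreyBilinear N C) (hM : 0 ≤ M) (hw : w ∈ decaySet M)
    (hw' : w' ∈ decaySet M) {t : ℝ} (ht : 0 ≤ t) :
    ‖duhamel (fun t => N (w t) (w t)) t - duhamel (fun t => N (w' t) (w' t)) t‖ ≤
      9 / 2 * (C * M) * ‖w - w'‖ := by
  have hC := hN.nonneg
  unfold duhamel
  rw [← intervalIntegral.integral_sub (intervalIntegrable_diag hN hw t 0 t)
    (intervalIntegrable_diag hN hw' t 0 t)]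
  have hb : ∀ τ ∈ Set.Ioc 0 t,
      ‖mulOp (smoothSymbol τ) (N (w (t - τ)) (w (t - τ))) -
        mulOp (smoothSymbol τ) (N (w' (t - τ)) (w' (t - τ)))‖ ≤
        2 * (C * M) * ‖w - w'‖ * majorant t τ := by
    rintro τ ⟨hτ0, hτt⟩
    have hs : 0 ≤ t - τ := by linarith
    have hκ := kernel_nonneg τ
    rw [← map_sub]
    have hH := hN.mem _ (hw.1 (t - τ)) _ (hw.1 (t - τ))
    have hH' := hN.mem _ (hw'.1 (t - τ)) _ (hw'.1 (t - τ))
    have h1 := norm_smooth_le hτ0 (H.sub_mem hH hH')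
    have h2 := hN.norm_sub_le (hw.1 (t - τ)) (hw'.1 (t - τ))
    have h3 := norm_le_of_mem_decaySet hM hw hs
    have h4 := norm_le_of_mem_decaySet hM hw' hs
    have h5 : ‖w (t - τ) - w' (t - τ)‖ ≤ ‖w - w'‖ := (w - w').norm_coe_le_norm (t - τ)
    have h6 : Real.exp (-τ) ≤ 1 := Real.exp_le_one_iff.2 (by linarith)
    have h7 : Real.exp (-(t - τ)) ≤ Real.exp (-(23 / 24 * (t - τ))) :=
      Real.exp_le_exp.2 (by linarith)
    calc _ ≤ _ := h1
      _ ≤ kernel τ * 1 * (C * (M * Real.exp (-(23 / 24 * (t - τ))) +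
          M * Real.exp (-(23 / 24 * (t - τ)))) * ‖w - w'‖) := by
          gcongr
          refine h2.trans ?_
          gcongr
          · refine h3.trans ?_
            gcongr
          · refine h4.trans ?_
            gcongr
      _ = 2 * (C * M) * ‖w - w'‖ * (kernel τ * Real.exp (-(23 / 24 * (t - τ)))) := by ring
      _ ≤ _ := by
          gcongr
          exact kernel_mul_exp_le hτt
  refine (intervalIntegral.norm_integral_le_of_norm_le ht (Filter.Eventually.of_forall hb)
    ((intervalIntegrable_majorant t 0 t).const_mul _)).trans ?_
  rw [intervalIntegral.integral_const_mul]
  have h6 := integral_majorant_le ht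
  calc 2 * (C * M) * ‖w - w'‖ * ∫ τ in 0..t, majorant t τ
      ≤ 2 * (C * M) * ‖w - w'‖ * (9 / 4) := by gcongr
    _ = _ := by ring

/-- Existence of a global mild solution with Gevrey decay, for small data. -/
theorem exists_mild_solution (hN : IsGevreyBilinear N C) {w₀ : L2} (hw₀ : w₀ ∈ H)
    (hsmall : 12 * (C * ‖w₀‖) ≤ 1) :
    ∃ w ∈ decaySet (4 / 3 * ‖w₀‖), ∀ t, w t = mulOp (heatSymbol (max t 0)) w₀ -
      duhamel (fun s => N (w s) (w s)) (max t 0) := by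
  set a := ‖w₀‖ with ha
  have ha0 : 0 ≤ a := norm_nonneg _
  set M := 4 / 3 * a with hMdef
  have hM : 0 ≤ M := by positivity
  have hC := hN.nonneg
  have hex : ∀ w : decaySet M, ∃ w' : decaySet M, ∀ t,
      (w' : BoundedContinuousFunction ℝ L2) t = mulOp (heatSymbol (max t 0)) w₀ -
        duhamel (fun s => N (w.1 s) (w.1 s)) (max t 0) := by
    rintro ⟨w, hw⟩
    -- Replacing t by max t 0 extends the function by w₀ to negative times, so that bounded
    -- continuous functions on all of ℝ can be used.
    have hcont : Continuous fun t : ℝ => mulOp (heatSymbol (max t 0)) w₀ -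
        duhamel (fun s => N (w s) (w s)) (max t 0) := by
      rw [continuous_iff_continuousAt]
      intro t₀
      refine (continuousAt_heat_max t₀ w₀).sub ?_
      exact ContinuousAt.comp (f := fun t : ℝ => max t 0) (continuousAt_duhamel
        (hN.continuous_diag w.continuous hw.1) (fun t => hN.mem _ (hw.1 t) _ (hw.1 t))
        (norm_diag_le hN hw) (le_max_right _ _)) (by fun_prop)
    have hmemH : ∀ t : ℝ, mulOp (heatSymbol (max t 0)) w₀ -
        duhamel (fun s => N (w s) (w s)) (max t 0) ∈ H := fun t =>
      H.sub_mem (mulOp_mem_H _ hw₀) (duhamel_mem_H (hN.continuous_diag w.continuous hw.1)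
        (fun t => hN.mem _ (hw.1 t) _ (hw.1 t)) (norm_diag_le hN hw) _)
    have htr : ∀ t : ℝ, 0 ≤ t → ∀ σ, 0 ≤ σ → σ ≤ t / 24 → ∀ n : ℕ,
        ‖mulOp (truncSymbol σ n) (mulOp (heatSymbol t) w₀ -
          duhamel (fun s => N (w s) (w s)) t)‖ ≤ M * Real.exp (σ - t) := by
      intro t ht σ hσ hσt n
      rw [map_sub]
      refine (norm_sub_le _ _).trans ?_
      have h1 := norm_trunc_heat_le ht (by linarith : σ ≤ t) hw₀ n
      have h2 := norm_trunc_duhamel_le hN hM hw ht hσ hσt n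
      -- With M = 4a/3 and Ca ≤ 1/12 the quadratic term is 4Ca² ≤ a/3, exactly the room left between
      -- a and M.
      have h3 : a + 9 / 4 * (C * M ^ 2) ≤ M := by
        rw [hMdef]
        nlinarith
      calc _ ≤ Real.exp (σ - t) * a + 9 / 4 * (C * M ^ 2) * Real.exp (σ - t) := add_le_add h1 h2
        _ = (a + 9 / 4 * (C * M ^ 2)) * Real.exp (σ - t) := by ring
        _ ≤ _ := by gcongr
    have hnorm : ∀ t : ℝ, ‖mulOp (heatSymbol (max t 0)) w₀ -
        duhamel (fun s => N (w s) (w s)) (max t 0)‖ ≤ M := by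
      intro t
      have ht : 0 ≤ max t 0 := le_max_right _ _
      have h := (mem_gevreyClass_zero_iff (by positivity) (hmemH t)).2
        (htr (max t 0) ht 0 le_rfl (by positivity))
      have h2 := h.2
      unfold gevreyNorm at h2
      rw [gevreyOp_zero_zero (hmemH t)] at h2
      refine h2.trans ?_
      have : Real.exp (0 - max t 0) ≤ 1 := Real.exp_le_one_iff.2 (by linarith)
      nlinarith
    refine ⟨⟨BoundedContinuousFunction.ofNormedAddCommGroup _ hcont M hnorm, hmemH, ?_⟩,
      fun t => rfl⟩
    intro t ht σ hσ hσt n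
    have h := htr t ht σ hσ hσt n
    rw [BoundedContinuousFunction.coe_ofNormedAddCommGroup, max_eq_left ht]
    exact h
  choose F hF using hex
  have : CompleteSpace (decaySet M) := (isClosed_decaySet M).completeSpace_coe
  have : Nonempty (decaySet M) := ⟨⟨0, fun t => H.zero_mem, fun t _ σ _ _ n => by
    simp only [BoundedContinuousFunction.coe_zero, Pi.zero_apply, map_zero, norm_zero]
    positivity⟩⟩
  have hcontr : ContractingWith (1 / 2) F := by
    refine ⟨by rw [one_div]; exact inv_lt_one_of_one_lt₀ one_lt_two, LipschitzWith.of_dist_le_mul fun w w' => ?_⟩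
    rw [Subtype.dist_eq, Subtype.dist_eq, dist_eq_norm]
    refine (BoundedContinuousFunction.norm_le (by positivity)).2 fun t => ?_
    rw [BoundedContinuousFunction.sub_apply, hF, hF, sub_sub_sub_cancel_left]
    have h := norm_duhamel_sub_le hN hM w'.2 w.2 (le_max_right t 0)
    refine h.trans ?_
    rw [dist_eq_norm, norm_sub_rev]
    push_cast
    gcongr
    -- The Lipschitz constant is (9/2)CM = 6Ca ≤ 1/2.
    rw [hMdef]
    linarith
  refine ⟨(hcontr.fixedPoint F).1, (hcontr.fixedPoint F).2, fun t => ?_⟩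
  conv_lhs => rw [← hcontr.fixedPoint_isFixedPt]
  exact hF _ t

end FixedPoint

/-! ### The mild formulation of the Navier–Stokes equations -/

theorem bdd_rpow {p : ℝ} (hp : p ≤ 0) : BddSymbol fun r => r ^ p := by
  refine ⟨1, fun k => ?_⟩
  rw [abs_of_nonneg (Real.rpow_nonneg (waveNorm_nonneg k) p)]
  rcases waveNorm_eq_zero_or k with h | h
  · rw [h]
    rcases hp.eq_or_lt with h0 | h0
    · rw [h0, Real.rpow_zero]
    · rw [Real.zero_rpow h0.ne]; exact zero_le_one
  · exact Real.rpow_le_one_of_one_le_of_nonpos h hp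

theorem gevreyClass_of_fc {α σ : ℝ} {u w : L2} (hu : u ∈ H) (hw : w ∈ H)
    (h : ∀ k ≠ 0, fc w k = gsymb α σ k • fc u k) :
    u ∈ gevreyClass α σ ∧ gevreyOp α σ u = w := by
  have h' : ∀ k, fc w k = gsymb α σ k • fc u k := by
    intro k
    by_cases hk : k = 0
    · rw [hk, fc_zero_of_mem_H hu, fc_zero_of_mem_H hw, smul_zero]
    · exact h k hk
  exact ⟨⟨hu, w, hasMultiplier_iff.2 ⟨hw, h'⟩⟩, gevreyOp_eq hw h'⟩

/-- The operator `A^{-β}`. -/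
def invA (β : ℝ) : L2 →L[ℝ] L2 := mulOp fun r => r ^ (-(2 * β))

theorem fc_invA {β : ℝ} (hβ : 0 ≤ β) (x : L2) (k : Fin 3 → ℤ) :
    fc (invA β x) k = waveNorm k ^ (-(2 * β)) • fc x k :=
  fc_mulOp (bdd_rpow (by linarith)) x k

theorem invA_mem_H (β : ℝ) {x : L2} (hx : x ∈ H) : invA β x ∈ H := mulOp_mem_H _ hx

theorem gevreyOp_invA {β σ : ℝ} (hβ : 0 ≤ β) {x : L2} (hx : x ∈ gevreyClass 0 σ) :
    invA β x ∈ gevreyClass β σ ∧ gevreyOp β σ (invA β x) = gevreyOp 0 σ x := by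
  refine gevreyClass_of_fc (invA_mem_H β hx.1) (gevreyOp_spec hx).1 fun k hk => ?_
  rw [(gevreyOp_spec hx).2, fc_invA hβ, smul_smul, gsymb_zero, gsymb]
  congr 1
  rw [mul_right_comm, ← Real.rpow_add (waveNorm_pos hk), add_neg_cancel, Real.rpow_zero, one_mul]

theorem powA_invA {β γ : ℝ} (hβ : 0 ≤ β) (hγ : γ ≤ β) {x : L2} (hx : x ∈ H) :
    invA β x ∈ domA γ ∧ powA γ (invA β x) = mulOp (fun r => r ^ (2 * γ - 2 * β)) x := by
  refine gevreyClass_of_fc (invA_mem_H β hx) (mulOp_mem_H _ hx) fun k hk => ?_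
  rw [fc_mulOp (bdd_rpow (by linarith)), fc_invA hβ, smul_smul, gsymb, zero_mul, Real.exp_zero,
    mul_one, ← Real.rpow_add (waveNorm_pos hk), sub_eq_add_neg]

theorem invA_powA {β : ℝ} (hβ : 0 ≤ β) {u : L2} (hu : u ∈ domA β) : invA β (powA β u) = u := by
  refine fc_injective fun k => ?_
  by_cases hk : k = 0
  · rw [hk, fc_zero_of_mem_H hu.1, powA,
      fc_zero_of_mem_H (invA_mem_H β (gevreyOp_spec hu).1)]
  · rw [fc_invA hβ, powA, (gevreyOp_spec hu).2, smul_smul, gsymb, zero_mul, Real.exp_zero, mul_one,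
      ← Real.rpow_add (waveNorm_pos hk), neg_add_cancel, Real.rpow_zero, one_smul]

/-- The nonlinearity `A^α B(A^{-α-1/2} x, A^{-α-1/2} y)`. -/
def liftedBilin (α : ℝ) (x y : L2) : L2 :=
  gevreyOp α 0 (bilin (invA (α + 1 / 2) x) (invA (α + 1 / 2) y))

/-- The symbol of e^{σA^{1/2}} commutes with powers of A, and |A^{-β}x|_{β,σ} = |x|_{0,σ}, so (*) at
(α,σ) transfers directly. It gives K^α, which is relaxed to K^{α+1/2} using K ≥ 1. -/
theorem isGevreyBilinear_liftedBilin {K α : ℝ} (hK : IsBilinConstant K) (hα : 1 / 2 ≤ α) :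
    IsGevreyBilinear (liftedBilin α) (K ^ (α + 1 / 2)) := by
  have hβ : 0 ≤ α + 1 / 2 := by linarith
  have hK0 : 0 < K := one_pos.trans_le hK.1
  have hcl : ∀ x ∈ H, invA (α + 1 / 2) x ∈ gevreyClass (α + 1 / 2) 0 := fun x hx =>
    (powA_invA hβ le_rfl hx).1
  have hB : ∀ x ∈ H, ∀ y ∈ H, bilin (invA (α + 1 / 2) x) (invA (α + 1 / 2) y) ∈ gevreyClass α 0 :=
    fun x hx y hy => (hK.2 α 0 hα le_rfl _ (hcl x hx) _ (hcl y hy)).1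
  have h1 : ∀ x ∈ H, invA (α + 1 / 2) x ∈ domA 1 := fun x hx =>
    (powA_invA hβ (by linarith) hx).1
  have h2 : ∀ x ∈ H, invA (α + 1 / 2) x ∈ domA (1 / 2) := fun x hx =>
    (powA_invA hβ (by linarith) hx).1
  refine ⟨by positivity, fun x hx y hy => (gevreyOp_spec (hB x hx y hy)).1, ?_, ?_, ?_⟩
  · intro x hx x' hx' y hy
    unfold liftedBilin
    rw [map_sub, bilin_sub_left (h1 x hx) (h1 x' hx'), gevreyOp_sub (hB x hx y hy) (hB x' hx' y hy)]
  · intro x hx y hy y' hy'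
    unfold liftedBilin
    rw [map_sub, bilin_sub_right (h1 x hx) (h2 y hy) (h2 y' hy'),
      gevreyOp_sub (hB x hx y hy) (hB x hx y' hy')]
  · intro σ hσ x hx y hy
    obtain ⟨hxm, hxe⟩ := gevreyOp_invA hβ hx
    obtain ⟨hym, hye⟩ := gevreyOp_invA hβ hy
    obtain ⟨hBm, hBn⟩ := hK.2 α σ hα hσ _ hxm _ hym
    have hb := hB x hx.1 y hy.1
    obtain ⟨hm, he⟩ := gevreyClass_of_fc (α := 0) (σ := σ) (u := liftedBilin α x y)
      (gevreyOp_spec hb).1 (gevreyOp_spec hBm).1 (fun k _ => by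
        rw [liftedBilin, (gevreyOp_spec hb).2, (gevreyOp_spec hBm).2, smul_smul, gsymb_zero, gsymb,
          gsymb, zero_mul, Real.exp_zero, mul_one, mul_comm])
    refine ⟨hm, ?_⟩
    unfold gevreyNorm at hBn ⊢
    rw [he]
    rw [hxe, hye] at hBn
    refine hBn.trans ?_
    gcongr
    · exact hK.1
    · linarith

/-- The scalar Duhamel formula solves the scalar linear equation. -/
theorem hasDerivAt_duhamel {E : Type*} [NormedAddCommGroup E] [NormedSpace ℝ E] [CompleteSpace E]
    {Y : ℝ → E} (hY : Continuous Y) (r : ℝ) (W₀ : E) {W : ℝ → E}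
    (hW : ∀ t, 0 ≤ t → W t = Real.exp (-(r ^ 2 * t)) • W₀ -
      ∫ τ in 0..t, (r * Real.exp (-(r ^ 2 * τ))) • Y (t - τ)) {t : ℝ} (ht : 0 ≤ t) :
    W t - W 0 = ∫ s in 0..t, -(r ^ 2 • W s + r • Y s) := by
  -- After s = t - τ the kernel factors into e^{-r²t}e^{r²s}, and the convolution becomes a scalar
  -- times a primitive.
  set I : ℝ → E := fun t => ∫ s in 0..t, Real.exp (r ^ 2 * s) • Y s with hI
  have hcont : Continuous fun s => Real.exp (r ^ 2 * s) • Y s := by fun_prop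
  have hId : ∀ t, HasDerivAt I (Real.exp (r ^ 2 * t) • Y t) t := fun t =>
    intervalIntegral.integral_hasDerivAt_right (hcont.intervalIntegrable _ _)
      hcont.stronglyMeasurable.stronglyMeasurableAtFilter hcont.continuousAt
  set Z : ℝ → E := fun t => Real.exp (-(r ^ 2 * t)) • W₀ - (r * Real.exp (-(r ^ 2 * t))) • I t
    with hZ
  have hWZ : ∀ t, 0 ≤ t → W t = Z t := by
    intro t ht
    rw [hW t ht, hZ]
    simp only
    congr 1
    have h1 := intervalIntegral.integral_comp_sub_left (a := 0) (b := t)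
      (fun s => (r * Real.exp (-(r ^ 2 * (t - s)))) • Y s) t
    simp only [sub_sub_cancel, sub_self, sub_zero] at h1
    rw [h1, hI]
    simp only
    rw [← intervalIntegral.integral_smul]
    refine intervalIntegral.integral_congr fun s _ => ?_
    simp only [smul_smul]
    congr 1
    rw [mul_assoc, ← Real.exp_add]
    ring_nf
  have hed : ∀ t, HasDerivAt (fun t => Real.exp (-(r ^ 2 * t))) (-(r ^ 2) * Real.exp (-(r ^ 2 * t)))
      t := by
    intro t
    have h := ((hasDerivAt_id' t).const_mul (r ^ 2)).fun_neg.exp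
    exact h.congr_deriv (by ring)
  have hZd : ∀ t, HasDerivAt Z (-(r ^ 2 • Z t + r • Y t)) t := by
    intro t
    have h := ((hed t).smul_const W₀).sub (((hed t).const_mul r).smul (hId t))
    refine h.congr_deriv ?_
    have e : r * Real.exp (-(r ^ 2 * t)) * Real.exp (r ^ 2 * t) = r := by
      rw [mul_assoc, ← Real.exp_add, neg_add_cancel, Real.exp_zero, mul_one]
    rw [smul_smul, e, hZ]
    module
  have hZc : Continuous Z := continuous_iff_continuousAt.2 fun t => (hZd t).continuousAt
  have h := intervalIntegral.integral_eq_sub_of_hasDerivAt (a := 0) (b := t) (fun s _ => hZd s)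
    (Continuous.intervalIntegrable (by fun_prop) _ _)
  rw [hWZ t ht, hWZ 0 le_rfl, ← h]
  refine intervalIntegral.integral_congr fun s hs => ?_
  rw [Set.uIcc_of_le ht] at hs
  simp only [hWZ s hs.1]

/-- Since α + 1/2 ≥ 1, both Au and B(u,u) are bounded operators applied to continuous H-valued
functions, hence continuous in time. The mild formula integrates to u = u₀ + ∫g at each frequency,
and the fundamental theorem of calculus gives the derivative in H. -/
theorem exists_regular_solution {K α : ℝ} (hK : IsBilinConstant K) (hα : 1 / 2 ≤ α) {u₀ : L2}
    (hu₀ : u₀ ∈ domA (α + 1 / 2))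
    (hsmall : ‖powA (α + 1 / 2) u₀‖ < 1 / (12 * K ^ (α + 1 / 2))) :
    ∃ u : ℝ → L2, IsRegularSolution ⊤ u₀ u ∧ ∀ σ t : ℝ, 0 ≤ σ → 24 * σ ≤ t →
      u t ∈ gevreyClass (α + 1 / 2) σ ∧ gevreyNorm (α + 1 / 2) σ (u t) ≤
        4 / 3 * ‖powA (α + 1 / 2) u₀‖ * Real.exp (σ - t) := by
  have hβ : 0 ≤ α + 1 / 2 := by linarith
  have hK0 : 0 < K := one_pos.trans_le hK.1
  have hN := isGevreyBilinear_liftedBilin hK hα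
  set w₀ := powA (α + 1 / 2) u₀ with hw₀
  have hw₀H : w₀ ∈ H := (gevreyOp_spec hu₀).1
  have hC : 0 < K ^ (α + 1 / 2) := by positivity
  obtain ⟨w, hwS, hw⟩ := exists_mild_solution hN hw₀H (by
    rw [lt_div_iff₀ (by positivity)] at hsmall
    linarith)
  have hyc := hN.continuous_diag w.continuous hwS.1
  have hyH : ∀ t, liftedBilin α (w t) (w t) ∈ H := fun t => hN.mem _ (hwS.1 t) _ (hwS.1 t)
  have hyb := norm_diag_le hN hwS
  set y : ℝ → L2 := fun t => liftedBilin α (w t) (w t) with hy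
  set u : ℝ → L2 := fun t => invA (α + 1 / 2) (w t) with hu
  have hpow : ∀ γ, γ ≤ α + 1 / 2 → ∀ t, u t ∈ domA γ ∧
      powA γ (u t) = mulOp (fun r => r ^ (2 * γ - 2 * (α + 1 / 2))) (w t) :=
    fun γ hγ t => powA_invA hβ hγ (hwS.1 t)
  have hf : ∀ t, bilin (u t) (u t) = invA α (y t) := by
    intro t
    have hcl : u t ∈ gevreyClass (α + 1 / 2) 0 := (hpow _ le_rfl t).1
    exact (invA_powA (by linarith) (hK.2 α 0 hα le_rfl _ hcl _ hcl).1).symm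
  set g : ℝ → L2 := fun t => -(powA 1 (u t) + bilin (u t) (u t)) with hg
  have hgeq : g = fun t => -(mulOp (fun r => r ^ (2 * 1 - 2 * (α + 1 / 2))) (w t) +
      invA α (y t)) := by
    funext t
    rw [hg]
    simp only
    rw [hf, (hpow 1 (by linarith) t).2]
  have hgc : Continuous g := by
    rw [hgeq]
    exact (((mulOp _).continuous.comp w.continuous).add ((invA α).continuous.comp hyc)).neg
  have hw0 : w 0 = w₀ := by
    rw [hw 0, max_self, duhamel, intervalIntegral.integral_same, sub_zero]
    refine fc_injective fun k => ?_
    rw [fc_mulOp (bdd_heatSymbol le_rfl)]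
    simp [heatSymbol]
  have hu0 : u 0 = u₀ := by
    rw [hu]
    simp only
    rw [hw0, hw₀, invA_powA hβ hu₀]
  have hint : ∀ t, 0 ≤ t → u t = u₀ + ∫ s in 0..t, g s := by
    intro t ht
    rw [← sub_eq_iff_eq_add']
    refine fc_injective fun k => ?_
    have h1 := (fcLin k).intervalIntegral_comp_comm (μ := volume) (hgc.intervalIntegrable 0 t)
    rw [← fcLin_apply k (∫ s in 0..t, g s), ← h1]
    by_cases hk : k = 0
    · have hgH : ∀ s, fc (g s) 0 = 0 := by
        intro s
        have : g s ∈ H := by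
          rw [hgeq]
          exact H.neg_mem (H.add_mem (mulOp_mem_H _ (hwS.1 s)) (invA_mem_H _ (hyH s)))
        exact fc_zero_of_mem_H this
      subst hk
      simp only [fcLin_apply, hgH, intervalIntegral.integral_zero]
      rw [fc_sub, fc_zero_of_mem_H hu₀.1, fc_zero_of_mem_H (invA_mem_H _ (hwS.1 t)), sub_zero]
    · have hr := waveNorm_pos hk
      set r := waveNorm k with hrdef
      have hYc : Continuous fun s => fc (y s) k := (fcLin k).continuous.comp hyc
      have hW : ∀ t, 0 ≤ t → fc (w t) k = Real.exp (-(r ^ 2 * t)) • fc w₀ k -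
          ∫ τ in 0..t, (r * Real.exp (-(r ^ 2 * τ))) • fc (y (t - τ)) k := by
        intro t ht
        rw [hw t, max_eq_left ht, fc_sub, fc_mulOp (bdd_heatSymbol ht), fc_duhamel hyc hyH hyb]
        congr 1
        -- `smoothSymbol` vanishes at τ = 0, where the explicit kernel equals r; agreement on (0,t]
        -- suffices.
        refine intervalIntegral.integral_congr_ae (Filter.Eventually.of_forall fun τ hτ => ?_)
        rw [Set.uIoc_of_le ht] at hτ
        rw [smoothSymbol, if_pos hτ.1]
      have h2 := hasDerivAt_duhamel hYc r (fc w₀ k) (W := fun t => fc (w t) k) hW ht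
      rw [← hu0, fc_sub]
      simp only [hu]
      rw [fc_invA hβ, fc_invA hβ, ← smul_sub, h2, ← intervalIntegral.integral_smul]
      refine intervalIntegral.integral_congr fun s _ => ?_
      simp only [fcLin_apply, hgeq]
      rw [fc_neg, fc_add, fc_mulOp (bdd_rpow (by linarith)), fc_invA (by linarith), ← hrdef,
        smul_neg, smul_add, smul_smul, smul_smul]
      congr 3
      · rw [← Real.rpow_natCast, ← Real.rpow_add hr]
        congr 1
        push_cast
        ring
      · rw [← Real.rpow_add_one hr.ne']
        congr 1
        ring
  refine ⟨u, ⟨EReal.coe_lt_top 0, hu0, fun t _ _ => (hpow _ (by linarith) t).1, ?_,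
    fun t _ _ => (hpow _ (by linarith) t).1, ?_⟩, ?_⟩
  · have h : (fun t => powA (1 / 2) (u t)) =
        fun t => mulOp (fun r => r ^ (2 * (1 / 2) - 2 * (α + 1 / 2))) (w t) := by
      funext t
      exact (hpow _ (by linarith) t).2
    rw [h]
    exact ((mulOp _).continuous.comp w.continuous).continuousOn
  · intro t ht _
    have h1 : HasDerivAt (fun t => u₀ + ∫ s in 0..t, g s) (g t) t :=
      (intervalIntegral.integral_hasDerivAt_right (hgc.intervalIntegrable _ _)
        hgc.stronglyMeasurable.stronglyMeasurableAtFilter hgc.continuousAt).const_add u₀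
    refine h1.congr_of_eventuallyEq ?_
    filter_upwards [eventually_gt_nhds ht] with s hs
    exact hint s hs.le
  · intro σ t hσ hσt
    have ht : 0 ≤ t := by linarith
    obtain ⟨h1, h2⟩ := mem_gevreyClass_of_mem_decaySet (by positivity) hwS ht hσ (by linarith)
    obtain ⟨h3, h4⟩ := gevreyOp_invA hβ h1
    refine ⟨h3, ?_⟩
    unfold gevreyNorm at h2 ⊢
    rw [h4]
    exact h2

/-! ### Uniqueness -/

theorem en_neg (u : L2) (k : Fin 3 → ℤ) : en u (-k) = en u k := by
  have : ‖fc u (-k)‖ = ‖fc u k‖ := by simp [EuclideanSpace.norm_eq, fc_conj]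
  rw [en_eq, en_eq, this]

theorem ofReal_abs_inner_le (f w : L2) :
    ENNReal.ofReal |inner ℝ f w| ≤
      ENNReal.ofReal ((2 * Real.pi) ^ 3) * ∑' k, en f k * en w k := by
  have h := hasSum_inner_fc f w
  have hc : (0 : ℝ) < (2 * Real.pi) ^ 3 := by positivity
  have h1 : inner ℝ f w = (2 * Real.pi) ^ 3 * ∑' k, (inner ℂ (fc f k) (fc w k)).re := by
    rw [h.tsum_eq, mul_inv_cancel_left₀ hc.ne']
  rw [h1, abs_mul, abs_of_pos hc, ENNReal.ofReal_mul hc.le]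
  gcongr
  rw [← Real.norm_eq_abs, ofReal_norm]
  refine enorm_tsum_le_tsum_enorm.trans (ENNReal.tsum_le_tsum fun k => ?_)
  rw [← ofReal_norm, en_eq, en_eq, ← ENNReal.ofReal_mul (norm_nonneg _), Real.norm_eq_abs]
  exact ENNReal.ofReal_le_ofReal ((Complex.abs_re_le_norm _).trans (norm_inner_le_norm _ _))

theorem ofReal_gsymb_half (k : Fin 3 → ℤ) : ENNReal.ofReal (gsymb (1 / 2) 0 k) = kn k := by
  rw [gsymb_half, kn]

/-- The weight |j|^{-1}|l-j|^{-3/4} is square summable in j, uniformly in l, because 2 + 3/2 > 3.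
Any order between 1/4 and 1/2 would do in place of 3/8. -/
theorem tsum_conv_en_sq_le {a w : L2} (ha : a ∈ H) (hw : w ∈ H) :
    ∑' l, (∑' j, en a j * en w (l - j)) ^ 2 ≤
      2 * latticeSum (7 / 2) * (gsum (1 / 2) 0 a * gsum (3 / 8) 0 w) := by
  have hg : ∀ k, ∑' j, (kinv j * kinv (k - j) ^ (3 / 4 : ℝ)) ^ 2 ≤ 2 * latticeSum (7 / 2) := by
    intro k
    have h := tsum_kinv_conv_le (p := 2) (q := 3 / 2) (by norm_num) (by norm_num) k
    rw [show (2 : ℝ) + 3 / 2 = 7 / 2 by norm_num] at h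
    refine le_trans (le_of_eq (tsum_congr fun j => ?_)) h
    rw [mul_pow, ← ENNReal.rpow_natCast, ← ENNReal.rpow_natCast, ← ENNReal.rpow_mul]
    norm_num
  have h := tsum_conv_sq_le (g := fun j l => kinv j * kinv l ^ (3 / 4 : ℝ)) hg
    (fun j => ENNReal.ofReal (gsymb (1 / 2) 0 j) * en a j)
    (fun j => ENNReal.ofReal (gsymb (3 / 8) 0 j) * en w j)
  refine le_trans (le_of_eq (tsum_congr fun l => ?_)) h
  congr 1
  refine tsum_congr fun j => ?_
  by_cases hj : j = 0
  · rw [hj, en_zero_of_mem_H ha]; simp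
  by_cases hl : l - j = 0
  · rw [hl, en_zero_of_mem_H hw]; simp
  have h1 : ENNReal.ofReal (gsymb (3 / 8) 0 (l - j)) = kn (l - j) ^ (3 / 4 : ℝ) := by
    rw [gsymb, zero_mul, Real.exp_zero, mul_one, kn,
      ENNReal.ofReal_rpow_of_nonneg (waveNorm_nonneg _) (by norm_num)]
    norm_num
  rw [ofReal_gsymb_half, h1]
  calc en a j * en w (l - j) = (kinv j * kn j) * (kinv (l - j) * kn (l - j)) ^ (3 / 4 : ℝ) *
        (en a j * en w (l - j)) := by
        rw [kinv_mul_kn hj, kinv_mul_kn hl, ENNReal.one_rpow, one_mul, one_mul]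
    _ = _ := by
        rw [ENNReal.mul_rpow_of_nonneg _ _ (by norm_num)]
        ring

/-- The triple sum is regrouped around the frequency l of b, so that Cauchy–Schwarz in l isolates
|A^{1/2}b| and leaves the convolution of a and w. No cancellation in the trilinear form is used. -/
theorem tsum_en_bilin_mul_sq_le {a b w : L2} (ha : a ∈ domA 1) (hb : b ∈ domA (1 / 2))
    (hw : w ∈ H) :
    (∑' k, en (bilin a b) k * en w k) ^ 2 ≤
      gsum (1 / 2) 0 b * (2 * latticeSum (7 / 2) * (gsum (1 / 2) 0 a * gsum (3 / 8) 0 w)) := by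
  have h1 : ∑' k, en (bilin a b) k * en w k ≤
      ∑' l, (kn l * en b l) * ∑' j, en a j * en w (l - j) := by
    calc ∑' k, en (bilin a b) k * en w k
        ≤ ∑' k, ∑' j, en a j * (kn (k - j) * en b (k - j)) * en w k := by
          refine ENNReal.tsum_le_tsum fun k => ?_
          rw [ENNReal.tsum_mul_right]
          gcongr
          exact en_bilin_le ha hb k
      _ = ∑' j, ∑' l, en a j * (kn l * en b l) * en w (l + j) := by
          rw [ENNReal.tsum_comm]
          refine tsum_congr fun j => ?_
          rw [← (Equiv.addRight j).tsum_eq]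
          simp
      _ = ∑' l, (kn l * en b l) * ∑' j, en a j * en w (l + j) := by
          rw [ENNReal.tsum_comm]
          refine tsum_congr fun l => ?_
          rw [← ENNReal.tsum_mul_left]
          refine tsum_congr fun j => ?_
          ring
      _ = _ := by
          refine tsum_congr fun l => ?_
          -- The reflection j ↦ -j is free because |â(-j)| = |â(j)| for real fields.
          rw [← (Equiv.neg (Fin 3 → ℤ)).tsum_eq]
          simp [en_neg, sub_eq_add_neg]
  calc (∑' k, en (bilin a b) k * en w k) ^ 2
      ≤ (∑' l, (kn l * en b l) * ∑' j, en a j * en w (l - j)) ^ 2 := by gcongr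
    _ ≤ (∑' l, (kn l * en b l) ^ 2) * ∑' l, (∑' j, en a j * en w (l - j)) ^ 2 :=
        tsum_mul_sq_le _ _
    _ ≤ _ := by
        gcongr
        · refine le_of_eq (tsum_congr fun l => ?_)
          rw [ofReal_gsymb_half]
        · exact tsum_conv_en_sq_le ha.1 hw

/-- The trilinear estimate `|(B(a,b), w)| ≤ Q |A^{1/2} a| |A^{1/2} b| |A^{3/8} w|`. -/
theorem exists_trilinear_bound : ∃ Q : ℝ, 0 ≤ Q ∧ ∀ a ∈ domA 1, ∀ b ∈ domA (1 / 2),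
    ∀ w ∈ domA (3 / 8), |inner ℝ (bilin a b) w| ≤
      Q * gevreyNorm (1 / 2) 0 a * gevreyNorm (1 / 2) 0 b * gevreyNorm (3 / 8) 0 w := by
  set c : ℝ := (2 * Real.pi) ^ 3 with hc
  have hc0 : 0 < c := by positivity
  set Λ : ℝ := (latticeSum (7 / 2)).toReal with hΛ
  have hΛ' : latticeSum (7 / 2) = ENNReal.ofReal Λ :=
    (ENNReal.ofReal_toReal (latticeSum_lt_top (by norm_num)).ne).symm
  have hΛ0 : 0 ≤ Λ := ENNReal.toReal_nonneg
  refine ⟨Real.sqrt (2 * Λ * c⁻¹), by positivity, fun a ha b hb w hw => ?_⟩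
  have ha2 : a ∈ domA (1 / 2) := (gevreyClass_mono (by norm_num) le_rfl ha).1
  have h1 := ofReal_abs_inner_le (bilin a b) w
  have h2 := tsum_en_bilin_mul_sq_le ha hb hw.1
  have h3 : ENNReal.ofReal |inner ℝ (bilin a b) w| ^ 2 ≤ ENNReal.ofReal c ^ 2 *
      (gsum (1 / 2) 0 b * (2 * latticeSum (7 / 2) * (gsum (1 / 2) 0 a * gsum (3 / 8) 0 w))) := by
    calc _ ≤ (ENNReal.ofReal c * ∑' k, en (bilin a b) k * en w k) ^ 2 := by gcongr
      _ = ENNReal.ofReal c ^ 2 * (∑' k, en (bilin a b) k * en w k) ^ 2 := by ring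
      _ ≤ _ := by gcongr
  rw [gsum_eq hb, gsum_eq ha2, gsum_eq hw, hΛ', ← hc] at h3
  set x := gevreyNorm (1 / 2) 0 a
  set y := gevreyNorm (1 / 2) 0 b
  set z := gevreyNorm (3 / 8) 0 w
  have hx : 0 ≤ x := norm_nonneg _
  have hy : 0 ≤ y := norm_nonneg _
  have hz : 0 ≤ z := norm_nonneg _
  have hlat : (2 : ℝ≥0∞) * ENNReal.ofReal Λ = ENNReal.ofReal (2 * Λ) := by
    rw [ENNReal.ofReal_mul (by norm_num), ENNReal.ofReal_ofNat]
  rw [hlat, ← ENNReal.ofReal_pow (by positivity), ← ENNReal.ofReal_pow (by positivity),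
    ← ENNReal.ofReal_mul (by positivity),
    ← ENNReal.ofReal_mul (by positivity), ← ENNReal.ofReal_mul (by positivity),
    ← ENNReal.ofReal_mul (by positivity), ENNReal.ofReal_le_ofReal_iff (by positivity)] at h3
  refine le_of_sq_le_sq (h3.trans (le_of_eq ?_)) (by positivity)
  rw [mul_pow, mul_pow, mul_pow, Real.sq_sqrt (by positivity)]
  field_simp

theorem gevreyNorm_interpolation {w : L2} (hw : w ∈ domA (1 / 2)) {ε : ℝ} (hε : 0 < ε) :
    w ∈ domA (3 / 8) ∧ gevreyNorm (3 / 8) 0 w ^ 2 ≤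
      ε * gevreyNorm (1 / 2) 0 w ^ 2 + (ε ^ 3)⁻¹ * ‖w‖ ^ 2 := by
  have hm : w ∈ domA (3 / 8) := (gevreyClass_mono (by norm_num) le_rfl hw).1
  refine ⟨hm, ?_⟩
  have h1 := hasSum_gevreyNorm hm
  have h2 := ((hasSum_gevreyNorm hw).mul_left ε).add ((hasSum_fc_sq w).mul_left (ε ^ 3)⁻¹)
  have h3 := hasSum_le (fun k => ?_) h1 h2
  · have hc : (0 : ℝ) < ((2 * Real.pi) ^ 3)⁻¹ := by positivity
    refine le_of_mul_le_mul_left ?_ hc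
    linarith
  · have hr := waveNorm_nonneg k
    rw [mul_pow, mul_pow, gsymb_half, gsymb, zero_mul, Real.exp_zero, mul_one]
    obtain ⟨s, hs, hsr⟩ : ∃ s, 0 ≤ s ∧ waveNorm k = s ^ 2 :=
      ⟨Real.sqrt (waveNorm k), Real.sqrt_nonneg _, (Real.sq_sqrt hr).symm⟩
    have h4 : (waveNorm k ^ (2 * (3 / 8) : ℝ)) ^ 2 = s ^ 3 := by
      rw [hsr, ← Real.rpow_natCast, ← Real.rpow_natCast, ← Real.rpow_natCast, ← Real.rpow_mul hs,
        ← Real.rpow_mul hs]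
      norm_num
    rw [h4, hsr]
    -- With |k| = s²: if εs ≥ 1 then s³ ≤ εs⁴, and otherwise s³ ≤ ε⁻³.
    have h5 : s ^ 3 ≤ ε * (s ^ 2) ^ 2 + (ε ^ 3)⁻¹ := by
      have h6 : 0 < (ε ^ 3)⁻¹ := by positivity
      rcases le_total 1 (ε * s) with h | h
      · have : s ^ 3 * 1 ≤ s ^ 3 * (ε * s) := by gcongr
        nlinarith
      · have h7 : (ε * s) ^ 3 ≤ 1 := pow_le_one₀ (by positivity) h
        have h8 : s ^ 3 ≤ (ε ^ 3)⁻¹ := by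
          rw [← one_div, le_div_iff₀ (by positivity)]
          nlinarith
        have : 0 ≤ ε * (s ^ 2) ^ 2 := by positivity
        linarith
    calc s ^ 3 * ‖fc w k‖ ^ 2 ≤ (ε * (s ^ 2) ^ 2 + (ε ^ 3)⁻¹) * ‖fc w k‖ ^ 2 := by gcongr
      _ = _ := by ring

theorem inner_powA_one {w : L2} (hw : w ∈ domA 1) :
    inner ℝ (powA 1 w) w = gevreyNorm (1 / 2) 0 w ^ 2 := by
  have hw2 : w ∈ domA (1 / 2) := (gevreyClass_mono (by norm_num) le_rfl hw).1
  have h1 := hasSum_inner_fc (powA 1 w) w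
  have h2 := hasSum_gevreyNorm hw2
  have h3 : ∀ k, (inner ℂ (fc (powA 1 w) k) (fc w k)).re = (gsymb (1 / 2) 0 k * ‖fc w k‖) ^ 2 := by
    intro k
    rw [powA, (gevreyOp_spec hw).2, gsymb_one, gsymb_half,
      RCLike.real_smul_eq_coe_smul (K := ℂ), inner_smul_left, inner_self_eq_norm_sq_to_K]
    simp only [RCLike.conj_ofReal, mul_pow]
    norm_cast
  simp only [h3] at h1
  have hc : ((2 * Real.pi) ^ 3)⁻¹ ≠ 0 := by positivity
  exact mul_left_cancel₀ hc (h1.unique h2)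

/-- With w = v - u, B(v,v) - B(u,u) = B(v,w) + B(w,u). The trilinear bound, Young's inequality and
interpolation with ε = D⁻¹ produce 2|A^{1/2}w|², which the dissipation cancels, plus a multiple of
|w|². -/
theorem energy_estimate {Q L : ℝ} (hQ0 : 0 ≤ Q)
    (hQ : ∀ a ∈ domA 1, ∀ b ∈ domA (1 / 2), ∀ w ∈ domA (3 / 8), |inner ℝ (bilin a b) w| ≤
      Q * gevreyNorm (1 / 2) 0 a * gevreyNorm (1 / 2) 0 b * gevreyNorm (3 / 8) 0 w)
    {u v : L2} (hu : u ∈ domA 1) (hv : v ∈ domA 1)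
    (huL : gevreyNorm (1 / 2) 0 u ≤ L) (hvL : gevreyNorm (1 / 2) 0 v ≤ L) :
    2 * inner ℝ (v - u) (-(powA 1 v + bilin v v) - -(powA 1 u + bilin u u)) ≤
      4 * (1 + (Q * L) ^ 2 * 4) ^ 4 * ‖v - u‖ ^ 2 := by
  have hw := gevreyClass_sub hv hu
  have half : ∀ {x : L2}, x ∈ domA 1 → x ∈ domA (1 / 2) := fun hx =>
    (gevreyClass_mono (by norm_num) le_rfl hx).1
  set w := v - u with hwdef
  set D := 1 + (Q * L) ^ 2 * 4 with hD
  have hD1 : 1 ≤ D := by rw [hD]; nlinarith [sq_nonneg (Q * L)]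
  obtain ⟨hw8, hint⟩ := gevreyNorm_interpolation (half hw) (ε := D⁻¹) (by positivity)
  have e1 : -(powA 1 v + bilin v v) - -(powA 1 u + bilin u u) =
      -(powA 1 w + (bilin v w + bilin w u)) := by
    rw [hwdef, bilin_sub_left hv hu, bilin_sub_right hv (half hv) (half hu), powA, powA, powA,
      gevreyOp_sub hv hu]
    abel
  have h1 := hQ v hv w (half hw) w hw8
  have h2 := hQ w hw u (half hu) w hw8
  have h3 := inner_powA_one hw
  rw [e1, inner_neg_right, inner_add_right, inner_add_right, real_inner_comm (powA 1 w) w, h3,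
    real_inner_comm (bilin v w) w, real_inner_comm (bilin w u) w]
  set x := gevreyNorm (1 / 2) 0 w
  set z := gevreyNorm (3 / 8) 0 w
  have hx : 0 ≤ x := norm_nonneg _
  have hz : 0 ≤ z := norm_nonneg _
  have h4 : Q * gevreyNorm (1 / 2) 0 v * x * z ≤ Q * L * x * z := by gcongr
  have h5 : Q * x * gevreyNorm (1 / 2) 0 u * z ≤ Q * x * L * z := by gcongr
  have h6 := (neg_abs_le (inner ℝ (bilin v w) w)).trans' (neg_le_neg (h1.trans h4))
  have h7 := (neg_abs_le (inner ℝ (bilin w u) w)).trans' (neg_le_neg (h2.trans h5))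
  have h8 : 4 * (Q * L * x * z) ≤ x ^ 2 + (Q * L) ^ 2 * 4 * z ^ 2 := by
    nlinarith [sq_nonneg (x - 2 * (Q * L) * z)]
  have h9 : (Q * L) ^ 2 * 4 * z ^ 2 ≤ D * z ^ 2 := by
    gcongr; rw [hD]; linarith
  have h10 : D * z ^ 2 ≤ x ^ 2 + D ^ 4 * ‖w‖ ^ 2 := by
    calc D * z ^ 2 ≤ D * (D⁻¹ * x ^ 2 + (D⁻¹ ^ 3)⁻¹ * ‖w‖ ^ 2) := by gcongr
      _ = x ^ 2 + D ^ 4 * ‖w‖ ^ 2 := by field_simp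
  have h11 : 0 ≤ D ^ 4 * ‖w‖ ^ 2 := by positivity
  linarith

theorem continuousOn_of_regular {T : EReal} {u₀ : L2} {u : ℝ → L2}
    (hu : IsRegularSolution T u₀ u) : ContinuousOn u {t : ℝ | 0 ≤ t ∧ (t : EReal) < T} := by
  refine ((invA (1 / 2)).continuous.comp_continuousOn hu.continuous_V).congr fun t ht => ?_
  exact (invA_powA (by norm_num) (hu.mem_V t ht.1 ht.2)).symm

/-- Gronwall for |v-u|². Continuity into V bounds both solutions on the compact interval [0,t],
which fixes L. The equation is used only at positive times; at 0 continuity in H suffices. -/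
theorem regular_solution_unique {T T' : EReal} {u₀ : L2} {u v : ℝ → L2}
    (hu : IsRegularSolution T u₀ u) (hv : IsRegularSolution T' u₀ v) {t : ℝ} (ht : 0 ≤ t)
    (htT : (t : EReal) < T) (htT' : (t : EReal) < T') : v t = u t := by
  obtain ⟨Q, hQ0, hQ⟩ := exists_trilinear_bound
  have hsub : Set.Icc 0 t ⊆ {s : ℝ | 0 ≤ s ∧ (s : EReal) < T} := fun s hs =>
    ⟨hs.1, (EReal.coe_le_coe_iff.2 hs.2).trans_lt htT⟩
  have hsub' : Set.Icc 0 t ⊆ {s : ℝ | 0 ≤ s ∧ (s : EReal) < T'} := fun s hs =>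
    ⟨hs.1, (EReal.coe_le_coe_iff.2 hs.2).trans_lt htT'⟩
  obtain ⟨L₁, hL₁⟩ := isCompact_Icc.exists_bound_of_continuousOn (hu.continuous_V.mono hsub)
  obtain ⟨L₂, hL₂⟩ := isCompact_Icc.exists_bound_of_continuousOn (hv.continuous_V.mono hsub')
  set L := max L₁ L₂
  set κ := 4 * (1 + (Q * L) ^ 2 * 4) ^ 4 with hκ
  set F : ℝ → ℝ := fun s => Real.exp (-(κ * s)) * ‖v s - u s‖ ^ 2 with hF
  have hcu := (continuousOn_of_regular hu).mono hsub
  have hcv := (continuousOn_of_regular hv).mono hsub'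
  have hFc : ContinuousOn F (Set.Icc 0 t) := by
    refine ContinuousOn.mul (Continuous.continuousOn (by fun_prop)) ?_
    exact (hcv.sub hcu).norm.pow 2
  have hFd : ∀ s ∈ interior (Set.Icc 0 t), ∃ F', HasDerivAt F F' s ∧ F' ≤ 0 := by
    intro s hs
    rw [interior_Icc] at hs
    have hsm : s ∈ Set.Icc 0 t := ⟨hs.1.le, hs.2.le⟩
    have hsT := (hsub hsm).2
    have hsT' := (hsub' hsm).2
    have hd := (hv.equation s hs.1 hsT').sub (hu.equation s hs.1 hsT)
    have hE := hd.norm_sq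
    have hexp : HasDerivAt (fun s => Real.exp (-(κ * s))) (Real.exp (-(κ * s)) * (-κ)) s :=
      (((hasDerivAt_id' s).const_mul κ).fun_neg.exp).congr_deriv (by ring)
    refine ⟨_, hexp.mul hE, ?_⟩
    have h1 := energy_estimate hQ0 hQ (hu.mem_domA s hs.1 hsT) (hv.mem_domA s hs.1 hsT')
      ((hL₁ s hsm).trans (le_max_left _ _))
      ((hL₂ s hsm).trans (le_max_right _ _))
    rw [← hκ] at h1
    have h2 := Real.exp_pos (-(κ * s))
    simp only [Pi.sub_apply]
    nlinarith
  have hanti : AntitoneOn F (Set.Icc 0 t) := by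
    refine antitoneOn_of_deriv_nonpos (convex_Icc 0 t) hFc (fun s hs => ?_) fun s hs => ?_
    · obtain ⟨F', h, -⟩ := hFd s hs
      exact h.differentiableAt.differentiableWithinAt
    · obtain ⟨F', h, h'⟩ := hFd s hs
      rw [h.deriv]
      exact h'
  have h0 : F 0 = 0 := by
    simp [hF, hu.initial, hv.initial]
  have h1 := hanti (Set.left_mem_Icc.2 ht) (Set.right_mem_Icc.2 ht) ht
  rw [h0] at h1
  have h2 : ‖v t - u t‖ ^ 2 ≤ 0 := by
    have h3 := Real.exp_pos (-(κ * t))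
    by_contra h
    push Not at h
    have : 0 < F t := mul_pos h3 h
    linarith
  have h3 : ‖v t - u t‖ = 0 := by
    have := norm_nonneg (v t - u t)
    nlinarith
  exact sub_eq_zero.1 (norm_eq_zero.1 h3)

end

end NSE

theorem theorem2p3 :
    (∃ K : ℝ, NSE.IsBilinConstant K) ∧
    ∀ K : ℝ, NSE.IsBilinConstant K →
      ∀ (α : ℝ) (u₀ : NSE.L2), 1 / 2 ≤ α → u₀ ∈ NSE.domA (α + 1 / 2) →
        ‖NSE.powA (α + 1 / 2) u₀‖ < 1 / (12 * K ^ (α + 1 / 2)) →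
        ∃ u : ℝ → NSE.L2, NSE.IsRegularSolution ⊤ u₀ u ∧
          (∀ (T : EReal) (v : ℝ → NSE.L2), NSE.IsRegularSolution T u₀ v →
            ∀ t : ℝ, 0 ≤ t → (t : EReal) < T → v t = u t) ∧
          ∀ σ t : ℝ, 0 < σ → 24 * σ ≤ t →
            u t ∈ NSE.gevreyClass α σ ∧
            NSE.gevreyNorm α σ (u t) ≤
              Real.sqrt 2 * Real.exp (4 * σ) * ‖NSE.powA (α + 1 / 2) u₀‖ * Real.exp (-t) ∧
            NSE.gevreyNorm α σ (u t) ≤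
              Real.exp (4 * σ) / (6 * Real.sqrt 2 * K ^ (α + 1 / 2)) * Real.exp (-t) := by
  refine ⟨NSE.exists_isBilinConstant, fun K hK α u₀ hα hu₀ hsmall => ?_⟩
  obtain ⟨u, hu, hdecay⟩ := NSE.exists_regular_solution hK hα hu₀ hsmall
  refine ⟨u, hu, fun T v hv t ht htT =>
    NSE.regular_solution_unique hu hv ht (EReal.coe_lt_top t) htT, fun σ t hσ hσt => ?_⟩
  obtain ⟨h1, h2⟩ := hdecay σ t hσ.le hσt
  -- The solution is controlled at order α + 1/2; since |k| ≥ 1, the order may be lowered to α.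
  obtain ⟨h3, h4⟩ := NSE.gevreyClass_mono (show α ≤ α + 1 / 2 by linarith) le_rfl h1
  have hs2 : Real.sqrt 2 * Real.sqrt 2 = 2 := Real.mul_self_sqrt (by norm_num)
  have hs : 4 / 3 ≤ Real.sqrt 2 := Real.le_sqrt_of_sq_le (by norm_num)
  have hC : 0 < K ^ (α + 1 / 2) := Real.rpow_pos_of_pos (one_pos.trans_le hK.1) _
  have h5 : NSE.gevreyNorm α σ (u t) ≤
      Real.sqrt 2 * Real.exp (4 * σ) * ‖NSE.powA (α + 1 / 2) u₀‖ * Real.exp (-t) := by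
    calc NSE.gevreyNorm α σ (u t)
        ≤ 4 / 3 * ‖NSE.powA (α + 1 / 2) u₀‖ * Real.exp (σ - t) := h4.trans h2
      _ ≤ Real.sqrt 2 * ‖NSE.powA (α + 1 / 2) u₀‖ * Real.exp (4 * σ + -t) := by
          gcongr
          linarith
      _ = _ := by rw [Real.exp_add]; ring
  refine ⟨h3, h5, h5.trans ?_⟩
  gcongr
  calc Real.sqrt 2 * Real.exp (4 * σ) * ‖NSE.powA (α + 1 / 2) u₀‖
      ≤ Real.sqrt 2 * Real.exp (4 * σ) * (1 / (12 * K ^ (α + 1 / 2))) := by gcongr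
    -- Here √2/12 = 1/(6√2).
    _ = Real.exp (4 * σ) / (6 * Real.sqrt 2 * K ^ (α + 1 / 2)) := by
        rw [mul_one_div, div_eq_div_iff (by positivity) (by positivity)]
        linear_combination 6 * Real.exp (4 * σ) * K ^ (α + 1 / 2) * hs2
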